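/- **Setting.** Let $(M,J)$ be a smooth almost complex manifold with a Riemannian metric $g$ and let $\nabla$ be a smooth connection in $TM$ that is $g$-compatible and $J$-linear ($\nabla J=0$), with torsion $T_\nabla(X,Y)=\nabla_XY-\nabla_YX-[X,Y]$. Let $\exp:TM\to M$ be an exponential-like map: a smooth map such that $\exp|_M=\mathrm{id}_M$ on the zero section $M\subset TM$, and $d_x\exp=(\mathrm{id},\mathrm{id}):T_x(TM)=T_xM\oplus T_xM\to T_xM$ for every $x\in M$. For $v\in T_xM$ let $\Pi_v:T_xM\to T_{\exp(v)}M$ be the $\nabla$-parallel transport along $t\mapsto\exp(tv)$, $t\in[0,1]$. Let $(\Sigma,\mathfrak j)$ be a smooth almost complex manifold and $u:\Sigma\to M$ a smooth map. Write $\Gamma(u)=\Gamma(\Sigma;u^*TM)$, $\Gamma^1(u)=\Gamma(\Sigma;T^*\Sigma\otimes_{\mathbb R}u^*TM)$ and $\Gamma^{0,1}(u)=\{\eta\in\Gamma^1(u):\eta\circ\mathfrak j=-J\eta\}$ for the spaces of smooth sections, and let $\nabla^u$ be the connection induced by $\nabla$ in $u^*TM$. For $\xi\in\Gamma(u)$ put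 $\{\exp_u\xi\}(z)=\exp(\xi(z))$ and $$\bar\partial u=\tfrac12\big(du+J\circ du\circ\mathfrak j\big),\qquad \{\bar\partial_u\xi\}_z=\Pi_{\xi(z)}^{-1}\circ\{\bar\partial(\exp_u\xi)\}_z,$$ $$D_u\xi=\tfrac12\big(\nabla^u\xi+J\nabla^u_{\mathfrak j}\xi\big)-\tfrac12\big(T_\nabla(du,\xi)+J\,T_\nabla(du\circ\mathfrak j,\xi)\big),$$ and define $N(\xi)\in\Gamma^{0,1}(u)$ by $\bar\partial_u\xi=\bar\partial u+D_u\xi+N(\xi)$. For $C_0>0$, norms $\|\cdot\|_{p,1}$ on $\Gamma(u)$ and $\|\cdot\|_p$ on $\Gamma^1(u)$ are called $C_0$-admissible if for all $\xi\in\Gamma(u)$, all $\eta\in\Gamma^1(u)$ and all smooth sections $A$ of the bundle $\mathrm{End}_{\mathbb R}(u^*TM)$ (in particular $A=f\cdot\mathrm{id}$ with $f\in C^\infty(\Sigma;\mathbb R)$) $$\|A\eta\|_p\le\|A\|_{C^0}\|\eta\|_p,\quad \|\eta\circ\mathfrak j\|_p=\|\eta\|_p,\quad \|\nabla^u\xi\|_p\le\|\xi\|_{p,1},\quad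 \|\xi\|_{C^0}\le C_0\|\xi\|_{p,1},$$ where the $C^0$-norms are taken with respect to $g$, with the operator norm for $A$; the first condition is imposed when $\|A\|_{C^0}<\infty$, and the last one includes $\|\xi\|_{C^0}<\infty$. **Proposition.** (1) For every compact subset $K\subset M$ there exists $C_K\in C^\infty(\mathbb R;\mathbb R)$ with the following property. If $(\Sigma,\mathfrak j)$ is an almost complex manifold, $u:\Sigma\to M$ is a smooth map with $u(\Sigma)\subset K$, $C_0>0$, and $\|\cdot\|_{p,1}$, $\|\cdot\|_p$ are $C_0$-admissible norms on $\Gamma(u)$, $\Gamma^1(u)$, then for all $\xi,\xi'\in\Gamma(u)$ $$\|N(\xi)-N(\xi')\|_p\le C_K\big(C_0+\|du\|_p+\|\xi\|_{p,1}+\|\xi'\|_{p,1}\big)\big(\|\xi\|_{p,1}+\|\xi'\|_{p,1}\big)\|\xi-\xi'\|_{p,1}.$$ (2) For every smooth $u:\Sigma\to M$, $N(0)=0$, and $N(\xi)\in\Gamma^{0,1}(u)$ for every $\xi\in\Gamma(u)$. (3) Let $u:\Sigma\to M$ be smooth, $\xi\in\Gamma(u)$, $z\in\Sigma$, and let $\delta$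 be such that $|\xi(z)|<\delta$. Suppose that the $g$-ball $B$ of radius $\delta$ around $u(z)$, with the structures $J$, $\nabla$ and $\exp$, is isomorphic to an open subset $V$ of $\mathbb C^n$ with its standard structures; that is, there is a diffeomorphism $\varphi:B\to V$ that carries $J$ to the standard complex structure and $\nabla$ to the standard flat connection, and such that $\varphi(\exp(v))=\varphi(x)+d_x\varphi(v)$, with $\exp(v)\in B$, whenever $x\in B$, $v\in T_xM$ and the segment from $\varphi(x)$ to $\varphi(x)+d_x\varphi(v)$ lies in $V$. Then $\{N(\xi)\}_z=0$. -/

import Mathlib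

open Set Bundle
open scoped Manifold ContDiff Topology

universe u w

noncomputable section

namespace DbarExpansion

/-! ### Smooth sections along maps, almost complex structures, exponential-like maps -/

section General

variable {E : Type*} [NormedAddCommGroup E] [NormedSpace ℝ E]
  {H : Type*} [TopologicalSpace H] (I : ModelWithCorners ℝ E H)
  {E' : Type*} [NormedAddCommGroup E'] [NormedSpace ℝ E']
  {H' : Type*} [TopologicalSpace H'] (I' : ModelWithCorners ℝ E' H')
  {F : Type*} [NormedAddCommGroup F] [NormedSpace ℝ F]
  {G : Type*} [TopologicalSpace G] (IN : ModelWithCorners ℝ F G)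
  {M : Type*} [TopologicalSpace M] [ChartedSpace H M] [IsManifold I ∞ M]
  {M' : Type*} [TopologicalSpace M'] [ChartedSpace H' M'] [IsManifold I' ∞ M']
  {N : Type*} [TopologicalSpace N] [ChartedSpace G N]

/-- `ξ` is a smooth section of `f^* TM`, where `f : N → M`; i.e. `ξ ∈ Γ(f)`. -/
def IsSmoothAlong (f : N → M) (ξ : ∀ z : N, TangentSpace I (f z)) : Prop :=
  ContMDiff IN I.tangent ∞ (fun z => (⟨f z, ξ z⟩ : TangentBundle I M))

/-- `A` is a smooth section of the bundle `Hom_ℝ(f^* TM, h^* TM')` over `N`, where `f : N → M` and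
`h : N → M'`: near every point, the matrix of `A` with respect to the standard trivializations of
the tangent bundles is smooth. -/
def IsSmoothHom (f : N → M) (h : N → M')
    (A : ∀ z : N, TangentSpace I (f z) →L[ℝ] TangentSpace I' (h z)) : Prop :=
  ∀ z₀ : N, ContMDiffAt IN 𝓘(ℝ, E →L[ℝ] E') ∞ (inTangentCoordinates I I' f h A z₀) z₀

/-- `J` is a (smooth) almost complex structure on `M`. -/
structure IsAlmostComplex (J : ∀ x : M, TangentSpace I x →L[ℝ] TangentSpace I x) : Prop where
  smooth : IsSmoothHom I I I (id : M → M) (id : M → M) J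
  sq : ∀ (x : M) (v : TangentSpace I x), J x (J x v) = -v

/-- `exp : TM → M` is an exponential-like map: it is smooth, restricts to the identity on the zero
section, and its differential along the zero section is `(id, id)` on `T_x(TM) = T_xM ⊕ T_xM`.
(On the horizontal summand, tangent to the zero section, the differential is the identity because
`exp ⟨x, 0⟩ = x`; the last field is the condition on the vertical summand, where
`T_{exp ⟨x, 0⟩}M = T_xM` is the model space `E`.) -/
structure IsExponentialLike (exp : TangentBundle I M → M) : Prop where
  smooth : ContMDiff I.tangent I ∞ exp
  zero : ∀ x : M, exp ⟨x, 0⟩ = x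
  vertical : ∀ x : M, HasMFDerivAt 𝓘(ℝ, E) I
    (fun w : E => exp ⟨x, (w : TangentSpace I x)⟩) 0 (ContinuousLinearMap.id ℝ E)

/-- `p` restricts to a norm on the linear subspace `s` of `V` (its values off `s` are ignored). -/
structure IsNormOn {V : Type*} [AddCommGroup V] [Module ℝ V] (s : Set V) (p : V → ℝ) : Prop where
  add_le : ∀ x ∈ s, ∀ y ∈ s, p (x + y) ≤ p x + p y
  smul : ∀ (c : ℝ), ∀ x ∈ s, p (c • x) = |c| * p x
  eq_zero : ∀ x ∈ s, p x = 0 → x = 0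

end General

section Expansion

variable {m : ℕ} {M : Type*} [TopologicalSpace M] [ChartedSpace (EuclideanSpace ℝ (Fin m)) M]
  [IsManifold (𝓡 m) ∞ M]

/-- A connection in `TM` is `J`-linear: `∇_v (Jσ) = J (∇_v σ)`, i.e. `∇J = 0`. -/
def IsJLinear
    (nabla : CovariantDerivative (𝓡 m) (EuclideanSpace ℝ (Fin m))
      (TangentSpace (𝓡 m) : M → Type _))
    (J : ∀ x : M, TangentSpace (𝓡 m) x →L[ℝ] TangentSpace (𝓡 m) x) : Prop :=
  ∀ σ : (∀ x : M, TangentSpace (𝓡 m) x), IsSmoothAlong (𝓡 m) (𝓡 m) (id : M → M) σ →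
    ∀ (x : M) (v : TangentSpace (𝓡 m) x),
      nabla (fun y => J y (σ y)) x v = J x (nabla σ x v)

section Along

variable {F : Type*} [NormedAddCommGroup F] [NormedSpace ℝ F]
  {N : Type*} [TopologicalSpace N] [ChartedSpace F N]

/-- The pulled back connection `∇^f : Γ(f^* TM) → Γ(T^*N ⊗ f^* TM)`. At `z` it is computed in the
coordinate frame `(eᵢ)` of `TM` around `f z`: if `ξ = ∑ᵢ ξⁱ (eᵢ ∘ f)` near `z`, then
`∇^f ξ = ∑ᵢ (dξⁱ ⊗ eᵢ + ξⁱ ∇_{df} eᵢ)` at `z`. -/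
def covAlong
    (nabla : CovariantDerivative (𝓡 m) (EuclideanSpace ℝ (Fin m))
      (TangentSpace (𝓡 m) : M → Type _))
    (f : N → M) (ξ : ∀ z : N, TangentSpace (𝓡 m) (f z)) (z : N) :
    TangentSpace 𝓘(ℝ, F) z →L[ℝ] TangentSpace (𝓡 m) (f z) :=
  let e := trivializationAt (EuclideanSpace ℝ (Fin m)) (TangentSpace (𝓡 m) : M → Type _) (f z)
  let b := (EuclideanSpace.basisFun (Fin m) ℝ).toBasis
  ∑ i : Fin m,
    ((mvfderiv 𝓘(ℝ, F) (fun z' : N => e.localFrameCoeff (𝓡 m) b i (f z') (ξ z')) z).smulRight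
        (e.localFrame b i (f z)) +
      e.localFrameCoeff (𝓡 m) b i (f z) (ξ z) •
        (nabla (e.localFrame b i) (f z)).comp (mfderiv 𝓘(ℝ, F) (𝓡 m) f z))

end Along

/-- The curve `γ_v(t) = exp(tv)`, for `v ∈ T_xM`. -/
def expCurve (exp : TangentBundle (𝓡 m) M → M) (x : M) (v : TangentSpace (𝓡 m) x) (t : ℝ) : M :=
  exp ⟨x, t • v⟩

/-- The vector `w₁ ∈ T_{exp(v)}M` is the parallel transport of `w₀ ∈ T_xM` along `γ_v|_{[0,1]}`. -/
def IsParallelTransport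
    (nabla : CovariantDerivative (𝓡 m) (EuclideanSpace ℝ (Fin m))
      (TangentSpace (𝓡 m) : M → Type _))
    (exp : TangentBundle (𝓡 m) M → M) (x : M) (v : TangentSpace (𝓡 m) x)
    (w₀ : TangentSpace (𝓡 m) x) (w₁ : TangentSpace (𝓡 m) (exp ⟨x, v⟩)) : Prop :=
  ∃ ζ : ∀ t : ℝ, TangentSpace (𝓡 m) (expCurve exp x v t),
    IsSmoothAlong (𝓡 m) 𝓘(ℝ, ℝ) (expCurve exp x v) ζ ∧
    (∀ t ∈ Icc (0 : ℝ) 1, covAlong (F := ℝ) nabla (expCurve exp x v) ζ t = 0) ∧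
    (⟨expCurve exp x v 0, ζ 0⟩ : TangentBundle (𝓡 m) M) = ⟨x, w₀⟩ ∧
    (⟨expCurve exp x v 1, ζ 1⟩ : TangentBundle (𝓡 m) M) = ⟨exp ⟨x, v⟩, w₁⟩

instance (x y : M) : Nonempty (TangentSpace (𝓡 m) x ≃L[ℝ] TangentSpace (𝓡 m) y) :=
  ⟨ContinuousLinearEquiv.refl ℝ (EuclideanSpace ℝ (Fin m))⟩

/-- The parallel transport isomorphism `Π_v : T_xM → T_{exp(v)}M` along `γ_v`: the linear
isomorphism that sends every vector to its parallel transport. -/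
def parallelTransport
    (nabla : CovariantDerivative (𝓡 m) (EuclideanSpace ℝ (Fin m))
      (TangentSpace (𝓡 m) : M → Type _))
    (exp : TangentBundle (𝓡 m) M → M) (x : M) (v : TangentSpace (𝓡 m) x) :
    TangentSpace (𝓡 m) x ≃L[ℝ] TangentSpace (𝓡 m) (exp ⟨x, v⟩) :=
  Classical.epsilon fun P => ∀ w, IsParallelTransport nabla exp x v w (P w)

variable {d : ℕ} {S : Type*} [TopologicalSpace S] [ChartedSpace (EuclideanSpace ℝ (Fin d)) S]
  [IsManifold (𝓡 d) ∞ S]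

/-- `∂̄_{J,j} f = ½ (df + J ∘ df ∘ j)`. -/
def dbar (J : ∀ x : M, TangentSpace (𝓡 m) x →L[ℝ] TangentSpace (𝓡 m) x)
    (j : ∀ z : S, TangentSpace (𝓡 d) z →L[ℝ] TangentSpace (𝓡 d) z) (f : S → M) (z : S) :
    TangentSpace (𝓡 d) z →L[ℝ] TangentSpace (𝓡 m) (f z) :=
  (1 / 2 : ℝ) • (mfderiv (𝓡 d) (𝓡 m) f z +
    (J (f z)).comp ((mfderiv (𝓡 d) (𝓡 m) f z).comp (j z)))

/-- `D_{J,j;f} ξ = ½ (∇^f ξ + J ∇^f_j ξ) - ½ (T_∇(df, ξ) + J T_∇(df ∘ j, ξ))`. -/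
def linDbar
    (nabla : CovariantDerivative (𝓡 m) (EuclideanSpace ℝ (Fin m))
      (TangentSpace (𝓡 m) : M → Type _))
    (J : ∀ x : M, TangentSpace (𝓡 m) x →L[ℝ] TangentSpace (𝓡 m) x)
    (j : ∀ z : S, TangentSpace (𝓡 d) z →L[ℝ] TangentSpace (𝓡 d) z) (f : S → M)
    (ξ : ∀ z : S, TangentSpace (𝓡 m) (f z)) (z : S) :
    TangentSpace (𝓡 d) z →L[ℝ] TangentSpace (𝓡 m) (f z) :=
  let D := covAlong nabla f ξ z
  let τ : EuclideanSpace ℝ (Fin m) →L[ℝ] EuclideanSpace ℝ (Fin m) →L[ℝ]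
    EuclideanSpace ℝ (Fin m) := nabla.torsion (f z)
  let T : TangentSpace (𝓡 d) z →L[ℝ] TangentSpace (𝓡 m) (f z) :=
    (τ.flip (ξ z)).comp (mfderiv (𝓡 d) (𝓡 m) f z)
  (1 / 2 : ℝ) • (D + (J (f z)).comp (D.comp (j z))) -
    (1 / 2 : ℝ) • (T + (J (f z)).comp (T.comp (j z)))

/-- `{∂̄_f ξ}_z = Π_{ξ(z)}⁻¹ ∘ {∂̄_{J,j}(exp_f ξ)}_z`, where `{exp_f ξ}(z) = exp(ξ(z))`. -/
def dbarAt
    (nabla : CovariantDerivative (𝓡 m) (EuclideanSpace ℝ (Fin m))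
      (TangentSpace (𝓡 m) : M → Type _))
    (exp : TangentBundle (𝓡 m) M → M)
    (J : ∀ x : M, TangentSpace (𝓡 m) x →L[ℝ] TangentSpace (𝓡 m) x)
    (j : ∀ z : S, TangentSpace (𝓡 d) z →L[ℝ] TangentSpace (𝓡 d) z) (f : S → M)
    (ξ : ∀ z : S, TangentSpace (𝓡 m) (f z)) (z : S) :
    TangentSpace (𝓡 d) z →L[ℝ] TangentSpace (𝓡 m) (f z) :=
  ((parallelTransport nabla exp (f z) (ξ z)).symm :
      TangentSpace (𝓡 m) (exp ⟨f z, ξ z⟩) →L[ℝ] TangentSpace (𝓡 m) (f z)).comp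
    (dbar J j (fun z' : S => exp ⟨f z', ξ z'⟩) z)

/-- The remainder `N(ξ)` in the expansion `∂̄_f ξ = ∂̄_{J,j} f + D_{J,j;f} ξ + N(ξ)`. -/
def remainder
    (nabla : CovariantDerivative (𝓡 m) (EuclideanSpace ℝ (Fin m))
      (TangentSpace (𝓡 m) : M → Type _))
    (exp : TangentBundle (𝓡 m) M → M)
    (J : ∀ x : M, TangentSpace (𝓡 m) x →L[ℝ] TangentSpace (𝓡 m) x)
    (j : ∀ z : S, TangentSpace (𝓡 d) z →L[ℝ] TangentSpace (𝓡 d) z) (f : S → M)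
    (ξ : ∀ z : S, TangentSpace (𝓡 m) (f z)) (z : S) :
    TangentSpace (𝓡 d) z →L[ℝ] TangentSpace (𝓡 m) (f z) :=
  dbarAt nabla exp J j f ξ z - dbar J j f z - linDbar nabla J j f ξ z

/-- `η` is a smooth section of `T^*S^{0,1} ⊗_ℂ f^* TM`. -/
def IsZeroOneForm (J : ∀ x : M, TangentSpace (𝓡 m) x →L[ℝ] TangentSpace (𝓡 m) x)
    (j : ∀ z : S, TangentSpace (𝓡 d) z →L[ℝ] TangentSpace (𝓡 d) z) (f : S → M)
    (η : ∀ z : S, TangentSpace (𝓡 d) z →L[ℝ] TangentSpace (𝓡 m) (f z)) : Prop :=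
  IsSmoothHom (𝓡 d) (𝓡 m) (𝓡 d) (id : S → S) f η ∧
    ∀ (z : S) (v : TangentSpace (𝓡 d) z), η z (j z v) = -(J (f z) (η z v))

section Metric

variable [RiemannianBundle (fun x : M => TangentSpace (𝓡 m) x)]

/-- `normOne` (for `‖·‖_{p,1}`) and `normZero` (for `‖·‖_p`) are `C₀`-admissible norms on the
smooth sections of `f^* TM` and on the smooth `f^* TM`-valued one-forms on `S`. The condition
`endo` says `‖A η‖_p ≤ ‖A‖_{C⁰} ‖η‖_p` for every smooth field `A` of endomorphisms of `f^* TM`;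
for `A = h · id` it is the inequality `‖h η‖_p ≤ ‖h‖_{C⁰} ‖η‖_p` for functions `h`. -/
structure IsAdmissible
    (nabla : CovariantDerivative (𝓡 m) (EuclideanSpace ℝ (Fin m))
      (TangentSpace (𝓡 m) : M → Type _))
    (j : ∀ z : S, TangentSpace (𝓡 d) z →L[ℝ] TangentSpace (𝓡 d) z) (f : S → M) (C₀ : ℝ)
    (normOne : (∀ z : S, TangentSpace (𝓡 m) (f z)) → ℝ)
    (normZero : (∀ z : S, TangentSpace (𝓡 d) z →L[ℝ] TangentSpace (𝓡 m) (f z)) → ℝ) :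
    Prop where
  isNormOn_one : IsNormOn {ξ | IsSmoothAlong (𝓡 m) (𝓡 d) f ξ} normOne
  isNormOn_zero : IsNormOn
    {η | IsSmoothHom (𝓡 d) (𝓡 m) (𝓡 d) (id : S → S) f η} normZero
  endo : ∀ A : (∀ z : S, TangentSpace (𝓡 m) (f z) →L[ℝ] TangentSpace (𝓡 m) (f z)),
    IsSmoothHom (𝓡 m) (𝓡 m) (𝓡 d) f f A →
    ∀ c : ℝ, 0 ≤ c → (∀ (z : S) (w : TangentSpace (𝓡 m) (f z)), ‖A z w‖ ≤ c * ‖w‖) →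
    ∀ η : (∀ z : S, TangentSpace (𝓡 d) z →L[ℝ] TangentSpace (𝓡 m) (f z)),
      IsSmoothHom (𝓡 d) (𝓡 m) (𝓡 d) (id : S → S) f η →
      normZero (fun z => (A z).comp (η z)) ≤ c * normZero η
  comp_j : ∀ η : (∀ z : S, TangentSpace (𝓡 d) z →L[ℝ] TangentSpace (𝓡 m) (f z)),
    IsSmoothHom (𝓡 d) (𝓡 m) (𝓡 d) (id : S → S) f η → normZero (fun z => (η z).comp (j z)) = normZero η
  cov_le : ∀ ξ : (∀ z : S, TangentSpace (𝓡 m) (f z)),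
    IsSmoothAlong (𝓡 m) (𝓡 d) f ξ →
    normZero (covAlong nabla f ξ) ≤ normOne ξ
  sup_le : ∀ ξ : (∀ z : S, TangentSpace (𝓡 m) (f z)),
    IsSmoothAlong (𝓡 m) (𝓡 d) f ξ →
    ∀ z : S, ‖ξ z‖ ≤ C₀ * normOne ξ

instance [IsContMDiffRiemannianBundle (𝓡 m) ∞ (EuclideanSpace ℝ (Fin m))
      (fun x : M => TangentSpace (𝓡 m) x)] :
    IsContMDiffRiemannianBundle (𝓡 m) 1 (EuclideanSpace ℝ (Fin m))
      (fun x : M => TangentSpace (𝓡 m) x) :=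
  IsContMDiffRiemannianBundle.of_le (n := ∞) (by exact_mod_cast le_top)

variable (m) in
/-- The open ball of radius `δ` around `x` for the distance induced by the Riemannian metric. -/
def riemannianBall (x : M) (δ : ℝ) : Set M :=
  {y | Manifold.riemannianEDist (𝓡 m) x y < ENNReal.ofReal δ}

end Metric

/-- The open subset `B` of `M`, with the restrictions of `J`, `∇` and `exp`, is isomorphic to an
open subset `V` of `ℂⁿ` with its standard complex structure, its standard flat connection, and its
standard exponential map `(y, w) ↦ y + w`, which is defined for those `w` for which the segment
from `y` to `y + w` lies in `V`. -/
def IsStandardOn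
    (nabla : CovariantDerivative (𝓡 m) (EuclideanSpace ℝ (Fin m))
      (TangentSpace (𝓡 m) : M → Type _))
    (exp : TangentBundle (𝓡 m) M → M)
    (J : ∀ x : M, TangentSpace (𝓡 m) x →L[ℝ] TangentSpace (𝓡 m) x) (B : Set M) : Prop :=
  ∃ (n : ℕ) (φ : OpenPartialHomeomorph M (EuclideanSpace ℂ (Fin n))),
    φ.source = B ∧
    ContMDiffOn (𝓡 m) 𝓘(ℝ, EuclideanSpace ℂ (Fin n)) ∞ φ φ.source ∧
    ContMDiffOn 𝓘(ℝ, EuclideanSpace ℂ (Fin n)) (𝓡 m) ∞ φ.symm φ.target ∧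
    -- complex structure
    (∀ x ∈ B, ∀ v : TangentSpace (𝓡 m) x,
      mvfderiv (𝓡 m) φ x (J x v) = Complex.I • mvfderiv (𝓡 m) φ x v) ∧
    -- connection
    (∀ σ : (∀ x : M, TangentSpace (𝓡 m) x), IsSmoothAlong (𝓡 m) (𝓡 m) (id : M → M) σ →
      ∀ x ∈ B, ∀ v : TangentSpace (𝓡 m) x,
        mvfderiv (𝓡 m) φ x (nabla σ x v) =
          fderiv ℝ (fun y => mvfderiv (𝓡 m) φ (φ.symm y) (σ (φ.symm y))) (φ x)
            (mvfderiv (𝓡 m) φ x v)) ∧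
    -- exponential map
    (∀ x ∈ B, ∀ v : TangentSpace (𝓡 m) x,
      segment ℝ (φ x) (φ x + mvfderiv (𝓡 m) φ x v) ⊆ φ.target →
        exp ⟨x, v⟩ = φ.symm (φ x + mvfderiv (𝓡 m) φ x v))

end Expansion

end DbarExpansion

end

/-! The heart of the matter is an exact formula for `Π_ξ⁻¹ ∘ d(exp_u ξ)`. Differentiating `exp ∘ ξ`
along the horizontal and vertical directions that `∇` defines in `T(TM)`, and transporting back to
the base point, gives `H(ξ) du + V(ξ) ∇ξ`. Here `H(v)` and `V(v)` are endomorphisms of `T_xM` that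
depend smoothly on `v ∈ T_xM` and not on `u`. Since `d exp = (id, id)` along the zero section, `H(0)
= V(0) = id`. The identity `D_t ∂_s α - D_s ∂_t α = T(∂_t α, ∂_s α)` (`covDeriv_vel_sub`) shows that
`dH(0)v = T(v, ·)` (`TangentFrame.s_fderiv_matH`). Hence `Π_ξ⁻¹ d(exp_u ξ) = du + ∇ξ - T(du, ξ) +
η(ξ)`, where `η(ξ) = (H(ξ) - H(0) - dH(0)ξ) du + (V(ξ) - V(0)) ∇ξ`. Because `∇J = 0`, transport
commutes with `J`, so `N(ξ)` is the `(0,1)`-part of `η(ξ)` (`remainder_eq_zeroOnePart`). Part (2)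
can be read off from this.

For part (1), the coefficient of `du` vanishes to second order in `v` and the coefficient of `∇ξ` to
first order, uniformly for `x ∈ K` and `|v| ≤ R` (`exists_higherOrderBound`). The admissibility
conditions turn these pointwise bounds into norm bounds (`normZero_higherOrder_sub_le`). The radius
`R` is controlled by `C₀‖ξ‖`, hence by the argument of `C_K`. The constants obtained for integer
radii are majorised by one smooth function (`exists_contDiff_majorant_ceil`).

No single chart need contain the curves `exp(tv)`, so the calculations are made in finitely many
vector fields spanning `TM` over a neighbourhood of a compact set (`exists_tangentFrame`). In their
coefficients parallel transport solves a linear differential equation with parameters. Smooth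
dependence on the parameters comes from inverting `1 - T`, with `T` a Volterra operator on a Banach
space of continuous functions (`exists_smooth_fundamentalSolution`).

For part (3), in the flat chart `exp` is addition, `∇` is differentiation and the torsion vanishes,
so `Π_ξ⁻¹ d(exp_u ξ) = du + ∇ξ` and `η = 0`. What needs an argument is that the segment from `u(z)`
in direction `ξ(z)` stays inside the chart. By metric compatibility its speed is constant, so its
length is below `δ` and it cannot leave the ball (`IsFlatChart.segment_subset`). -/

namespace DbarExpansion

/-! ### Linear differential equations with smooth parameters -/

section LinearODE

open MeasureTheory

variable {l r : ℝ} {𝔸 : Type*} [NormedRing 𝔸] [NormedAlgebra ℝ 𝔸] [CompleteSpace 𝔸]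

omit [NormedAlgebra ℝ 𝔸] [CompleteSpace 𝔸] in
lemma continuous_comp_projIcc (hlr : l ≤ r) (u : C(Icc l r, 𝔸)) :
    Continuous fun s : ℝ => u (projIcc l r hlr s) :=
  u.continuous.comp continuous_projIcc

/-- The Volterra operator `u ↦ (t ↦ ∫_{t₀}^t u)`. -/
noncomputable def volterra (hlr : l ≤ r) (t₀ : ℝ) : C(Icc l r, 𝔸) →L[ℝ] C(Icc l r, 𝔸) :=
  LinearMap.mkContinuousOfExistsBound
    { toFun := fun u =>
        ⟨fun t => ∫ s in t₀..(t : ℝ), u (projIcc l r hlr s),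
          (intervalIntegral.continuous_primitive
            (fun _ _ => (continuous_comp_projIcc hlr u).intervalIntegrable _ _) t₀).comp
            continuous_subtype_val⟩
      map_add' := fun u v => by
        ext t
        exact intervalIntegral.integral_add
          ((continuous_comp_projIcc hlr u).intervalIntegrable _ _)
          ((continuous_comp_projIcc hlr v).intervalIntegrable _ _)
      map_smul' := fun c u => by
        ext t
        exact intervalIntegral.integral_smul c _ }
    (by
      refine ⟨|l - t₀| + |r - t₀|, fun u => ?_⟩
      refine (ContinuousMap.norm_le _ (by positivity)).2 fun t => ?_
      refine (intervalIntegral.norm_integral_le_of_norm_le_const (C := ‖u‖)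
        fun s _ => u.norm_coe_le_norm _).trans ?_
      rw [mul_comm]
      refine mul_le_mul_of_nonneg_right ?_ (norm_nonneg _)
      have h1 := t.2.1
      have h2 := t.2.2
      rcases abs_cases ((t : ℝ) - t₀) with h | h <;> rcases abs_cases (l - t₀) with h' | h' <;>
        rcases abs_cases (r - t₀) with h'' | h'' <;> linarith)

/-- The operator `u ↦ (t ↦ ∫_{t₀}^t α u)`. -/
noncomputable def volterraMul (hlr : l ≤ r) (t₀ : ℝ) :
    C(Icc l r, 𝔸) →L[ℝ] C(Icc l r, 𝔸) →L[ℝ] C(Icc l r, 𝔸) :=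
  (ContinuousLinearMap.compL ℝ _ _ _ (volterra hlr t₀)).comp
    (ContinuousLinearMap.mul ℝ C(Icc l r, 𝔸))

lemma volterraMul_apply (hlr : l ≤ r) (t₀ : ℝ) (α u : C(Icc l r, 𝔸)) (t : Icc l r) :
    volterraMul hlr t₀ α u t =
      ∫ s in t₀..(t : ℝ), α (projIcc l r hlr s) * u (projIcc l r hlr s) := rfl

/-- The factorial is the volume of the simplex of ordered times in the iterated integral. It makes
high powers of the operator small however long the interval and however large `α`. -/
lemma norm_volterraMul_pow_apply_le (hlr : l ≤ r) {t₀ : ℝ} (ht₀ : t₀ ∈ Icc l r)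
    (α u : C(Icc l r, 𝔸)) (n : ℕ) (t : Icc l r) :
    ‖((volterraMul hlr t₀ α) ^ n) u t‖ ≤
      (‖α‖ * |(t : ℝ) - t₀|) ^ n / n.factorial * ‖u‖ := by
  induction n generalizing t with
  | zero => simpa using u.norm_coe_le_norm t
  | succ n hn =>
    rw [pow_succ', mul_apply_eq_comp, volterraMul_apply]
    calc
      _ ≤ ∫ τ in uIoc t₀ t.1, ‖α‖ ^ (n + 1) * |τ - t₀| ^ n / n.factorial * ‖u‖ := by
        rw [intervalIntegral.norm_intervalIntegral_eq]
        apply MeasureTheory.norm_integral_le_of_norm_le (Continuous.integrableOn_uIoc (by fun_prop))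
        apply ae_restrict_mem measurableSet_Ioc |>.mono
        intro t' ht'
        have ht' : t' ∈ Icc l r :=
          subset_trans uIoc_subset_uIcc (uIcc_subset_Icc ht₀ t.2) ht'
        rw [projIcc_of_mem hlr ht']
        refine (norm_mul_le _ _).trans ?_
        refine (mul_le_mul (α.norm_coe_le_norm _) (hn ⟨t', ht'⟩) (norm_nonneg _)
          (norm_nonneg _)).trans_eq ?_
        simp only
        rw [mul_pow, pow_succ']
        ring
      _ ≤ (‖α‖ * |t.1 - t₀|) ^ (n + 1) / (n + 1).factorial * ‖u‖ := by
        apply le_of_abs_le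
        rw [← intervalIntegral.abs_intervalIntegral_eq, intervalIntegral.integral_mul_const,
          intervalIntegral.integral_div, intervalIntegral.integral_const_mul, abs_mul, abs_div,
          abs_mul, intervalIntegral.abs_intervalIntegral_eq, integral_pow_abs_sub_uIoc, abs_div,
          abs_pow, abs_pow, abs_norm, abs_norm, abs_abs, mul_div, div_div, ← abs_mul,
          ← Nat.cast_succ, ← Nat.cast_mul, ← Nat.factorial_succ, Nat.abs_cast, ← mul_pow]

/-- Some power satisfies `‖T ^ n‖ < 1`, so `1 - T ^ n` is a unit. It is the product of `1 - T` with
a geometric sum that commutes with it, so `1 - T` is a unit too. -/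
lemma isUnit_one_sub_volterraMul (hlr : l ≤ r) {t₀ : ℝ} (ht₀ : t₀ ∈ Icc l r)
    (α : C(Icc l r, 𝔸)) : IsUnit (1 - volterraMul hlr t₀ α) := by
  set T := volterraMul hlr t₀ α
  obtain ⟨n, hn⟩ : ∃ n, ‖T ^ n‖ < 1 := by
    obtain ⟨n, hn⟩ := ((FloorSemiring.tendsto_pow_div_factorial_atTop
      (‖α‖ * (r - l))).eventually (gt_mem_nhds one_pos)).exists
    refine ⟨n, lt_of_le_of_lt (ContinuousLinearMap.opNorm_le_bound _ ?_ fun u => ?_) hn⟩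
    · have := sub_nonneg.2 hlr
      positivity
    · have h0 : 0 ≤ r - l := sub_nonneg.2 hlr
      refine (ContinuousMap.norm_le _ (by positivity)).2 fun t => ?_
      refine (norm_volterraMul_pow_apply_le hlr ht₀ α u n t).trans ?_
      gcongr
      rw [abs_le]
      constructor <;> linarith [t.2.1, t.2.2, ht₀.1, ht₀.2]
  have h1 := isUnit_one_sub_of_norm_lt_one (R := C(Icc l r, 𝔸) →L[ℝ] C(Icc l r, 𝔸)) hn
  rw [← mul_neg_geom_sum] at h1
  refine ((Commute.isUnit_mul_iff ?_).1 h1).1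
  refine Commute.sum_right _ _ _ fun i _ => ?_
  exact Commute.sub_left (R := C(Icc l r, 𝔸) →L[ℝ] C(Icc l r, 𝔸)) (Commute.one_left _)
    ((Commute.refl T).pow_right i)

/-- The solution `Φ` of `Φ' = α Φ`, `Φ(t₀) = 1`. -/
noncomputable def fundamentalSolution (hlr : l ≤ r) (t₀ : ℝ) (α : C(Icc l r, 𝔸)) :
    C(Icc l r, 𝔸) :=
  Ring.inverse (1 - volterraMul hlr t₀ α) 1

lemma fundamentalSolution_apply (hlr : l ≤ r) {t₀ : ℝ} (ht₀ : t₀ ∈ Icc l r)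
    (α : C(Icc l r, 𝔸)) (t : Icc l r) :
    fundamentalSolution hlr t₀ α t = 1 + ∫ s in t₀..(t : ℝ), α (projIcc l r hlr s) *
      fundamentalSolution hlr t₀ α (projIcc l r hlr s) := by
  have h := Ring.mul_inverse_cancel _ (isUnit_one_sub_volterraMul hlr ht₀ α)
  have h2 := congrArg (fun A : C(Icc l r, 𝔸) →L[ℝ] C(Icc l r, 𝔸) => A 1 t) h
  simp only [mul_apply_eq_comp] at h2
  change fundamentalSolution hlr t₀ α t -
    volterraMul hlr t₀ α (fundamentalSolution hlr t₀ α) t = 1 at h2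
  rw [volterraMul_apply, sub_eq_iff_eq_add] at h2
  exact h2

lemma fundamentalSolution_self (hlr : l ≤ r) {t₀ : ℝ} (ht₀ : t₀ ∈ Icc l r)
    (α : C(Icc l r, 𝔸)) : fundamentalSolution hlr t₀ α ⟨t₀, ht₀⟩ = 1 := by
  rw [fundamentalSolution_apply hlr ht₀]
  simp

/-- Restricted to the open interval because `projIcc` freezes the solution beyond `l` and `r`. -/
lemma hasDerivAt_fundamentalSolution (hlr : l ≤ r) {t₀ : ℝ} (ht₀ : t₀ ∈ Icc l r)
    (α : C(Icc l r, 𝔸)) {t : ℝ} (ht : t ∈ Ioo l r) :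
    HasDerivAt (fun s => fundamentalSolution hlr t₀ α (projIcc l r hlr s))
      (α (projIcc l r hlr t) * fundamentalSolution hlr t₀ α (projIcc l r hlr t)) t := by
  set Φ := fundamentalSolution hlr t₀ α
  have hc : Continuous fun s : ℝ => α (projIcc l r hlr s) * Φ (projIcc l r hlr s) :=
    (continuous_comp_projIcc hlr α).mul (continuous_comp_projIcc hlr Φ)
  have h := (intervalIntegral.integral_hasDerivAt_right (hc.intervalIntegrable t₀ t)
    (hc.stronglyMeasurableAtFilter _ _) hc.continuousAt).const_add (1 : 𝔸)
  refine h.congr_of_eventuallyEq ?_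
  filter_upwards [Ioo_mem_nhds ht.1 ht.2] with s hs
  rw [fundamentalSolution_apply hlr ht₀]
  simp only [projIcc_of_mem hlr (Ioo_subset_Icc_self hs)]
  rfl

-- Inversion is smooth on the units of a Banach algebra and `volterraMul` is linear in `α`, so
-- smooth dependence on the coefficient needs no flow theory.
set_option synthInstance.maxHeartbeats 400000 in
lemma contDiff_fundamentalSolution (hlr : l ≤ r) {t₀ : ℝ} (ht₀ : t₀ ∈ Icc l r) :
    ContDiff ℝ ∞ (fundamentalSolution (𝔸 := 𝔸) hlr t₀) := by
  rw [contDiff_iff_contDiffAt]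
  intro α
  obtain ⟨x, hx⟩ := isUnit_one_sub_volterraMul hlr ht₀ α
  have h1 := contDiffAt_ringInverse ℝ (n := ∞) (R := C(Icc l r, 𝔸) →L[ℝ] C(Icc l r, 𝔸)) x
  rw [hx] at h1
  have h3 : ContDiff ℝ ∞ (fun β : C(Icc l r, 𝔸) => volterraMul hlr t₀ β) := by
    fun_prop
  have h2 : ContDiffAt ℝ ∞ (fun β : C(Icc l r, 𝔸) => 1 - volterraMul hlr t₀ β) α :=
    contDiffAt_const.sub h3.contDiffAt
  exact (ContDiffAt.comp α h1 h2).clm_apply contDiffAt_const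

end LinearODE

/-! ### Smooth functions of a parameter and time as smooth maps into continuous functions of time -/

section Curry

variable {K : Type*} [TopologicalSpace K]

open Classical in
/-- A function on `X × K` seen as a map to the space of continuous functions on `K`. -/
noncomputable def curryMap {X W : Type*} [Zero W] [TopologicalSpace W] (a : X → K → W) (x : X) :
    C(K, W) :=
  if h : Continuous (a x) then ⟨a x, h⟩ else 0

lemma curryMap_apply {X W : Type*} [Zero W] [TopologicalSpace W] {a : X → K → W} {x : X}
    (h : Continuous (a x)) (t : K) : curryMap a x t = a x t := by
  simp [curryMap, h]

variable [CompactSpace K]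

omit [CompactSpace K] in
lemma continuousOn_curryMap {X W : Type*} [TopologicalSpace X] [Zero W] [TopologicalSpace W]
    {U : Set X} {a : X → K → W} (ha : ContinuousOn (Function.uncurry a) (U ×ˢ univ)) :
    ContinuousOn (curryMap a) U := by
  rw [continuousOn_iff_continuous_domRestrict]
  have hc : Continuous fun q : U × K => a q.1 q.2 := by
    rw [continuousOn_iff_continuous_domRestrict] at ha
    exact ha.comp (f := fun q : U × K => (⟨(q.1.1, q.2), ⟨q.1.2, mem_univ _⟩⟩ :
      (U ×ˢ univ : Set (X × K)))) (by fun_prop)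
  convert (ContinuousMap.curry ⟨_, hc⟩).continuous using 1
  ext x t
  rw [Set.domRestrict_apply, curryMap_apply]
  · rfl
  · exact hc.comp (f := fun t : K => (x, t)) (by fun_prop)

noncomputable instance (P W : Type*) [NormedAddCommGroup P] [NormedSpace ℝ P]
    [NormedAddCommGroup W] [NormedSpace ℝ W] : NormedAddCommGroup C(K, P →L[ℝ] W) :=
  ContinuousMap.instNormedAddCommGroup

/-- The map `C(K, P →L W) → (P →L C(K, W))`. -/
noncomputable def flipMap (K P W : Type*) [TopologicalSpace K] [CompactSpace K]
    [NormedAddCommGroup P] [NormedSpace ℝ P] [NormedAddCommGroup W] [NormedSpace ℝ W] :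
    C(K, P →L[ℝ] W) →L[ℝ] P →L[ℝ] C(K, W) :=
  LinearMap.mkContinuous₂
    (LinearMap.mk₂ ℝ (fun (ψ : C(K, P →L[ℝ] W)) (e : P) =>
        (⟨fun t => ψ t e, ψ.continuous.clm_apply continuous_const⟩ : C(K, W)))
      (fun ψ φ e => by ext; simp) (fun c ψ e => by ext; simp)
      (fun ψ e e' => by ext; simp) (fun c ψ e => by ext; simp)) 1
    (fun ψ e => by
      rw [one_mul]
      refine (ContinuousMap.norm_le _ (by positivity)).2 fun t => ?_
      exact ((ψ t).le_opNorm e).trans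
        (mul_le_mul_of_nonneg_right (ψ.norm_coe_le_norm t) (norm_nonneg _)))

lemma flipMap_apply {P W : Type*}
    [NormedAddCommGroup P] [NormedSpace ℝ P] [NormedAddCommGroup W] [NormedSpace ℝ W]
    (ψ : C(K, P →L[ℝ] W)) (e : P) (t : K) : flipMap K P W ψ e t = ψ t e := rfl

/-- The mean value inequality is applied for each `t` on one ball around `p`. On that ball `a'` is
within `ε` of its value at `p` uniformly in `t`, because on a compact `K` the topology of `C(K, ·)`
is that of the sup norm. -/
lemma hasFDerivAt_curryMap {P W : Type*}
    [NormedAddCommGroup P] [NormedSpace ℝ P] [NormedAddCommGroup W] [NormedSpace ℝ W]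
    {U : Set P} (hU : IsOpen U) {a : P → K → W} {a' : P → K → P →L[ℝ] W}
    (ha : ContinuousOn (Function.uncurry a) (U ×ˢ univ))
    (ha' : ContinuousOn (Function.uncurry a') (U ×ˢ univ))
    (h : ∀ p ∈ U, ∀ t, HasFDerivAt (fun q => a q t) (a' p t) p) {p : P} (hp : p ∈ U) :
    HasFDerivAt (curryMap a) (flipMap K P W (curryMap a' p)) p := by
  have hcont : ∀ q ∈ U, Continuous (a q) := fun q hq =>
    continuousOn_univ.1 (ha.comp (f := fun t : K => (q, t)) (by fun_prop)
      fun t _ => ⟨hq, mem_univ _⟩)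
  have hcont' : ∀ q ∈ U, Continuous (a' q) := fun q hq =>
    continuousOn_univ.1 (ha'.comp (f := fun t : K => (q, t)) (by fun_prop)
      fun t _ => ⟨hq, mem_univ _⟩)
  rw [hasFDerivAt_iff_isLittleO_nhds_zero, Asymptotics.isLittleO_iff]
  intro ε hε
  have hca : ContinuousAt (curryMap a') p :=
    (continuousOn_curryMap ha').continuousAt (hU.mem_nhds hp)
  obtain ⟨δ, hδ, hball⟩ : ∃ δ > 0, ∀ q ∈ Metric.ball p δ, q ∈ U ∧
      ‖curryMap a' q - curryMap a' p‖ ≤ ε := by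
    obtain ⟨δ, hδ, hb⟩ := Metric.mem_nhds_iff.1 (Filter.inter_mem (hU.mem_nhds hp)
      (hca (Metric.closedBall_mem_nhds _ hε)))
    refine ⟨δ, hδ, fun q hq => ⟨(hb hq).1, ?_⟩⟩
    have := (hb hq).2
    rwa [mem_preimage, mem_closedBall_iff_norm] at this
  filter_upwards [Metric.ball_mem_nhds (0 : P) hδ] with e he
  have hpe : p + e ∈ Metric.ball p δ := by simpa using he
  refine (ContinuousMap.norm_le _ (by positivity)).2 fun t => ?_
  have := Convex.norm_image_sub_le_of_norm_hasFDerivWithin_le' (f := fun q => a q t)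
    (f' := fun q => a' q t) (φ := a' p t) (C := ε) (s := Metric.ball p δ) (x := p) (y := p + e)
    (fun q hq => (h q (hball q hq).1 t).hasFDerivWithinAt) (fun q hq => ?_)
    (convex_ball _ _) (Metric.mem_ball_self hδ) hpe
  · rw [add_sub_cancel_left] at this
    simpa only [ContinuousMap.sub_apply, curryMap_apply (hcont _ (hball _ hpe).1),
      curryMap_apply (hcont _ hp), flipMap_apply, curryMap_apply (hcont' _ hp)] using this
  · refine le_trans ?_ (hball q hq).2
    have := (curryMap a' q - curryMap a' p).norm_coe_le_norm t
    simpa only [ContinuousMap.sub_apply, curryMap_apply (hcont' _ (hball q hq).1),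
      curryMap_apply (hcont' _ hp)] using this

-- The derivative of the curried map is the curried partial derivative, followed by the continuous
-- linear map `flipMap`. The induction replaces `W` by `P →L[ℝ] W`, hence the quantification over
-- `W` after `n` and the common universe of `P` and `W`.
set_option synthInstance.maxHeartbeats 400000 in
lemma contDiffOn_curryMap_nat {P : Type u} [NormedAddCommGroup P] [NormedSpace ℝ P]
    {K : Set ℝ} [CompactSpace K] {U : Set P} (hU : IsOpen U) (n : ℕ) :
    ∀ {W : Type u} [NormedAddCommGroup W] [NormedSpace ℝ W] {a : P × ℝ → W},
      ContDiffOn ℝ n a (U ×ˢ univ) →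
      ContDiffOn ℝ n (curryMap fun p (t : K) => a (p, t)) U := by
  have hsub : ∀ {W : Type u} [NormedAddCommGroup W] {b : P × ℝ → W},
      ContinuousOn b (U ×ˢ univ) →
      ContinuousOn (Function.uncurry fun p (t : K) => b (p, t)) (U ×ˢ univ) := fun hb =>
    hb.comp (f := fun q : P × K => (q.1, (q.2 : ℝ))) (by fun_prop)
      fun q hq => ⟨hq.1, mem_univ _⟩
  have hUu : IsOpen (U ×ˢ (univ : Set ℝ)) := hU.prod isOpen_univ
  induction n with
  | zero =>
    intro W _ _ a ha
    simp only [Nat.cast_zero, contDiffOn_zero] at ha ⊢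
    exact continuousOn_curryMap (hsub ha)
  | succ n ih =>
    intro W _ _ a ha
    have ha1 := ha
    rw [Nat.cast_succ, contDiffOn_succ_iff_fderiv_of_isOpen hUu] at ha1
    rw [Nat.cast_succ, contDiffOn_succ_iff_fderiv_of_isOpen hU]
    set b : P × ℝ → P →L[ℝ] W := fun q => (fderiv ℝ a q).comp (ContinuousLinearMap.inl ℝ P ℝ)
      with hb
    have hbs : ContDiffOn ℝ n b (U ×ˢ univ) := ha1.2.2.clm_comp contDiffOn_const
    have hd : ∀ p ∈ U, HasFDerivAt (curryMap fun p (t : K) => a (p, t))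
        (flipMap K P W (curryMap (fun p (t : K) => b (p, t)) p)) p := fun p hp =>
      hasFDerivAt_curryMap hU (hsub ha.continuousOn) (hsub hbs.continuousOn)
        (fun q hq t => by
          have h1 := (ha1.1.differentiableAt
            (hUu.mem_nhds (⟨hq, mem_univ _⟩ : (q, (t : ℝ)) ∈ U ×ˢ univ))).hasFDerivAt
          exact h1.comp q (hasFDerivAt_prodMk_left q (t : ℝ))) hp
    refine ⟨fun p hp => (hd p hp).differentiableAt.differentiableWithinAt, by simp, ?_⟩
    have h3 : ContDiff ℝ n (fun ψ => flipMap K P W ψ) := by fun_prop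
    exact (h3.comp_contDiffOn (ih hbs)).congr
      fun p hp => (hd p hp).fderiv

lemma contDiffOn_curryMap {P W : Type u} [NormedAddCommGroup P] [NormedSpace ℝ P]
    [NormedAddCommGroup W] [NormedSpace ℝ W] {K : Set ℝ} [CompactSpace K] {U : Set P}
    (hU : IsOpen U) {a : P × ℝ → W} (ha : ContDiffOn ℝ ∞ a (U ×ˢ univ)) :
    ContDiffOn ℝ ∞ (curryMap fun p (t : K) => a (p, t)) U :=
  contDiffOn_infty.2 fun n => contDiffOn_curryMap_nat hU n (contDiffOn_infty.1 ha n)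

end Curry

end DbarExpansion

namespace DbarExpansion

/-! ### Linear differential equations with parameters in a manifold -/

section ManifoldODE

/-- Bootstrapping: if `y` is `C^n`, then so is `y' = b y`. -/
lemma contDiffOn_of_hasDerivAt_mul {𝔸 : Type*} [NormedRing 𝔸] [NormedAlgebra ℝ 𝔸]
    {U : Set ℝ} (hU : IsOpen U) {b y : ℝ → 𝔸} (hb : ContDiffOn ℝ ∞ b U)
    (hy : ∀ t ∈ U, HasDerivAt y (b t * y t) t) : ContDiffOn ℝ ∞ y U := by
  rw [contDiffOn_infty]
  intro n
  induction n with
  | zero =>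
    simp only [Nat.cast_zero, contDiffOn_zero]
    exact fun t ht => (hy t ht).continuousAt.continuousWithinAt
  | succ n ih =>
    rw [Nat.cast_succ, contDiffOn_succ_iff_deriv_of_isOpen hU]
    refine ⟨fun t ht => (hy t ht).differentiableAt.differentiableWithinAt, by simp, ?_⟩
    exact ((contDiffOn_infty.1 hb n).mul ih).congr fun t ht => (hy t ht).deriv

/-- The solution of the linear equation `Φ' = a(n, ·) Φ`, `Φ(t₀) = 1`, depends smoothly on the
parameter `n`, which may vary in a manifold without boundary. -/
theorem exists_smooth_fundamentalSolution {E : Type u} [NormedAddCommGroup E] [NormedSpace ℝ E]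
    {H : Type*} [TopologicalSpace H] {I : ModelWithCorners ℝ E H} [I.Boundaryless]
    {N : Type*} [TopologicalSpace N] [ChartedSpace H N] [IsManifold I ∞ N]
    {𝔸 : Type u} [NormedRing 𝔸] [NormedAlgebra ℝ 𝔸] [CompleteSpace 𝔸]
    {a : N × ℝ → 𝔸} (ha : ContMDiff (I.prod 𝓘(ℝ, ℝ)) 𝓘(ℝ, 𝔸) ∞ a)
    {l r t₀ : ℝ} (ht₀ : t₀ ∈ Icc l r) :
    ∃ Φ : N → ℝ → 𝔸, (∀ n, Φ n t₀ = 1) ∧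
      (∀ n, ∀ t ∈ Ioo l r, HasDerivAt (Φ n) (a (n, t) * Φ n t) t) ∧
      (∀ n, ContDiffOn ℝ ∞ (Φ n) (Ioo l r)) ∧
      ∀ t, ContMDiff I 𝓘(ℝ, 𝔸) ∞ fun n => Φ n t := by
  have hlr : l ≤ r := ht₀.1.trans ht₀.2
  set α : N → C(Icc l r, 𝔸) := curryMap fun n (t : Icc l r) => a (n, t) with hα
  have hslice : ∀ n, ContDiff ℝ ∞ fun t : ℝ => a (n, t) := fun n => by
    rw [← contMDiff_iff_contDiff]
    exact ha.comp (contMDiff_const.prodMk contMDiff_id)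
  have hαapp : ∀ n (t : Icc l r), α n t = a (n, t) := fun n t =>
    curryMap_apply (a := fun n (t : Icc l r) => a (n, t))
      ((hslice n).continuous.comp continuous_subtype_val) t
  -- Smoothness of the coefficient as a map into `C(Icc l r, 𝔸)` is local in `n`, so it is checked
  -- in a chart. Without boundary the chart target is open, as the Euclidean lemma requires.
  have hαs : ContMDiff I 𝓘(ℝ, C(Icc l r, 𝔸)) ∞ α := by
    intro n₀
    set e := extChartAt I n₀
    set U := e.target
    have hU : IsOpen U := isOpen_extChartAt_target n₀
    have h0 : ContMDiffOn (𝓘(ℝ, E).prod 𝓘(ℝ, ℝ)) 𝓘(ℝ, 𝔸) ∞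
        (fun q : E × ℝ => a (e.symm q.1, q.2)) (U ×ˢ univ) := by
      refine ha.comp_contMDiffOn (ContMDiffOn.prodMk ?_ contMDiffOn_snd)
      exact (contMDiffOn_extChartAt_symm n₀).comp contMDiffOn_fst fun q hq => hq.1
    have h1 : ContDiffOn ℝ ∞ (fun q : E × ℝ => a (e.symm q.1, q.2)) (U ×ˢ univ) := by
      rw [← contMDiffOn_iff_contDiffOn, modelWithCornersSelf_prod, ← chartedSpaceSelf_prod]
      exact h0
    have h2 := contDiffOn_curryMap (K := Icc l r) hU h1
    have h3 : ContMDiffAt I 𝓘(ℝ, C(Icc l r, 𝔸)) ∞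
        ((curryMap fun p (t : Icc l r) => a (e.symm p, t)) ∘ e) n₀ := by
      refine ContMDiffAt.comp (I' := 𝓘(ℝ, E)) n₀ ?_ contMDiffAt_extChartAt
      exact (h2.contDiffAt (hU.mem_nhds (mem_extChartAt_target n₀))).contMDiffAt
    refine h3.congr_of_eventuallyEq ?_
    filter_upwards [extChartAt_source_mem_nhds (I := I) n₀] with n hn
    ext t
    rw [hαapp, Function.comp_apply, curryMap_apply]
    · rw [e.left_inv hn]
    · exact (hslice _).continuous.comp continuous_subtype_val
  have hder : ∀ n, ∀ t ∈ Ioo l r,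
      HasDerivAt (fun s => fundamentalSolution hlr t₀ (α n) (projIcc l r hlr s))
        (a (n, t) * fundamentalSolution hlr t₀ (α n) (projIcc l r hlr t)) t := fun n t ht => by
    have := hasDerivAt_fundamentalSolution hlr ht₀ (α n) ht
    have ht' : (projIcc l r hlr t : ℝ) = t := by
      rw [projIcc_of_mem hlr (Ioo_subset_Icc_self ht)]
    rwa [hαapp, ht'] at this
  refine ⟨fun n t => fundamentalSolution hlr t₀ (α n) (projIcc l r hlr t), fun n => ?_, hder,
    fun n => contDiffOn_of_hasDerivAt_mul isOpen_Ioo (hslice n).contDiffOn (hder n), fun t => ?_⟩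
  · simp only [projIcc_of_mem hlr ht₀]
    exact fundamentalSolution_self hlr ht₀ _
  · have h1 : ContDiff ℝ ∞ fun β : C(Icc l r, 𝔸) =>
        fundamentalSolution hlr t₀ β (projIcc l r hlr t) :=
      (ContinuousMap.evalCLM ℝ (projIcc l r hlr t) : C(Icc l r, 𝔸) →L[ℝ] 𝔸).contDiff.comp
        (contDiff_fundamentalSolution hlr ht₀)
    exact h1.contMDiff.comp hαs

end ManifoldODE

end DbarExpansion

namespace DbarExpansion

/-! ### Smooth sections along maps and smooth bundle homomorphisms, locally -/

section SmoothHom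

variable {E : Type*} [NormedAddCommGroup E] [NormedSpace ℝ E]
  {H : Type*} [TopologicalSpace H] (I : ModelWithCorners ℝ E H)
  {E' : Type*} [NormedAddCommGroup E'] [NormedSpace ℝ E']
  {H' : Type*} [TopologicalSpace H'] (I' : ModelWithCorners ℝ E' H')
  {E'' : Type*} [NormedAddCommGroup E''] [NormedSpace ℝ E'']
  {H'' : Type*} [TopologicalSpace H''] (I'' : ModelWithCorners ℝ E'' H'')
  {F : Type*} [NormedAddCommGroup F] [NormedSpace ℝ F]
  {G : Type*} [TopologicalSpace G] (IN : ModelWithCorners ℝ F G)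
  {F' : Type*} [NormedAddCommGroup F'] [NormedSpace ℝ F']
  {G' : Type*} [TopologicalSpace G'] (IN' : ModelWithCorners ℝ F' G')
  {M : Type*} [TopologicalSpace M] [ChartedSpace H M] [IsManifold I ∞ M]
  {M' : Type*} [TopologicalSpace M'] [ChartedSpace H' M'] [IsManifold I' ∞ M']
  {M'' : Type*} [TopologicalSpace M''] [ChartedSpace H'' M''] [IsManifold I'' ∞ M'']
  {N : Type*} [TopologicalSpace N] [ChartedSpace G N]
  {N' : Type*} [TopologicalSpace N'] [ChartedSpace G' N']
  {W : Type*} [NormedAddCommGroup W] [NormedSpace ℝ W]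
  {W' : Type*} [NormedAddCommGroup W'] [NormedSpace ℝ W']

/-- `ξ` is a section of `f^* TM` that is smooth at `z₀`. -/
def IsSmoothAlongAt (f : N → M) (ξ : ∀ z : N, TangentSpace I (f z)) (z₀ : N) : Prop :=
  ContMDiffAt IN I.tangent ∞ (fun z => (⟨f z, ξ z⟩ : TangentBundle I M)) z₀

/-- `A` is a section of `Hom_ℝ(f^* TM, h^* TM')` that is smooth at `z₀`. -/
def IsSmoothHomAt (f : N → M) (h : N → M')
    (A : ∀ z : N, TangentSpace I (f z) →L[ℝ] TangentSpace I' (h z)) (z₀ : N) : Prop :=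
  ContMDiffAt IN 𝓘(ℝ, E →L[ℝ] E') ∞ (inTangentCoordinates I I' f h A z₀) z₀

variable {I I' I'' IN IN'}

lemma contMDiffAt_clm_of_apply [FiniteDimensional ℝ W] {A : N → W →L[ℝ] W'} {z₀ : N}
    (h : ∀ c, ContMDiffAt IN 𝓘(ℝ, W') ∞ (fun z => A z c) z₀) :
    ContMDiffAt IN 𝓘(ℝ, W →L[ℝ] W') ∞ A z₀ := by
  let b := Module.finBasis ℝ W
  have hA : A = fun z => ∑ i, ContinuousLinearMap.smulRightL ℝ W W'
      (LinearMap.toContinuousLinearMap (b.coord i)) (A z (b i)) := by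
    ext z c
    conv_lhs => rw [← b.sum_repr c, map_sum]
    simp
  rw [hA]
  refine ContMDiffAt.sum fun i _ => ?_
  exact (ContinuousLinearMap.contMDiff _).contMDiffAt.comp z₀ (h (b i))

lemma IsSmoothAlong.at {f : N → M} {ξ : ∀ z : N, TangentSpace I (f z)}
    (h : IsSmoothAlong I IN f ξ) (z₀ : N) : IsSmoothAlongAt I IN f ξ z₀ :=
  h z₀

lemma IsSmoothHom.at {f : N → M} {h : N → M'}
    {A : ∀ z : N, TangentSpace I (f z) →L[ℝ] TangentSpace I' (h z)}
    (hA : IsSmoothHom I I' IN f h A) (z₀ : N) : IsSmoothHomAt I I' IN f h A z₀ :=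
  hA z₀

lemma IsSmoothAlongAt.contMDiffAt {f : N → M} {ξ : ∀ z : N, TangentSpace I (f z)} {z₀ : N}
    (h : IsSmoothAlongAt I IN f ξ z₀) : ContMDiffAt IN I ∞ f z₀ :=
  (contMDiffAt_totalSpace.1 h).1

lemma IsSmoothAlongAt.congr {f : N → M} {ξ ξ' : ∀ z : N, TangentSpace I (f z)} {z₀ : N}
    (h : IsSmoothAlongAt I IN f ξ z₀) (h' : ∀ᶠ z in 𝓝 z₀, ξ' z = ξ z) :
    IsSmoothAlongAt I IN f ξ' z₀ := by
  refine ContMDiffAt.congr_of_eventuallyEq h ?_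
  filter_upwards [h'] with z hz
  rw [hz]

lemma IsSmoothHomAt.congr {f : N → M} {h : N → M'} {z₀ : N}
    {A A' : ∀ z : N, TangentSpace I (f z) →L[ℝ] TangentSpace I' (h z)}
    (hA : IsSmoothHomAt I I' IN f h A z₀) (h' : ∀ᶠ z in 𝓝 z₀, A' z = A z) :
    IsSmoothHomAt I I' IN f h A' z₀ := by
  refine ContMDiffAt.congr_of_eventuallyEq hA ?_
  filter_upwards [h'] with z hz
  simp only [inTangentCoordinates, hz]

lemma IsSmoothHomAt.apply {f : N → M} {h : N → M'} {z₀ : N}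
    {A : ∀ z : N, TangentSpace I (f z) →L[ℝ] TangentSpace I' (h z)}
    {ξ : ∀ z : N, TangentSpace I (f z)} (hA : IsSmoothHomAt I I' IN f h A z₀)
    (hξ : IsSmoothAlongAt I IN f ξ z₀) (hh : ContMDiffAt IN I' ∞ h z₀) :
    IsSmoothAlongAt I' IN h (fun z => A z (ξ z)) z₀ :=
  ContMDiffAt.clm_apply_of_inCoordinates (b₁ := f) (b₂ := h) (v := ξ) (ϕ := A) hA hξ hh

lemma eventually_mem_baseSet {f : N → M} {z₀ : N} (hf : ContinuousAt f z₀) :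
    ∀ᶠ z in 𝓝 z₀, f z ∈ (trivializationAt E (TangentSpace I : M → Type _) (f z₀)).baseSet :=
  hf ((trivializationAt E (TangentSpace I : M → Type _) (f z₀)).open_baseSet.mem_nhds
    (FiberBundle.mem_baseSet_trivializationAt' (f z₀)))

/-- Near `z₀` the trivialization at `h z₀` cancels against its inverse in the middle, so the matrix
of the composite is the product of the matrices. -/
lemma IsSmoothHomAt.comp {f : N → M} {h : N → M'} {k : N → M''} {z₀ : N}
    {B : ∀ z : N, TangentSpace I' (h z) →L[ℝ] TangentSpace I'' (k z)}
    {A : ∀ z : N, TangentSpace I (f z) →L[ℝ] TangentSpace I' (h z)}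
    (hB : IsSmoothHomAt I' I'' IN h k B z₀) (hA : IsSmoothHomAt I I' IN f h A z₀)
    (hh : ContinuousAt h z₀) :
    IsSmoothHomAt I I'' IN f k (fun z => (B z).comp (A z)) z₀ := by
  refine ContMDiffAt.congr_of_eventuallyEq (ContMDiffAt.clm_comp hB hA) ?_
  filter_upwards [eventually_mem_baseSet (I := I') hh] with z hz
  ext v
  simp only [inTangentCoordinates, ContinuousLinearMap.inCoordinates,
    ContinuousLinearMap.comp_apply]
  have := (trivializationAt E' (TangentSpace I' : M' → Type _) (h z₀)).symmL_continuousLinearMapAt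
    (R := ℝ) hz
  erw [this]

lemma IsSmoothHomAt.add {f : N → M} {h : N → M'} {z₀ : N}
    {A B : ∀ z : N, TangentSpace I (f z) →L[ℝ] TangentSpace I' (h z)}
    (hA : IsSmoothHomAt I I' IN f h A z₀) (hB : IsSmoothHomAt I I' IN f h B z₀) :
    IsSmoothHomAt I I' IN f h (fun z => A z + B z) z₀ := by
  refine (ContMDiffAt.add hA hB).congr_of_eventuallyEq (Filter.Eventually.of_forall fun z => ?_)
  ext v
  exact map_add ((trivializationAt E' (TangentSpace I' : M' → Type _)
    (h z₀)).continuousLinearMapAt ℝ (h z)) _ _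

lemma IsSmoothHomAt.smul {f : N → M} {h : N → M'} {z₀ : N} {c : N → ℝ}
    {A : ∀ z : N, TangentSpace I (f z) →L[ℝ] TangentSpace I' (h z)}
    (hc : ContMDiffAt IN 𝓘(ℝ, ℝ) ∞ c z₀) (hA : IsSmoothHomAt I I' IN f h A z₀) :
    IsSmoothHomAt I I' IN f h (fun z => c z • A z) z₀ := by
  refine (ContMDiffAt.smul hc hA).congr_of_eventuallyEq (Filter.Eventually.of_forall fun z => ?_)
  ext v
  exact map_smul ((trivializationAt E' (TangentSpace I' : M' → Type _)
    (h z₀)).continuousLinearMapAt ℝ (h z)) _ _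

lemma IsSmoothHomAt.const_smul {f : N → M} {h : N → M'} {z₀ : N} (c : ℝ)
    {A : ∀ z : N, TangentSpace I (f z) →L[ℝ] TangentSpace I' (h z)}
    (hA : IsSmoothHomAt I I' IN f h A z₀) :
    IsSmoothHomAt I I' IN f h (fun z => c • A z) z₀ :=
  IsSmoothHomAt.smul contMDiffAt_const hA

lemma IsSmoothHomAt.sub {f : N → M} {h : N → M'} {z₀ : N}
    {A B : ∀ z : N, TangentSpace I (f z) →L[ℝ] TangentSpace I' (h z)}
    (hA : IsSmoothHomAt I I' IN f h A z₀) (hB : IsSmoothHomAt I I' IN f h B z₀) :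
    IsSmoothHomAt I I' IN f h (fun z => A z - B z) z₀ := by
  refine (hA.add (hB.const_smul (-1))).congr (Filter.Eventually.of_forall fun z => ?_)
  simp [sub_eq_add_neg]

lemma IsSmoothHomAt.sum {ι : Type*} (s : Finset ι) {f : N → M} {h : N → M'} {z₀ : N}
    {A : ι → ∀ z : N, TangentSpace I (f z) →L[ℝ] TangentSpace I' (h z)}
    (hA : ∀ i ∈ s, IsSmoothHomAt I I' IN f h (A i) z₀) :
    IsSmoothHomAt I I' IN f h (fun z => ∑ i ∈ s, A i z) z₀ := by
  refine (ContMDiffAt.sum (fun i hi => hA i hi)).congr_of_eventuallyEq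
    (Filter.Eventually.of_forall fun z => ?_)
  ext v
  simp only [sum_apply, inTangentCoordinates,
    ContinuousLinearMap.inCoordinates, ContinuousLinearMap.comp_apply]
  exact map_sum ((trivializationAt E' (TangentSpace I' : M' → Type _)
    (h z₀)).continuousLinearMapAt ℝ (h z)) _ _

lemma IsSmoothHomAt.comp_right {f : N → M} {h : N → M'} {k : N' → N} {z₀ : N'}
    {A : ∀ z : N, TangentSpace I (f z) →L[ℝ] TangentSpace I' (h z)}
    (hA : IsSmoothHomAt I I' IN f h A (k z₀)) (hk : ContMDiffAt IN' IN ∞ k z₀) :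
    IsSmoothHomAt I I' IN' (fun z => f (k z)) (fun z => h (k z)) (fun z => A (k z)) z₀ :=
  ContMDiffAt.comp z₀ hA hk

lemma IsSmoothAlongAt.comp_right {f : N → M} {k : N' → N} {z₀ : N'}
    {ξ : ∀ z : N, TangentSpace I (f z)}
    (hξ : IsSmoothAlongAt I IN f ξ (k z₀)) (hk : ContMDiffAt IN' IN ∞ k z₀) :
    IsSmoothAlongAt I IN' (fun z => f (k z)) (fun z => ξ (k z)) z₀ :=
  ContMDiffAt.comp z₀ hξ hk

lemma isSmoothHomAt_model_iff {f : N → W} {h : N → W'} {z₀ : N} {A : N → W →L[ℝ] W'} :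
    IsSmoothHomAt 𝓘(ℝ, W) 𝓘(ℝ, W') IN f h A z₀ ↔ ContMDiffAt IN 𝓘(ℝ, W →L[ℝ] W') ∞ A z₀ := by
  unfold IsSmoothHomAt
  rw [inTangentCoordinates_model_space]

lemma isSmoothAlongAt_model_iff {f : N → W} {z₀ : N} {ξ : N → W}
    (hf : ContMDiffAt IN 𝓘(ℝ, W) ∞ f z₀) :
    IsSmoothAlongAt 𝓘(ℝ, W) IN f ξ z₀ ↔ ContMDiffAt IN 𝓘(ℝ, W) ∞ ξ z₀ := by
  unfold IsSmoothAlongAt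
  rw [contMDiffAt_totalSpace]
  simp only [trivializationAt_model_space_apply]
  exact and_iff_right hf

/-- A trivial bundle with fibre `W` is modelled as the pullback of the tangent bundle of `W` along
the constant map `0`, so that maps into and out of it also fall under `IsSmoothHomAt`. -/
lemma isSmoothHomAt_of_apply [FiniteDimensional ℝ W] {f : N → M} {z₀ : N}
    {A : ∀ z : N, W →L[ℝ] TangentSpace I (f z)}
    (h : ∀ c, IsSmoothAlongAt I IN f (fun z => A z c) z₀) :
    IsSmoothHomAt 𝓘(ℝ, W) I IN (fun _ => (0 : W)) f A z₀ := by
  refine contMDiffAt_clm_of_apply fun c => ?_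
  have hf := (h c).contMDiffAt
  refine (contMDiffAt_totalSpace.1 (h c)).2.congr_of_eventuallyEq ?_
  filter_upwards [eventually_mem_baseSet (I := I) hf.continuousAt] with z hz
  simp only [inTangentCoordinates, ContinuousLinearMap.inCoordinates,
    ContinuousLinearMap.comp_apply, TangentBundle.symmL_model_space]
  rw [Trivialization.continuousLinearMapAt_apply, Trivialization.coe_linearMapAt_of_mem _ hz]
  rfl

lemma isSmoothHomAt_mfderiv [IsManifold IN ∞ N] {f : N → M} {z₀ : N}
    (hf : ContMDiffAt IN I ∞ f z₀) :
    IsSmoothHomAt IN I IN (id : N → N) f (mfderiv IN I f) z₀ :=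
  hf.mfderiv_const le_rfl

lemma isSmoothHomAt_partial_mfderiv [IsManifold IN ∞ N] {f : N → M → M'} {g : N → M} {z₀ : N}
    (hf : ContMDiffAt (IN.prod I) I' ∞ (Function.uncurry f) (z₀, g z₀))
    (hg : ContMDiffAt IN I ∞ g z₀) :
    IsSmoothHomAt I I' IN g (fun z => f z (g z)) (fun z => mfderiv I I' (f z) (g z)) z₀ :=
  hf.mfderiv f g hg le_rfl

end SmoothHom

end DbarExpansion

namespace DbarExpansion

/-! ### Global frames of the tangent bundle over a neighbourhood of a compact set -/

section Frames

variable {m : ℕ} {M : Type*} [TopologicalSpace M] [ChartedSpace (EuclideanSpace ℝ (Fin m)) M]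
  [IsManifold (𝓡 m) ∞ M]

/-- Smooth bundle maps `s : M × F → TM` and `θ : TM → M × F` with `s ∘ θ = id` over the open
set `U`. -/
structure TangentFrame (F : Type*) [NormedAddCommGroup F] [NormedSpace ℝ F] (U : Set M) where
  s : ∀ x : M, F →L[ℝ] TangentSpace (𝓡 m) x
  θ : ∀ x : M, TangentSpace (𝓡 m) x →L[ℝ] F
  s_smooth : ∀ c, IsSmoothAlong (𝓡 m) (𝓡 m) (id : M → M) (fun x => s x c)
  θ_smooth : IsSmoothHom (𝓡 m) 𝓘(ℝ, F) (𝓡 m) (id : M → M) (fun _ => (0 : F)) θ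
  s_θ : ∀ x ∈ U, ∀ v, s x (θ x v) = v
  isOpen : IsOpen U

/-- A smooth replacement for `1 / r`: the factor `smoothTransition (8r - 1)` vanishes for `r ≤ 1/8`
and equals one for `r ≥ 1/4`. It is used to divide by a sum of squares of bump functions. -/
lemma exists_contDiff_mul_eq_one :
    ∃ k : ℝ → ℝ, ContDiff ℝ ∞ k ∧ ∀ r, 1 / 4 < r → k r * r = 1 := by
  refine ⟨fun r => Real.smoothTransition (8 * r - 1) / r, ?_, fun r hr => ?_⟩
  · rw [contDiff_iff_contDiffAt]
    intro r
    rcases lt_or_ge r (1 / 8) with h | h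
    · refine (contDiffAt_const (c := (0 : ℝ))).congr_of_eventuallyEq ?_
      filter_upwards [Iio_mem_nhds h] with r' hr'
      rw [Real.smoothTransition.zero_of_nonpos, zero_div]
      rw [mem_Iio] at hr'
      linarith
    · refine ContDiffAt.div ?_ contDiffAt_id (by linarith)
      exact Real.smoothTransition.contDiff.contDiffAt.comp r (by fun_prop)
  · simp only
    rw [Real.smoothTransition.one_of_one_le (by linarith), one_div, inv_mul_cancel₀ (by linarith)]

local notation "𝔼" => EuclideanSpace ℝ (Fin m)

lemma continuousLinearMapAt_model_space_apply {W : Type*} [NormedAddCommGroup W]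
    [NormedSpace ℝ W] (b b' w : W) :
    (trivializationAt W (TangentSpace 𝓘(ℝ, W) : W → Type _) b).continuousLinearMapAt ℝ b' w =
      w := by
  rw [TangentBundle.continuousLinearMapAt_model_space]
  rfl

/-- Its matrix in the trivialization at `x₀` is a coordinate change of the tangent bundle. -/
lemma isSmoothHomAt_continuousLinearMapAt (c x₀ : M)
    (hx : x₀ ∈ (trivializationAt 𝔼 (TangentSpace (𝓡 m) : M → Type _) c).baseSet) :
    IsSmoothHomAt (𝓡 m) 𝓘(ℝ, 𝔼) (𝓡 m) (id : M → M) (fun _ => (0 : 𝔼))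
      (fun x => (trivializationAt 𝔼 (TangentSpace (𝓡 m) : M → Type _) c).continuousLinearMapAt
        ℝ x) x₀ := by
  set e := trivializationAt 𝔼 (TangentSpace (𝓡 m) : M → Type _) c
  set e₀ := trivializationAt 𝔼 (TangentSpace (𝓡 m) : M → Type _) x₀ with he₀
  have hx' : x₀ ∈ e₀.baseSet := mem_baseSet_trivializationAt 𝔼 (TangentSpace (𝓡 m)) x₀
  refine (contMDiffAt_coordChangeL (IB := 𝓡 m) (n := ∞) hx' hx).congr_of_eventuallyEq ?_
  filter_upwards [e.open_baseSet.mem_nhds hx, e₀.open_baseSet.mem_nhds hx'] with y hy hy'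
  ext1 v
  refine (continuousLinearMapAt_model_space_apply _ _ _).trans ?_
  refine Eq.trans ?_ (Trivialization.coordChangeL_apply e₀ e ⟨hy', hy⟩ v).symm
  change e.continuousLinearMapAt ℝ y (e₀.symmL ℝ y v) = _
  rw [Trivialization.continuousLinearMapAt_apply, Trivialization.coe_linearMapAt_of_mem _ hy]
  change (e ⟨y, e₀.symmL ℝ y v⟩).2 = _
  rw [e₀.symmL_apply hy']

lemma pi_eq_sum_single_comp {ι V W : Type*} [Fintype ι] [DecidableEq ι] [AddCommGroup V]
    [Module ℝ V] [TopologicalSpace V] [NormedAddCommGroup W] [NormedSpace ℝ W]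
    (A : ι → V →L[ℝ] W) :
    ContinuousLinearMap.pi A =
      ∑ i, (ContinuousLinearMap.single ℝ (fun _ : ι => W) i).comp (A i) := by
  ext v i
  simp [sum_apply, Pi.single_apply]

/-- Take bump functions `ρᵢ` of finitely many charts and put `σ = ∑ ρᵢ²`. In the `i`-th chart `s`
multiplies by `ρᵢ` and `θ` by `ρᵢ / σ`, so `s ∘ θ = ∑ ρᵢ² / σ = id` where `σ > 1/4`. Over `C` some
`ρᵢ` exceeds `1/2`. Each `s c` is a vector field on all of `M`, to which `∇` applies. The system is
overcomplete, so `θ ∘ s` need not be the identity. -/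
lemma exists_tangentFrame [T2Space M] {C : Set M} (hC : IsCompact C) :
    ∃ (q : ℕ) (U : Set M), C ⊆ U ∧ Nonempty (TangentFrame (M := M) (m := m) (Fin q → 𝔼) U) := by
  classical
  set ρ : ∀ x : M, SmoothBumpFunction (𝓡 m) x := fun x => Classical.arbitrary _
  have hopen : ∀ x : M, IsOpen {y | 1 / 2 < ρ x y} := fun x =>
    isOpen_lt continuous_const (ρ x).continuous
  obtain ⟨t, ht⟩ := hC.elim_finite_subcover (fun x : M => {y | 1 / 2 < ρ x y}) hopen
    (fun x _ => mem_iUnion.2 ⟨x, by simp only [mem_ofPred_eq, (ρ x).eq_one]; norm_num⟩)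
  obtain ⟨k, hk, hk1⟩ := exists_contDiff_mul_eq_one
  set p : Fin t.card → M := fun i => (t.equivFin.symm i : M) with hp
  set σ : M → ℝ := fun y => ∑ i, ρ (p i) y ^ 2 with hσ
  have hσs : ContMDiff (𝓡 m) 𝓘(ℝ, ℝ) ∞ σ := by
    refine contMDiff_finsetSum fun i _ => ?_
    exact (ρ (p i)).contMDiff.pow 2
  have hkσ : ContMDiff (𝓡 m) 𝓘(ℝ, ℝ) ∞ fun y => k (σ y) := hk.contMDiff.comp hσs
  set e : Fin t.card → Trivialization 𝔼 (π 𝔼 (TangentSpace (𝓡 m) : M → Type _)) :=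
    fun i => trivializationAt 𝔼 (TangentSpace (𝓡 m)) (p i) with he
  have hsupp : ∀ i, tsupport (ρ (p i)) ⊆ (e i).baseSet := fun i =>
    (ρ (p i)).tsupport_subset_chartAt_source
  refine ⟨t.card, {y | 1 / 4 < σ y}, fun y hy => ?_, ⟨?_⟩⟩
  · obtain ⟨x, hx, hxy⟩ := mem_iUnion₂.1 (ht hy)
    simp only [mem_ofPred_eq] at hxy ⊢
    have h1 : ρ (p (t.equivFin ⟨x, hx⟩)) y ^ 2 ≤ σ y :=
      Finset.single_le_sum (f := fun i => ρ (p i) y ^ 2) (fun i _ => sq_nonneg _)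
        (Finset.mem_univ _)
    have h2 : p (t.equivFin ⟨x, hx⟩) = x := by simp [hp]
    rw [h2] at h1
    nlinarith
  · exact
    { s := fun x => ∑ i, ρ (p i) x • ((e i).symmL ℝ x).comp (ContinuousLinearMap.proj i)
      θ := fun x => ContinuousLinearMap.pi fun i =>
        (k (σ x) * ρ (p i) x) • (e i).continuousLinearMapAt ℝ x
      s_smooth := fun c => by
        have h1 : ∀ i, ContMDiff (𝓡 m) (𝓡 m).tangent ∞ (fun x =>
            TotalSpace.mk' 𝔼 x ((ρ (p i) : M → ℝ) x • (e i).symmL ℝ x (c i))) := fun i => by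
          refine ContMDiffOn.smul_section_of_tsupport (u := (e i).baseSet)
            (ρ (p i)).contMDiff.contMDiffOn (e i).open_baseSet (hsupp i) ?_
          rw [(e i).contMDiffOn_section_baseSet_iff]
          refine (contMDiffOn_const (c := c i)).congr fun y hy => ?_
          rw [(e i).symmL_apply hy, (e i).mk_symm hy]
          simp [hy]
        have h2 := ContMDiff.sum_section (s := Finset.univ) fun i _ => h1 i
        simpa [IsSmoothAlong] using! h2
      θ_smooth := fun x₀ => by
        have h1 : ∀ i, IsSmoothHomAt (𝓡 m) 𝓘(ℝ, 𝔼) (𝓡 m) (id : M → M) (fun _ => (0 : 𝔼))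
            (fun x => (k (σ x) * ρ (p i) x) • (e i).continuousLinearMapAt ℝ x) x₀ := fun i => by
          -- Away from the support of `ρᵢ` the component vanishes identically, so the trivialization
          -- matters only on its base set.
          by_cases hx : x₀ ∈ tsupport (ρ (p i))
          · exact IsSmoothHomAt.smul ((hkσ x₀).mul ((ρ (p i)).contMDiff x₀))
              (isSmoothHomAt_continuousLinearMapAt _ _ (hsupp i hx))
          · refine (IsSmoothHomAt.congr (A := fun _ => 0) ?_ ?_)
            · refine (contMDiffAt_const (c := (0 : 𝔼 →L[ℝ] 𝔼))).congr_of_eventuallyEq ?_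
              refine Filter.Eventually.of_forall fun x => ?_
              ext1 v
              exact map_zero ((trivializationAt 𝔼 (TangentSpace 𝓘(ℝ, 𝔼) : 𝔼 → Type _)
                0).continuousLinearMapAt ℝ 0)
            · filter_upwards [(isClosed_tsupport (ρ (p i))).isOpen_compl.mem_nhds hx] with y hy
              rw [image_eq_zero_of_notMem_tsupport hy, mul_zero, zero_smul]
              rfl
        have h2 := IsSmoothHomAt.sum (Finset.univ) fun i _ =>
          IsSmoothHomAt.comp (I'' := 𝓘(ℝ, Fin t.card → 𝔼)) (k := fun _ => (0 : Fin t.card → 𝔼))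
            (B := fun _ => ContinuousLinearMap.single ℝ (fun _ : Fin t.card => 𝔼) i)
            (isSmoothHomAt_model_iff.2 contMDiffAt_const) (h1 i) continuousAt_const
        refine h2.congr (Filter.Eventually.of_forall fun x => ?_)
        exact pi_eq_sum_single_comp fun i =>
          (k (σ x) * ρ (p i) x) • (e i).continuousLinearMapAt ℝ x
      s_θ := fun x hx v => by
        have h1 : ∀ i, ρ (p i) x • (e i).symmL ℝ x
            ((k (σ x) * ρ (p i) x) • (e i).continuousLinearMapAt ℝ x v) =
            (k (σ x) * ρ (p i) x ^ 2) • v := fun i => by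
          by_cases hx' : x ∈ (e i).baseSet
          · rw [map_smul, (e i).symmL_continuousLinearMapAt hx', smul_smul]
            congr 1
            ring
          · rw [image_eq_zero_of_notMem_tsupport (f := ρ (p i)) fun h => hx' (hsupp i h)]
            simp
        simp only [sum_apply, smul_apply,
          ContinuousLinearMap.comp_apply, ContinuousLinearMap.proj_apply,
          ContinuousLinearMap.pi_apply]
        rw [Finset.sum_congr rfl fun i _ => h1 i, ← Finset.sum_smul, ← Finset.mul_sum,
          hk1 _ hx, one_smul]
      isOpen := isOpen_lt continuous_const hσs.continuous }

end Frames

end DbarExpansion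

namespace DbarExpansion

/-! ### Calculus of the pulled back connection -/

section CovAlong

variable {m : ℕ} {M : Type*} [TopologicalSpace M] [ChartedSpace (EuclideanSpace ℝ (Fin m)) M]
  [IsManifold (𝓡 m) ∞ M]

local notation "𝔼" => EuclideanSpace ℝ (Fin m)

local notation "TM" => (TangentSpace (𝓡 m) : M → Type _)

variable {nabla : CovariantDerivative (𝓡 m) (EuclideanSpace ℝ (Fin m))
  (TangentSpace (𝓡 m) : M → Type _)}

lemma nabla_sum {ι : Type*} (s : Finset ι) {σ : ι → ∀ x : M, TangentSpace (𝓡 m) x} {x : M}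
    (hσ : ∀ i ∈ s, MDifferentiableAt (𝓡 m) (𝓡 m).tangent
      (fun y => (⟨y, σ i y⟩ : TangentBundle (𝓡 m) M)) x) :
    nabla (fun y => ∑ i ∈ s, σ i y) x = ∑ i ∈ s, nabla (σ i) x := by
  classical
  induction s using Finset.induction_on with
  | empty =>
    simp only [Finset.sum_empty]
    exact congrFun nabla.zero x
  | insert a s ha ih =>
    simp only [Finset.sum_insert ha]
    rw [← ih fun i hi => hσ i (Finset.mem_insert_of_mem hi)]
    refine nabla.isCovariantDerivativeOnUniv.add (hσ a (Finset.mem_insert_self _ _)) ?_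
    have := MDifferentiableAt.sum_section (s := s) (I := 𝓡 m) (F := 𝔼)
      fun i hi => hσ i (Finset.mem_insert_of_mem hi)
    exact this

lemma nabla_eq_sum_localFrame {σ : ∀ x : M, TangentSpace (𝓡 m) x} {x x₀ : M}
    (hx : x ∈ (trivializationAt 𝔼 TM x₀).baseSet)
    (hσ : MDifferentiableAt (𝓡 m) (𝓡 m).tangent
      (fun y => (⟨y, σ y⟩ : TangentBundle (𝓡 m) M)) x) :
    let e := trivializationAt 𝔼 TM x₀
    let b := (EuclideanSpace.basisFun (Fin m) ℝ).toBasis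
    nabla σ x = ∑ i, (e.localFrameCoeff (𝓡 m) b i x (σ x) • nabla (e.localFrame b i) x +
      (mvfderiv (𝓡 m) (fun y => e.localFrameCoeff (𝓡 m) b i y (σ y)) x).smulRight
        (e.localFrame b i x)) := by
  intro e b
  have hg : ∀ i, MDifferentiableAt (𝓡 m) 𝓘(ℝ, ℝ)
      (fun y => e.localFrameCoeff (𝓡 m) b i y (σ y)) x := fun i =>
    mdifferentiableAt_localFrameCoeff b hx hσ i
  have he : ∀ i, MDifferentiableAt (𝓡 m) (𝓡 m).tangent
      (fun y => (⟨y, e.localFrame b i y⟩ : TangentBundle (𝓡 m) M)) x := fun i =>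
    (contMDiffAt_localFrame_of_mem 1 e b i hx).mdifferentiableAt one_ne_zero
  have hge : ∀ i, MDifferentiableAt (𝓡 m) (𝓡 m).tangent
      (fun y => (⟨y, e.localFrameCoeff (𝓡 m) b i y (σ y) • e.localFrame b i y⟩ :
        TangentBundle (𝓡 m) M)) x := fun i => MDifferentiableAt.smul_section (hg i) (he i)
  have h1 : nabla σ x = nabla (fun y => ∑ i, e.localFrameCoeff (𝓡 m) b i y (σ y) •
      e.localFrame b i y) x := by
    refine nabla.isCovariantDerivativeOnUniv.congr_of_eventuallyEq hσ ?_ Filter.univ_mem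
      (e.eventually_eq_localFrame_sum_coeff_smul b hx)
    exact MDifferentiableAt.sum_section (s := Finset.univ) (I := 𝓡 m) (F := 𝔼) fun i _ => hge i
  rw [h1, nabla_sum _ fun i _ => hge i]
  exact Finset.sum_congr rfl fun i _ =>
    nabla.isCovariantDerivativeOnUniv.leibniz (he i) (hg i)

variable {F : Type*} [NormedAddCommGroup F] [NormedSpace ℝ F]
  {N : Type*} [TopologicalSpace N] [ChartedSpace F N]
  {F' : Type*} [NormedAddCommGroup F'] [NormedSpace ℝ F']
  {N' : Type*} [TopologicalSpace N'] [ChartedSpace F' N']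
  {V : Type*} [NormedAddCommGroup V] [NormedSpace ℝ V]

/-- The defining property of a pulled back connection: the Leibniz rule together with `∇^f (σ ∘ f) =
∇_{df} σ`. Expanding `σ` in the frame used by `covAlong`, the derivatives of its coefficients and of
the frame reassemble to `∇σ`. -/
lemma covAlong_smul_comp {f : N → M} {z : N} {h : N → ℝ} {σ : ∀ x : M, TangentSpace (𝓡 m) x}
    (hf : MDifferentiableAt 𝓘(ℝ, F) (𝓡 m) f z) (hh : MDifferentiableAt 𝓘(ℝ, F) 𝓘(ℝ, ℝ) h z)
    (hσ : MDifferentiableAt (𝓡 m) (𝓡 m).tangent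
      (fun y => (⟨y, σ y⟩ : TangentBundle (𝓡 m) M)) (f z)) :
    covAlong nabla f (fun z' => h z' • σ (f z')) z =
      (mvfderiv 𝓘(ℝ, F) h z).smulRight (σ (f z)) +
        h z • (nabla σ (f z)).comp (mfderiv 𝓘(ℝ, F) (𝓡 m) f z) := by
  set e := trivializationAt 𝔼 TM (f z)
  set b := (EuclideanSpace.basisFun (Fin m) ℝ).toBasis
  have hx : f z ∈ e.baseSet := mem_baseSet_trivializationAt 𝔼 TM (f z)
  set g : Fin m → M → ℝ := fun i y => e.localFrameCoeff (𝓡 m) b i y (σ y) with hgdef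
  have hg : ∀ i, MDifferentiableAt (𝓡 m) 𝓘(ℝ, ℝ) (g i) (f z) := fun i =>
    mdifferentiableAt_localFrameCoeff b hx hσ i
  have h1 : ∀ i, mvfderiv 𝓘(ℝ, F) (fun z' : N => e.localFrameCoeff (𝓡 m) b i (f z')
      (h z' • σ (f z'))) z = h z • (mvfderiv (𝓡 m) (g i) (f z)).comp (mfderiv 𝓘(ℝ, F) (𝓡 m) f z)
        + g i (f z) • mvfderiv 𝓘(ℝ, F) h z := fun i => by
    have h2 : (fun z' : N => e.localFrameCoeff (𝓡 m) b i (f z') (h z' • σ (f z'))) =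
        h * (g i ∘ f) := by
      funext z'
      simp [hgdef]
    rw [h2, mvfderiv_mul hh ((hg i).comp z hf)]
    congr 2
    simp only [mvfderiv]
    rw [mfderiv_comp z (hg i) hf]
    rfl
  have hσx : σ (f z) = ∑ i, g i (f z) • e.localFrame b i (f z) :=
    e.eq_sum_localFrameCoeff_smul (I := 𝓡 m) hx
  have h3 : covAlong nabla f (fun z' => h z' • σ (f z')) z = ∑ i,
      ((h z • (mvfderiv (𝓡 m) (g i) (f z)).comp (mfderiv 𝓘(ℝ, F) (𝓡 m) f z)
        + g i (f z) • mvfderiv 𝓘(ℝ, F) h z).smulRight (e.localFrame b i (f z)) +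
      (h z * g i (f z)) • (nabla (e.localFrame b i) (f z)).comp (mfderiv 𝓘(ℝ, F) (𝓡 m) f z)) := by
    simp only [covAlong]
    refine Finset.sum_congr rfl fun i _ => ?_
    rw [← h1 i]
    congr 2
    exact (e.localFrameCoeff (𝓡 m) b i (f z)).map_smul (h z) (σ (f z))
  rw [h3, nabla_eq_sum_localFrame (nabla := nabla) hx hσ]
  have h4 : ∀ c : ℝ, c • σ (f z) = ∑ i, (c * g i (f z)) • e.localFrame b i (f z) := fun c => by
    conv_lhs => rw [hσx]
    simp only [Finset.smul_sum, mul_smul]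
  ext v
  simp only [sum_apply, add_apply, ContinuousLinearMap.smulRight_apply,
    smul_apply, ContinuousLinearMap.comp_apply, Finset.smul_sum]
  rw [h4, ← Finset.sum_add_distrib]
  refine Finset.sum_congr rfl fun i _ => ?_
  module

lemma covAlong_congr {f : N → M} {z : N} {ξ ξ' : ∀ z : N, TangentSpace (𝓡 m) (f z)}
    (h : ∀ᶠ z' in 𝓝 z, ξ z' = ξ' z') :
    covAlong (F := F) nabla f ξ z = covAlong nabla f ξ' z := by
  simp only [covAlong]
  refine Finset.sum_congr rfl fun i _ => ?_
  rw [h.self_of_nhds]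
  congr 2
  simp only [mvfderiv]
  congr 1
  refine Filter.EventuallyEq.mfderiv_eq ?_
  filter_upwards [h] with z' hz'
  rw [hz']

lemma localFrameCoeff_apply_eq {x y : M} (hy : y ∈ (trivializationAt 𝔼 TM x).baseSet)
    (w : TangentSpace (𝓡 m) y) (i : Fin m) :
    (trivializationAt 𝔼 TM x).localFrameCoeff (𝓡 m) (EuclideanSpace.basisFun (Fin m) ℝ).toBasis
      i y w = (trivializationAt 𝔼 TM x ⟨y, w⟩).2 i := by
  classical
  have h := (trivializationAt 𝔼 TM x).localFrameCoeff_eq_coeff (I := 𝓡 m)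
    (b := (EuclideanSpace.basisFun (Fin m) ℝ).toBasis) (s := Function.update 0 y w) hy (i := i)
  rw [Function.update_self] at h
  rw [h]
  simp

lemma mdifferentiableAt_localFrameCoeff_along {f : N → M} {z : N}
    {ξ : ∀ z : N, TangentSpace (𝓡 m) (f z)}
    (hξ : MDifferentiableAt 𝓘(ℝ, F) (𝓡 m).tangent
      (fun z' => (⟨f z', ξ z'⟩ : TangentBundle (𝓡 m) M)) z) (i : Fin m) :
    MDifferentiableAt 𝓘(ℝ, F) 𝓘(ℝ, ℝ) (fun z' => (trivializationAt 𝔼 TM (f z)).localFrameCoeff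
      (𝓡 m) (EuclideanSpace.basisFun (Fin m) ℝ).toBasis i (f z') (ξ z')) z := by
  have h := (mdifferentiableAt_totalSpace _ _).1 hξ
  have h2 : MDifferentiableAt 𝓘(ℝ, F) 𝓘(ℝ, ℝ) (fun z' => (EuclideanSpace.proj i : 𝔼 →L[ℝ] ℝ)
      (trivializationAt 𝔼 TM (f z) ⟨f z', ξ z'⟩).2) z :=
    (ContinuousLinearMap.mdifferentiableAt _).comp z h.2
  refine h2.congr_of_eventuallyEq ?_
  filter_upwards [eventually_mem_baseSet (I := 𝓡 m) h.1.continuousAt] with z' hz'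
  exact localFrameCoeff_apply_eq hz' (ξ z') i

/-- Differentiable sections along a map. -/
def AlongDiffAt (f : N → M) (ξ : ∀ z : N, TangentSpace (𝓡 m) (f z)) (z : N) : Prop :=
  MDifferentiableAt 𝓘(ℝ, F) (𝓡 m).tangent (fun z' => (⟨f z', ξ z'⟩ : TangentBundle (𝓡 m) M)) z

lemma IsSmoothAlongAt.alongDiffAt {f : N → M} {ξ : ∀ z : N, TangentSpace (𝓡 m) (f z)} {z : N}
    (h : IsSmoothAlongAt (𝓡 m) 𝓘(ℝ, F) f ξ z) : AlongDiffAt (F := F) f ξ z :=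
  ContMDiffAt.mdifferentiableAt h (by simp)

lemma AlongDiffAt.mdifferentiableAt {f : N → M} {ξ : ∀ z : N, TangentSpace (𝓡 m) (f z)} {z : N}
    (h : AlongDiffAt (F := F) f ξ z) : MDifferentiableAt 𝓘(ℝ, F) (𝓡 m) f z :=
  ((mdifferentiableAt_totalSpace _ _).1 h).1

lemma AlongDiffAt.smul_comp {f : N → M} {z : N} {h : N → ℝ} {σ : ∀ x : M, TangentSpace (𝓡 m) x}
    (hf : MDifferentiableAt 𝓘(ℝ, F) (𝓡 m) f z) (hh : MDifferentiableAt 𝓘(ℝ, F) 𝓘(ℝ, ℝ) h z)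
    (hσ : MDifferentiableAt (𝓡 m) (𝓡 m).tangent
      (fun y => (⟨y, σ y⟩ : TangentBundle (𝓡 m) M)) (f z)) :
    AlongDiffAt (F := F) f (fun z' => h z' • σ (f z')) z := by
  have h1 := (mdifferentiableAt_totalSpace _ _).1 (hσ.comp z hf)
  refine (mdifferentiableAt_totalSpace _ _).2 ⟨hf, (hh.smul h1.2).congr_of_eventuallyEq ?_⟩
  filter_upwards [eventually_mem_baseSet (I := 𝓡 m) hf.continuousAt] with z' hz'
  exact ((trivializationAt 𝔼 TM (f z)).linear ℝ hz').map_smul (h z') (σ (f z'))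

lemma AlongDiffAt.add {f : N → M} {ξ ξ' : ∀ z : N, TangentSpace (𝓡 m) (f z)} {z : N}
    (h : AlongDiffAt (F := F) f ξ z) (h' : AlongDiffAt (F := F) f ξ' z) :
    AlongDiffAt (F := F) f (fun z => ξ z + ξ' z) z := by
  have h1 := (mdifferentiableAt_totalSpace _ _).1 h
  have h2 := (mdifferentiableAt_totalSpace _ _).1 h'
  refine (mdifferentiableAt_totalSpace _ _).2 ⟨h1.1, (h1.2.add h2.2).congr_of_eventuallyEq ?_⟩
  filter_upwards [eventually_mem_baseSet (I := 𝓡 m) h1.1.continuousAt] with z' hz'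
  exact ((trivializationAt 𝔼 TM (f z)).linear ℝ hz').map_add (ξ z') (ξ' z')

lemma covAlong_add {f : N → M} {ξ ξ' : ∀ z : N, TangentSpace (𝓡 m) (f z)} {z : N}
    (h : AlongDiffAt (F := F) f ξ z) (h' : AlongDiffAt (F := F) f ξ' z) :
    covAlong (F := F) nabla f (fun z => ξ z + ξ' z) z =
      covAlong nabla f ξ z + covAlong nabla f ξ' z := by
  simp only [covAlong, ← Finset.sum_add_distrib]
  refine Finset.sum_congr rfl fun i _ => ?_
  have h3 : mvfderiv 𝓘(ℝ, F) (fun z' => (trivializationAt 𝔼 TM (f z)).localFrameCoeff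
      (𝓡 m) (EuclideanSpace.basisFun (Fin m) ℝ).toBasis i (f z') (ξ z' + ξ' z')) z = _ :=
    (congrArg (fun k => mvfderiv 𝓘(ℝ, F) k z) (funext fun z' => map_add _ _ _)).trans
      (mvfderiv_add (mdifferentiableAt_localFrameCoeff_along h i)
        (mdifferentiableAt_localFrameCoeff_along h' i))
  rw [h3, map_add]
  ext v
  simp only [add_apply, ContinuousLinearMap.smulRight_apply, smul_apply,
    ContinuousLinearMap.comp_apply]
  module

lemma AlongDiffAt.zero {f : N → M} {z : N} (hf : MDifferentiableAt 𝓘(ℝ, F) (𝓡 m) f z) :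
    AlongDiffAt (F := F) f (fun z => (0 : TangentSpace (𝓡 m) (f z))) z := by
  refine (mdifferentiableAt_totalSpace _ _).2 ⟨hf,
    (mdifferentiableAt_const (c := (0 : 𝔼))).congr_of_eventuallyEq ?_⟩
  filter_upwards [eventually_mem_baseSet (I := 𝓡 m) hf.continuousAt] with z' hz'
  exact ((trivializationAt 𝔼 TM (f z)).linear ℝ hz').map_zero

lemma covAlong_zero (f : N → M) (z : N) :
    covAlong (F := F) nabla f (fun z => (0 : TangentSpace (𝓡 m) (f z))) z = 0 := by
  simp only [covAlong]
  refine Finset.sum_eq_zero fun i _ => ?_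
  simp only [map_zero, zero_smul, add_zero]
  ext v
  simp [mvfderiv]

lemma AlongDiffAt.sum {ι : Type*} (s : Finset ι) {f : N → M}
    {ξ : ι → ∀ z : N, TangentSpace (𝓡 m) (f z)} {z : N}
    (hf : MDifferentiableAt 𝓘(ℝ, F) (𝓡 m) f z)
    (h : ∀ i ∈ s, AlongDiffAt (F := F) f (ξ i) z) :
    AlongDiffAt (F := F) f (fun z => ∑ i ∈ s, ξ i z) z := by
  classical
  induction s using Finset.induction_on with
  | empty => simpa using AlongDiffAt.zero hf
  | insert a s ha ih =>
    simp only [Finset.sum_insert ha]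
    exact (h a (Finset.mem_insert_self _ _)).add
      (ih fun i hi => h i (Finset.mem_insert_of_mem hi))

lemma covAlong_sum {ι : Type*} (s : Finset ι) {f : N → M}
    {ξ : ι → ∀ z : N, TangentSpace (𝓡 m) (f z)} {z : N}
    (hf : MDifferentiableAt 𝓘(ℝ, F) (𝓡 m) f z)
    (h : ∀ i ∈ s, AlongDiffAt (F := F) f (ξ i) z) :
    covAlong (F := F) nabla f (fun z => ∑ i ∈ s, ξ i z) z = ∑ i ∈ s, covAlong nabla f (ξ i) z := by
  classical
  induction s using Finset.induction_on with
  | empty => simpa using covAlong_zero f z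
  | insert a s ha ih =>
    simp only [Finset.sum_insert ha]
    rw [← ih fun i hi => h i (Finset.mem_insert_of_mem hi)]
    exact covAlong_add (h a (Finset.mem_insert_self _ _))
      (AlongDiffAt.sum s hf fun i hi => h i (Finset.mem_insert_of_mem hi))

lemma covAlong_sub {f : N → M} {ξ ξ' : ∀ z : N, TangentSpace (𝓡 m) (f z)} {z : N}
    (h : AlongDiffAt (F := F) f (fun z => ξ z - ξ' z) z) (h' : AlongDiffAt (F := F) f ξ' z) :
    covAlong (F := F) nabla f (fun z => ξ z - ξ' z) z =
      covAlong nabla f ξ z - covAlong nabla f ξ' z := by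
  rw [eq_sub_iff_add_eq, ← covAlong_add h h']
  simp

/-- Both sides use the coordinate frame around the same point `f (k z)`, so the chain rule applies
term by term. -/
lemma covAlong_comp {f : N → M} {k : N' → N} {z : N'}
    {ξ : ∀ z : N, TangentSpace (𝓡 m) (f z)} (h : AlongDiffAt (F := F) f ξ (k z))
    (hk : MDifferentiableAt 𝓘(ℝ, F') 𝓘(ℝ, F) k z) :
    covAlong (F := F') nabla (fun z => f (k z)) (fun z => ξ (k z)) z =
      (covAlong nabla f ξ (k z)).comp (mfderiv 𝓘(ℝ, F') 𝓘(ℝ, F) k z) := by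
  simp only [covAlong]
  rw [ContinuousLinearMap.finsetSum_comp]
  refine Finset.sum_congr rfl fun i _ => ?_
  have h1 := mfderiv_comp z h.mdifferentiableAt hk
  have h2 := mfderiv_comp z (mdifferentiableAt_localFrameCoeff_along h i) hk
  ext v
  have h1' := DFunLike.congr_fun h1 v
  have h2' := DFunLike.congr_fun h2 v
  simp only [add_apply, ContinuousLinearMap.smulRight_apply, smul_apply,
    ContinuousLinearMap.comp_apply]
  congr 1
  · exact congrArg (fun t : ℝ => t • _) h2'
  · congr 1
    exact congrArg (nabla _ (f (k z))) h1'

end CovAlong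

end DbarExpansion

namespace DbarExpansion

/-! ### The pulled back connection in a frame, metric compatibility and `J`-linearity -/

section CovAlongFrame

variable {m : ℕ} {M : Type*} [TopologicalSpace M] [ChartedSpace (EuclideanSpace ℝ (Fin m)) M]
  [IsManifold (𝓡 m) ∞ M]

local notation "𝔼" => EuclideanSpace ℝ (Fin m)

local notation "TM" => (TangentSpace (𝓡 m) : M → Type _)

variable {nabla : CovariantDerivative (𝓡 m) (EuclideanSpace ℝ (Fin m))
  (TangentSpace (𝓡 m) : M → Type _)}
  {F : Type*} [NormedAddCommGroup F] [NormedSpace ℝ F]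
  {N : Type*} [TopologicalSpace N] [ChartedSpace F N]
  {W : Type*} [NormedAddCommGroup W] [NormedSpace ℝ W]

lemma isSmoothHom_nabla (hsmooth : nabla.ContMDiffCovariantDerivative ∞)
    {σ : ∀ x : M, TangentSpace (𝓡 m) x} (hσ : IsSmoothAlong (𝓡 m) (𝓡 m) (id : M → M) σ) :
    IsSmoothHom (𝓡 m) (𝓡 m) (𝓡 m) (id : M → M) (id : M → M) (nabla σ) := by
  intro x₀
  have h1 : ContMDiffOn (𝓡 m) (𝓡 m).tangent (∞ + 1)
      (fun x => (⟨x, σ x⟩ : TangentBundle (𝓡 m) M)) univ := by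
    have : ((∞ : ℕ∞ω) + 1) = ∞ := rfl
    rw [this]
    exact ContMDiff.contMDiffOn hσ
  have h2 := hsmooth.contMDiff.contMDiff h1
  have h3 := (h2 x₀ (mem_univ _)).contMDiffAt Filter.univ_mem
  exact ((contMDiffAt_hom_bundle _).1 h3).2

lemma TangentFrame.mdifferentiableAt {U : Set M} (Φ : TangentFrame (m := m) W U) (c : W) (x : M) :
    MDifferentiableAt (𝓡 m) (𝓡 m).tangent
      (fun y => (⟨y, Φ.s y c⟩ : TangentBundle (𝓡 m) M)) x :=
  ContMDiffAt.mdifferentiableAt (Φ.s_smooth c x) (by simp)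

lemma TangentFrame.nabla_sum_smul {ι : Type*} (s : Finset ι) {U : Set M}
    (Φ : TangentFrame (m := m) W U) (a : ι → ℝ) (c : ι → W) (x : M) :
    nabla (fun y => Φ.s y (∑ i ∈ s, a i • c i)) x =
      ∑ i ∈ s, a i • nabla (fun y => Φ.s y (c i)) x := by
  have h1 : (fun y => Φ.s y (∑ i ∈ s, a i • c i)) =
      fun y => ∑ i ∈ s, (a i • fun y => Φ.s y (c i)) y := by
    funext y
    simp
  have h2 : ∀ i ∈ s, nabla (a i • fun y => Φ.s y (c i)) x =
      a i • nabla (fun y => Φ.s y (c i)) x := fun i _ =>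
    nabla.isCovariantDerivativeOnUniv.smul_const (a i) (Φ.mdifferentiableAt (c i) x)
  rw [h1, nabla_sum, Finset.sum_congr rfl h2]
  intro i _
  exact MDifferentiableAt.smul_section mdifferentiableAt_const (Φ.mdifferentiableAt (c i) x)

/-- The Leibniz rule for `∑ Zⁱ s(bᵢ)`. Unlike the coordinate frame in `covAlong`, whose centre moves
with `z`, the fields here are fixed, so the formula can be used for all `z` at once. -/
lemma TangentFrame.covAlong_eq [FiniteDimensional ℝ W] {U : Set M}
    (Φ : TangentFrame (m := m) W U) {f : N → M} {Z : N → W} {z : N}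
    (hf : MDifferentiableAt 𝓘(ℝ, F) (𝓡 m) f z) (hZ : MDifferentiableAt 𝓘(ℝ, F) 𝓘(ℝ, W) Z z) :
    covAlong nabla f (fun z' => Φ.s (f z') (Z z')) z =
      (Φ.s (f z)).comp (mvfderiv 𝓘(ℝ, F) Z z) +
        (nabla (fun y => Φ.s y (Z z)) (f z)).comp (mfderiv 𝓘(ℝ, F) (𝓡 m) f z) := by
  let b := Module.finBasis ℝ W
  have hco : ∀ i, MDifferentiableAt 𝓘(ℝ, F) 𝓘(ℝ, ℝ) (fun z' => b.coord i (Z z')) z := fun i =>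
    (ContinuousLinearMap.mdifferentiableAt (LinearMap.toContinuousLinearMap (b.coord i))).comp z hZ
  have hξ : (fun z' => Φ.s (f z') (Z z')) =
      fun z' => ∑ i, b.coord i (Z z') • Φ.s (f z') (b i) := by
    funext z'
    conv_lhs => rw [← b.sum_repr (Z z'), map_sum]
    simp
  have hd : ∀ i v, mvfderiv 𝓘(ℝ, F) (fun z' => b.coord i (Z z')) z v =
      b.coord i (mvfderiv 𝓘(ℝ, F) Z z v) := fun i v => by
    have h := mfderiv_comp (I := 𝓘(ℝ, F)) (I' := 𝓘(ℝ, W)) (I'' := 𝓘(ℝ, ℝ)) z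
      (ContinuousLinearMap.mdifferentiableAt (LinearMap.toContinuousLinearMap (b.coord i))) hZ
    rw [ContinuousLinearMap.mfderiv_eq] at h
    exact DFunLike.congr_fun h v
  have hZz : nabla (fun y => Φ.s y (Z z)) (f z) =
      ∑ i, b.coord i (Z z) • nabla (fun y => Φ.s y (b i)) (f z) := by
    conv_lhs => rw [← b.sum_repr (Z z)]
    rw [Φ.nabla_sum_smul]
    rfl
  rw [hξ, covAlong_sum _ hf fun i _ => AlongDiffAt.smul_comp hf (hco i) (Φ.mdifferentiableAt _ _),
    hZz, Finset.sum_congr rfl fun i _ => covAlong_smul_comp hf (hco i) (Φ.mdifferentiableAt _ _)]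
  ext v
  have hv : Φ.s (f z) (mvfderiv 𝓘(ℝ, F) Z z v) =
      ∑ i, b.coord i (mvfderiv 𝓘(ℝ, F) Z z v) • Φ.s (f z) (b i) := by
    conv_lhs => rw [← b.sum_repr (mvfderiv 𝓘(ℝ, F) Z z v), map_sum]
    simp
  simp only [sum_apply, add_apply, ContinuousLinearMap.smulRight_apply, smul_apply,
    ContinuousLinearMap.comp_apply, Finset.sum_add_distrib, hd, hv]

lemma TangentFrame.contMDiff_repr {U : Set M} (Φ : TangentFrame (m := m) W U)
    {E₁ : Type*} [NormedAddCommGroup E₁] [NormedSpace ℝ E₁]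
    {G : Type*} [TopologicalSpace G] {IN : ModelWithCorners ℝ E₁ G}
    {N : Type*} [TopologicalSpace N] [ChartedSpace G N]
    {f : N → M} {ξ : ∀ z : N, TangentSpace (𝓡 m) (f z)} {z : N}
    (hξ : IsSmoothAlongAt (𝓡 m) IN f ξ z) :
    ContMDiffAt IN 𝓘(ℝ, W) ∞ (fun z => Φ.θ (f z) (ξ z)) z := by
  have h1 := ((Φ.θ_smooth.at (f z)).comp_right hξ.contMDiffAt).apply hξ contMDiffAt_const
  exact (isSmoothAlongAt_model_iff contMDiffAt_const).1 h1

lemma TangentFrame.eventually_eq {U : Set M} (Φ : TangentFrame (m := m) W U)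
    {N : Type*} [TopologicalSpace N] {f : N → M}
    (ξ : ∀ z : N, TangentSpace (𝓡 m) (f z)) {z : N} (hf : ContinuousAt f z) (hz : f z ∈ U) :
    ∀ᶠ z' in 𝓝 z, ξ z' = Φ.s (f z') (Φ.θ (f z') (ξ z')) := by
  filter_upwards [hf (Φ.isOpen.mem_nhds hz)] with z' hz'
  exact (Φ.s_θ _ hz' _).symm

lemma TangentFrame.mdifferentiableAt_repr {U : Set M} (Φ : TangentFrame (m := m) W U)
    {f : N → M} {ξ : ∀ z : N, TangentSpace (𝓡 m) (f z)} {z : N}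
    (hξ : AlongDiffAt (F := F) f ξ z) :
    MDifferentiableAt 𝓘(ℝ, F) 𝓘(ℝ, W) (fun z => Φ.θ (f z) (ξ z)) z := by
  have h := (mdifferentiableAt_totalSpace _ _).1 hξ
  set e := trivializationAt 𝔼 TM (f z)
  have h1 : MDifferentiableAt 𝓘(ℝ, F) 𝓘(ℝ, 𝔼 →L[ℝ] W) (fun z' => inTangentCoordinates (𝓡 m)
      𝓘(ℝ, W) id (fun _ => (0 : W)) Φ.θ (f z) (f z')) z :=
    ((Φ.θ_smooth (f z)).mdifferentiableAt (by simp)).comp z h.1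
  refine (h1.clm_apply h.2).congr_of_eventuallyEq ?_
  filter_upwards [eventually_mem_baseSet (I := 𝓡 m) h.1.continuousAt] with z' hz'
  refine Eq.symm ((continuousLinearMapAt_model_space_apply _ _ _).trans ?_)
  have h2 : e.symmL ℝ (f z') (e ⟨f z', ξ z'⟩).2 = ξ z' := by
    have := e.symmL_continuousLinearMapAt (R := ℝ) hz' (ξ z')
    rwa [Trivialization.continuousLinearMapAt_apply,
      Trivialization.coe_linearMapAt_of_mem _ hz'] at this
  exact congrArg (Φ.θ (f z')) h2

/-- Every section along `f` is near `z` a combination of smooth vector fields of `M`. -/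
lemma alongDiffAt_induction [T2Space M] {f : N → M} {z : N}
    {p : (∀ z : N, TangentSpace (𝓡 m) (f z)) → Prop}
    (hcongr : ∀ ξ ξ', (∀ᶠ z' in 𝓝 z, ξ z' = ξ' z') → p ξ' → p ξ)
    (hzero : p fun _ => 0) (hadd : ∀ ξ ξ', p ξ → p ξ' → p fun z => ξ z + ξ' z)
    (hsmul : ∀ (h : N → ℝ) (σ : ∀ x : M, TangentSpace (𝓡 m) x),
      MDifferentiableAt 𝓘(ℝ, F) 𝓘(ℝ, ℝ) h z → IsSmoothAlong (𝓡 m) (𝓡 m) (id : M → M) σ →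
      p fun z => h z • σ (f z))
    {ξ : ∀ z : N, TangentSpace (𝓡 m) (f z)} (hξ : AlongDiffAt (F := F) f ξ z) : p ξ := by
  obtain ⟨q, U, hU, ⟨Φ⟩⟩ := exists_tangentFrame (M := M) (m := m) (isCompact_singleton (x := f z))
  let b := Module.finBasis ℝ (Fin q → 𝔼)
  have hco : ∀ i, MDifferentiableAt 𝓘(ℝ, F) 𝓘(ℝ, ℝ)
      (fun z' => b.coord i (Φ.θ (f z') (ξ z'))) z := fun i =>
    (ContinuousLinearMap.mdifferentiableAt (LinearMap.toContinuousLinearMap (b.coord i))).comp z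
      (Φ.mdifferentiableAt_repr hξ)
  have hf := hξ.mdifferentiableAt
  refine hcongr _ (∑ i, fun z' => b.coord i (Φ.θ (f z') (ξ z')) • Φ.s (f z') (b i)) ?_
    (Finset.sum_induction _ p hadd hzero fun i _ => hsmul _ _ (hco i) (Φ.s_smooth _))
  filter_upwards [Φ.eventually_eq ξ hf.continuousAt (hU rfl)] with z' hz'
  conv_lhs => rw [hz', ← b.sum_repr (Φ.θ (f z') (ξ z')), map_sum]
  simp

lemma mdifferentiableAt_of_isSmoothAlong {σ : ∀ x : M, TangentSpace (𝓡 m) x}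
    (hσ : IsSmoothAlong (𝓡 m) (𝓡 m) (id : M → M) σ) (x : M) :
    MDifferentiableAt (𝓡 m) (𝓡 m).tangent
      (fun y => (⟨y, σ y⟩ : TangentBundle (𝓡 m) M)) x :=
  ContMDiffAt.mdifferentiableAt (hσ x) (by simp)

/-- Reduction to `h • σ ∘ f`, where it is the Leibniz rule and `∇J = 0`. Differentiability of both
sections is carried through the induction because additivity of `covAlong` needs it. -/
lemma covAlong_J [T2Space M]
    {J : ∀ x : M, TangentSpace (𝓡 m) x →L[ℝ] TangentSpace (𝓡 m) x}
    (hJ : IsSmoothHom (𝓡 m) (𝓡 m) (𝓡 m) (id : M → M) (id : M → M) J) (hnablaJ : IsJLinear nabla J)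
    {f : N → M} {z : N} {ξ : ∀ z : N, TangentSpace (𝓡 m) (f z)}
    (hξ : AlongDiffAt (F := F) f ξ z) :
    covAlong (F := F) nabla f (fun z => J (f z) (ξ z)) z = (J (f z)).comp (covAlong (F := F) nabla f ξ z) := by
  have hf := hξ.mdifferentiableAt
  suffices h : AlongDiffAt (F := F) f ξ z ∧ AlongDiffAt (F := F) f (fun z => J (f z) (ξ z)) z ∧
      covAlong (F := F) nabla f (fun z => J (f z) (ξ z)) z = (J (f z)).comp (covAlong (F := F) nabla f ξ z) from h.2.2
  refine alongDiffAt_induction (F := F) (p := fun ξ => AlongDiffAt (F := F) f ξ z ∧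
    AlongDiffAt (F := F) f (fun z => J (f z) (ξ z)) z ∧
      covAlong (F := F) nabla f (fun z => J (f z) (ξ z)) z = (J (f z)).comp (covAlong (F := F) nabla f ξ z))
    ?_ ?_ ?_ ?_ hξ
  · intro ξ ξ' h ⟨h1, h2, h3⟩
    have h' : ∀ᶠ z' in 𝓝 z, J (f z') (ξ z') = J (f z') (ξ' z') := by
      filter_upwards [h] with z' hz'
      rw [hz']
    refine ⟨h1.congr_of_eventuallyEq ?_, h2.congr_of_eventuallyEq ?_, ?_⟩
    · filter_upwards [h] with z' hz'
      rw [hz']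
    · filter_upwards [h] with z' hz'
      rw [hz']
    · rw [covAlong_congr h', covAlong_congr h, h3]
  · simp only [map_zero]
    exact ⟨AlongDiffAt.zero hf, AlongDiffAt.zero hf, by simp [covAlong_zero]⟩
  · intro ξ ξ' ⟨h1, h2, h3⟩ ⟨h1', h2', h3'⟩
    simp only [map_add]
    refine ⟨h1.add h1', h2.add h2', ?_⟩
    rw [covAlong_add h2 h2', covAlong_add h1 h1', h3, h3']
    ext v
    simp
  · intro h σ hh hσ
    have hJσ : IsSmoothAlong (𝓡 m) (𝓡 m) (id : M → M) (fun x => J x (σ x)) := fun x =>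
      (hJ.at x).apply (hσ.at x) contMDiffAt_id
    have hσ' := mdifferentiableAt_of_isSmoothAlong hσ (f z)
    have hJσ' := mdifferentiableAt_of_isSmoothAlong hJσ (f z)
    simp only [map_smul]
    refine ⟨AlongDiffAt.smul_comp hf hh hσ', AlongDiffAt.smul_comp hf hh hJσ', ?_⟩
    rw [covAlong_smul_comp hf hh hσ']
    refine (covAlong_smul_comp hf hh hJσ').trans ?_
    ext v
    have := hnablaJ σ hσ (f z) (mfderiv 𝓘(ℝ, F) (𝓡 m) f z v)
    simp only [add_apply, ContinuousLinearMap.smulRight_apply, smul_apply,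
      ContinuousLinearMap.comp_apply, map_add, map_smul]
    rw [this]

lemma IsSmoothHomAt.change_model {E₁ : Type*} [NormedAddCommGroup E₁] [NormedSpace ℝ E₁]
    {E₂ : Type*} [NormedAddCommGroup E₂] [NormedSpace ℝ E₂]
    {H₁ : Type*} [TopologicalSpace H₁] {I : ModelWithCorners ℝ E₁ H₁}
    {G : Type*} [TopologicalSpace G] {IN : ModelWithCorners ℝ E₂ G}
    {M₁ : Type*} [TopologicalSpace M₁] [ChartedSpace H₁ M₁] [IsManifold I ∞ M₁]
    {N : Type*} [TopologicalSpace N] [ChartedSpace G N]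
    {f : N → M₁} {h : N → W} {z₀ : N} {A : ∀ z : N, TangentSpace I (f z) →L[ℝ] W}
    (hA : IsSmoothHomAt I 𝓘(ℝ, W) IN f h A z₀) (h' : N → W) :
    IsSmoothHomAt I 𝓘(ℝ, W) IN f h' A z₀ := by
  refine ContMDiffAt.congr_of_eventuallyEq hA (Filter.Eventually.of_forall fun z => ?_)
  ext v
  exact (continuousLinearMapAt_model_space_apply _ _ _).trans
    (continuousLinearMapAt_model_space_apply _ _ _).symm

/-- Two nested inductions, one per argument, reduce to products `h • σ ∘ f` and `h₁ • σ₁ ∘ f`. There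
it is the product rule and metric compatibility on `M`. -/
lemma mvfderiv_inner_along [T2Space M] [RiemannianBundle (fun x : M => TangentSpace (𝓡 m) x)]
    [IsContMDiffRiemannianBundle (𝓡 m) ∞ (EuclideanSpace ℝ (Fin m))
      (fun x : M => TangentSpace (𝓡 m) x)]
    (hmetric : nabla.IsMetricCompatible)
    {f : N → M} {z : N} {ξ ξ' : ∀ z : N, TangentSpace (𝓡 m) (f z)}
    (hξ : AlongDiffAt (F := F) f ξ z) (hξ' : AlongDiffAt (F := F) f ξ' z) :
    MDifferentiableAt 𝓘(ℝ, F) 𝓘(ℝ, ℝ) (fun z => inner ℝ (ξ z) (ξ' z)) z ∧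
    ∀ v, mvfderiv 𝓘(ℝ, F) (fun z => inner ℝ (ξ z) (ξ' z)) z v =
      inner ℝ (covAlong nabla f ξ z v) (ξ' z) + inner ℝ (ξ z) (covAlong nabla f ξ' z v) := by
  have hf := hξ.mdifferentiableAt
  refine (alongDiffAt_induction (F := F) (p := fun ξ => AlongDiffAt (F := F) f ξ z ∧
    MDifferentiableAt 𝓘(ℝ, F) 𝓘(ℝ, ℝ) (fun z => inner ℝ (ξ z) (ξ' z)) z ∧
    ∀ v, mvfderiv 𝓘(ℝ, F) (fun z => inner ℝ (ξ z) (ξ' z)) z v =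
      inner ℝ (covAlong nabla f ξ z v) (ξ' z) + inner ℝ (ξ z) (covAlong nabla f ξ' z v))
    ?_ ?_ ?_ ?_ hξ).2
  · intro ξ₁ ξ₂ h ⟨h1, h2, h3⟩
    have h' : (fun z' => inner ℝ (ξ₁ z') (ξ' z')) =ᶠ[𝓝 z] fun z' => inner ℝ (ξ₂ z') (ξ' z') := by
      filter_upwards [h] with z' hz'
      rw [hz']
    refine ⟨h1.congr_of_eventuallyEq ?_, h2.congr_of_eventuallyEq h', fun v => ?_⟩
    · filter_upwards [h] with z' hz'
      rw [hz']
    · rw [covAlong_congr h, h.self_of_nhds, ← h3 v]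
      simp only [mvfderiv]
      rw [h'.mfderiv_eq]
      rfl
  · refine ⟨AlongDiffAt.zero hf, ?_, fun v => ?_⟩
    · simp only [inner_zero_left]
      exact mdifferentiableAt_const
    · simp only [inner_zero_left, covAlong_zero]
      simp [mvfderiv]
  · intro ξ₁ ξ₂ ⟨h1, h2, h3⟩ ⟨h1', h2', h3'⟩
    have he : (fun z => inner ℝ (ξ₁ z + ξ₂ z) (ξ' z)) =
      (fun z => inner ℝ (ξ₁ z) (ξ' z)) + fun z => inner ℝ (ξ₂ z) (ξ' z) := by
      funext z
      exact inner_add_left _ _ _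
    rw [he]
    refine ⟨h1.add h1', h2.add h2', fun v => ?_⟩
    rw [mvfderiv_add h2 h2', covAlong_add h1 h1']
    simp only [add_apply, inner_add_left]
    rw [h3, h3']
    ring
  · intro h σ hh hσ
    have hσ' := mdifferentiableAt_of_isSmoothAlong hσ (f z)
    refine (alongDiffAt_induction (F := F) (p := fun ξ' => AlongDiffAt (F := F) f ξ' z ∧
      AlongDiffAt (F := F) f (fun z => h z • σ (f z)) z ∧
      MDifferentiableAt 𝓘(ℝ, F) 𝓘(ℝ, ℝ) (fun z => inner ℝ (h z • σ (f z)) (ξ' z)) z ∧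
      ∀ v, mvfderiv 𝓘(ℝ, F) (fun z => inner ℝ (h z • σ (f z)) (ξ' z)) z v =
        inner ℝ (covAlong nabla f (fun z => h z • σ (f z)) z v) (ξ' z) +
          inner ℝ (h z • σ (f z)) (covAlong nabla f ξ' z v))
      ?_ ?_ ?_ ?_ hξ').2
    · intro ξ₁ ξ₂ hc ⟨h1, h0, h2, h3⟩
      have h' : (fun z' => inner ℝ (h z' • σ (f z')) (ξ₁ z')) =ᶠ[𝓝 z]
          fun z' => inner ℝ (h z' • σ (f z')) (ξ₂ z') := by
        filter_upwards [hc] with z' hz'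
        rw [hz']
      refine ⟨h1.congr_of_eventuallyEq ?_, h0, h2.congr_of_eventuallyEq h', fun v => ?_⟩
      · filter_upwards [hc] with z' hz'
        rw [hz']
      · rw [covAlong_congr (ξ := ξ₁) hc, hc.self_of_nhds, ← h3 v]
        simp only [mvfderiv]
        rw [h'.mfderiv_eq]
        rfl
    · refine ⟨AlongDiffAt.zero hf, AlongDiffAt.smul_comp hf hh hσ', ?_, fun v => ?_⟩
      · simp only [inner_zero_right]
        exact mdifferentiableAt_const
      · simp only [inner_zero_right, covAlong_zero]
        simp [mvfderiv]
    · intro ξ₁ ξ₂ ⟨h1, h0, h2, h3⟩ ⟨h1', _, h2', h3'⟩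
      have he : (fun z => inner ℝ (h z • σ (f z)) (ξ₁ z + ξ₂ z)) =
        (fun z => inner ℝ (h z • σ (f z)) (ξ₁ z)) + fun z => inner ℝ (h z • σ (f z)) (ξ₂ z) := by
        funext z
        exact inner_add_right _ _ _
      rw [he]
      refine ⟨h1.add h1', h0, h2.add h2', fun v => ?_⟩
      rw [mvfderiv_add h2 h2', covAlong_add h1 h1']
      simp only [add_apply, inner_add_right]
      rw [h3, h3']
      ring
    · intro h₁ σ₁ hh₁ hσ₁
      classical
      have hσ₁' := mdifferentiableAt_of_isSmoothAlong hσ₁ (f z)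
      have hin : MDifferentiableAt (𝓡 m) 𝓘(ℝ, ℝ) (fun x => inner ℝ (σ x) (σ₁ x)) (f z) :=
        hσ'.inner_bundle hσ₁'
      have he : (fun z => inner ℝ (h z • σ (f z)) (h₁ z • σ₁ (f z))) =
          (h * h₁) * ((fun x => inner ℝ (σ x) (σ₁ x)) ∘ f) := by
        funext z
        simp only [inner_smul_left, inner_smul_right, Pi.mul_apply, Function.comp]
        simp
        ring
      rw [he]
      refine ⟨AlongDiffAt.smul_comp hf hh₁ hσ₁', AlongDiffAt.smul_comp hf hh hσ',
        (hh.mul hh₁).mul (hin.comp z hf), fun v => ?_⟩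
      rw [mvfderiv_mul (hh.mul hh₁) (hin.comp z hf), mvfderiv_mul hh hh₁,
        covAlong_smul_comp hf hh hσ', covAlong_smul_comp hf hh₁ hσ₁']
      have h5 : mvfderiv 𝓘(ℝ, F) ((fun x => inner ℝ (σ x) (σ₁ x)) ∘ f) z v =
          inner ℝ (nabla σ (f z) (mfderiv 𝓘(ℝ, F) (𝓡 m) f z v)) (σ₁ (f z)) +
          inner ℝ (σ (f z)) (nabla σ₁ (f z) (mfderiv 𝓘(ℝ, F) (𝓡 m) f z v)) := by
        -- The direction is a vector field in this statement, but only its value at `f z` matters;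
        -- it is extended by zero.
        have h6 := CovariantDerivative.IsMetricCompatible.mvfderiv_inner_eq hmetric
          (Function.update 0 (f z) (mfderiv 𝓘(ℝ, F) (𝓡 m) f z v)) hσ' hσ₁'
        simp only [Function.update_self] at h6
        rw [← h6]
        simp only [mvfderiv]
        rw [mfderiv_comp z hin hf]
        rfl
      simp only [add_apply, ContinuousLinearMap.smulRight_apply, smul_apply,
        ContinuousLinearMap.comp_apply, inner_add_left, inner_add_right, inner_smul_left,
        inner_smul_right, h5, Pi.mul_apply, Function.comp, smul_eq_mul]
      simp
      ring

/-- The frame in the definition of `covAlong` changes with the point, so smoothness is read from the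
formula in one fixed frame. -/
lemma isSmoothHom_covAlong [T2Space M] [IsManifold 𝓘(ℝ, F) ∞ N]
    (hsmooth : nabla.ContMDiffCovariantDerivative ∞)
    {f : N → M} {ξ : ∀ z : N, TangentSpace (𝓡 m) (f z)}
    (hξ : IsSmoothAlong (𝓡 m) 𝓘(ℝ, F) f ξ) :
    IsSmoothHom 𝓘(ℝ, F) (𝓡 m) 𝓘(ℝ, F) (id : N → N) f (covAlong nabla f ξ) := by
  intro z
  have hf : ∀ z, ContMDiffAt 𝓘(ℝ, F) (𝓡 m) ∞ f z := fun z => (hξ.at z).contMDiffAt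
  obtain ⟨q, U, hU, ⟨Φ⟩⟩ := exists_tangentFrame (M := M) (m := m) (isCompact_singleton (x := f z))
  let b := Module.finBasis ℝ (Fin q → 𝔼)
  set Z : N → Fin q → 𝔼 := fun z => Φ.θ (f z) (ξ z)
  have hZ : ContMDiff 𝓘(ℝ, F) 𝓘(ℝ, Fin q → 𝔼) ∞ Z := fun z' => Φ.contMDiff_repr (hξ.at z')
  have hco : ∀ i, ContMDiffAt 𝓘(ℝ, F) 𝓘(ℝ, ℝ) ∞ (fun z' => b.coord i (Z z')) z := fun i =>
    (ContinuousLinearMap.contMDiff (LinearMap.toContinuousLinearMap (b.coord i))).contMDiffAt.comp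
      z (hZ z)
  have hdf := isSmoothHomAt_mfderiv (hf z)
  have hdZ : IsSmoothHomAt 𝓘(ℝ, F) 𝓘(ℝ, Fin q → 𝔼) 𝓘(ℝ, F) (id : N → N) Z
    (mfderiv 𝓘(ℝ, F) 𝓘(ℝ, Fin q → 𝔼) Z) z := isSmoothHomAt_mfderiv (hZ z)
  have hs : IsSmoothHomAt 𝓘(ℝ, Fin q → 𝔼) (𝓡 m) 𝓘(ℝ, F) (fun _ => (0 : Fin q → 𝔼)) f
      (fun z => Φ.s (f z)) z :=
    isSmoothHomAt_of_apply fun c => ((Φ.s_smooth c).at (f z)).comp_right (hf z)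
  have hdZ' : IsSmoothHomAt 𝓘(ℝ, F) 𝓘(ℝ, Fin q → 𝔼) 𝓘(ℝ, F) (id : N → N)
    (fun _ => (0 : Fin q → 𝔼))
    (fun z => mvfderiv 𝓘(ℝ, F) Z z) z := hdZ.change_model _
  refine ((hs.comp hdZ' continuousAt_const).add (IsSmoothHomAt.sum Finset.univ fun i _ =>
    IsSmoothHomAt.smul (hco i) ((((isSmoothHom_nabla hsmooth (Φ.s_smooth (b i))).at
      (f z)).comp_right (hf z)).comp hdf (hf z).continuousAt))).congr ?_
  filter_upwards [(hf z).continuousAt (Φ.isOpen.mem_nhds (hU rfl))] with z' hz'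
  rw [covAlong_congr (Φ.eventually_eq ξ (hf z').continuousAt hz'),
    Φ.covAlong_eq ((hf z').mdifferentiableAt (by simp)) ((hZ z').mdifferentiableAt (by simp))]
  have hZz : nabla (fun y => Φ.s y (Z z')) (f z') =
      ∑ i, b.coord i (Z z') • nabla (fun y => Φ.s y (b i)) (f z') := by
    conv_lhs => rw [← b.sum_repr (Z z')]
    rw [Φ.nabla_sum_smul]
    rfl
  rw [hZz]
  ext v
  simp [sum_apply]
  rfl

end CovAlongFrame

end DbarExpansion

namespace DbarExpansion

/-! ### Parallel transport along the curves of an exponential-like map -/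

section Transport

variable {m : ℕ} {M : Type*} [TopologicalSpace M] [ChartedSpace (EuclideanSpace ℝ (Fin m)) M]
  [IsManifold (𝓡 m) ∞ M]

local notation "𝔼" => EuclideanSpace ℝ (Fin m)

local notation "TM" => (TangentSpace (𝓡 m) : M → Type _)

variable {nabla : CovariantDerivative (𝓡 m) (EuclideanSpace ℝ (Fin m))
  (TangentSpace (𝓡 m) : M → Type _)}
  {exp : TangentBundle (𝓡 m) M → M}
  {W : Type} [NormedAddCommGroup W] [NormedSpace ℝ W] [FiniteDimensional ℝ W] {U : Set M}

lemma TangentFrame.isSmoothAlongAt (Φ : TangentFrame (m := m) W U)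
    {E₁ : Type*} [NormedAddCommGroup E₁] [NormedSpace ℝ E₁]
    {G : Type*} [TopologicalSpace G] {IN : ModelWithCorners ℝ E₁ G}
    {N : Type*} [TopologicalSpace N] [ChartedSpace G N] {f : N → M} {Z : N → W} {z : N}
    (hf : ContMDiffAt IN (𝓡 m) ∞ f z) (hZ : ContMDiffAt IN 𝓘(ℝ, W) ∞ Z z) :
    IsSmoothAlongAt (𝓡 m) IN f (fun z => Φ.s (f z) (Z z)) z := by
  have hs : IsSmoothHomAt 𝓘(ℝ, W) (𝓡 m) IN (fun _ => (0 : W)) f (fun z => Φ.s (f z)) z :=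
    isSmoothHomAt_of_apply fun c => ((Φ.s_smooth c).at (f z)).comp_right hf
  exact hs.apply (ξ := Z) ((isSmoothAlongAt_model_iff contMDiffAt_const).2 hZ) hf

/-- The connection matrix of a frame: `c ↦ θ (∇_w (s c))`. -/
noncomputable def TangentFrame.conn (Φ : TangentFrame (m := m) W U)
    (nabla : CovariantDerivative (𝓡 m) (EuclideanSpace ℝ (Fin m))
      (TangentSpace (𝓡 m) : M → Type _)) (x : M) (w : TangentSpace (𝓡 m) x) : W →L[ℝ] W :=
  ∑ i, (LinearMap.toContinuousLinearMap ((Module.finBasis ℝ W).coord i)).smulRight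
    (Φ.θ x (nabla (fun y => Φ.s y (Module.finBasis ℝ W i)) x w))

lemma TangentFrame.conn_apply (Φ : TangentFrame (m := m) W U) (x : M) (w : TangentSpace (𝓡 m) x)
    (c : W) : Φ.conn nabla x w c = Φ.θ x (nabla (fun y => Φ.s y c) x w) := by
  conv_rhs => rw [← (Module.finBasis ℝ W).sum_repr c]
  rw [Φ.nabla_sum_smul]
  simp [TangentFrame.conn, sum_apply]

/-- `∂ₜ exp(tv)`. -/
noncomputable def expVelocity (exp : TangentBundle (𝓡 m) M → M) (x : M)
    (v : TangentSpace (𝓡 m) x) (t : ℝ) : TangentSpace (𝓡 m) (expCurve exp x v t) :=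
  mfderiv 𝓘(ℝ, ℝ) (𝓡 m) (expCurve exp x v) t (1 : ℝ)

lemma TangentFrame.contMDiff_expCurve (Φ : TangentFrame (m := m) W U)
    (hexp : ContMDiff (𝓡 m).tangent (𝓡 m) ∞ exp)
    {E₁ : Type*} [NormedAddCommGroup E₁] [NormedSpace ℝ E₁]
    {G : Type*} [TopologicalSpace G] {IN : ModelWithCorners ℝ E₁ G}
    {N : Type*} [TopologicalSpace N] [ChartedSpace G N] {f : N → M} {Z : N → W} {τ : N → ℝ} {z : N}
    (hf : ContMDiffAt IN (𝓡 m) ∞ f z) (hZ : ContMDiffAt IN 𝓘(ℝ, W) ∞ Z z)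
    (hτ : ContMDiffAt IN 𝓘(ℝ, ℝ) ∞ τ z) :
    ContMDiffAt IN (𝓡 m) ∞ (fun z => expCurve exp (f z) (Φ.s (f z) (Z z)) (τ z)) z := by
  have h := Φ.isSmoothAlongAt hf (hτ.smul hZ)
  refine (hexp.contMDiffAt.comp z h).congr_of_eventuallyEq
    (Filter.Eventually.of_forall fun z' => ?_)
  simp [expCurve]

lemma contMDiff_expCurve (hexp : ContMDiff (𝓡 m).tangent (𝓡 m) ∞ exp) (x : M)
    (v : TangentSpace (𝓡 m) x) : ContMDiff 𝓘(ℝ, ℝ) (𝓡 m) ∞ (expCurve exp x v) := by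
  intro t
  refine hexp.contMDiffAt.comp t (contMDiffAt_totalSpace.2 ⟨contMDiffAt_const, ?_⟩)
  refine (ContMDiffAt.smul contMDiffAt_id (contMDiffAt_const
    (c := (trivializationAt 𝔼 TM x ⟨x, v⟩).2))).congr_of_eventuallyEq
      (Filter.Eventually.of_forall fun t' => ?_)
  exact ((trivializationAt 𝔼 TM x).linear ℝ
    (mem_baseSet_trivializationAt 𝔼 TM x)).map_smul t' v

/-- The coefficient of the equation `Z' = -conn(γ') Z` for parallel transport along `γ(t) = exp(t
s_x c)`, jointly in `((x, c), t)`. Using `(x, c) ∈ M × W` in place of a vector in `TM` makes the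
parameter space a product. -/
lemma TangentFrame.contMDiff_conn (hsmooth : nabla.ContMDiffCovariantDerivative ∞)
    (hexp : ContMDiff (𝓡 m).tangent (𝓡 m) ∞ exp) (Φ : TangentFrame (m := m) W U) :
    ContMDiff (((𝓡 m).prod 𝓘(ℝ, W)).prod 𝓘(ℝ, ℝ)) 𝓘(ℝ, W →L[ℝ] W) ∞
      (fun p : (M × W) × ℝ => -Φ.conn nabla (expCurve exp p.1.1 (Φ.s p.1.1 p.1.2) p.2)
        (expVelocity exp p.1.1 (Φ.s p.1.1 p.1.2) p.2)) := by
  intro p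
  set γ : (M × W) × ℝ → M := fun p => expCurve exp p.1.1 (Φ.s p.1.1 p.1.2) p.2
  have h1 : ContMDiffAt (((𝓡 m).prod 𝓘(ℝ, W)).prod 𝓘(ℝ, ℝ)) (𝓡 m) ∞ γ p :=
    Φ.contMDiff_expCurve hexp (contMDiffAt_fst.comp p contMDiffAt_fst)
      (contMDiffAt_snd.comp p contMDiffAt_fst) contMDiffAt_snd
  have h2 : IsSmoothHomAt 𝓘(ℝ, ℝ) (𝓡 m) (((𝓡 m).prod 𝓘(ℝ, W)).prod 𝓘(ℝ, ℝ))
      (fun p : (M × W) × ℝ => p.2) γ (fun p => mfderiv 𝓘(ℝ, ℝ) (𝓡 m)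
        (fun t => expCurve exp p.1.1 (Φ.s p.1.1 p.1.2) t) p.2) p := by
    refine isSmoothHomAt_partial_mfderiv
      (f := fun (p : (M × W) × ℝ) t => expCurve exp p.1.1 (Φ.s p.1.1 p.1.2) t) ?_ contMDiffAt_snd
    exact Φ.contMDiff_expCurve hexp
      (f := fun z : ((M × W) × ℝ) × ℝ => z.1.1.1) (Z := fun z : ((M × W) × ℝ) × ℝ => z.1.1.2)
      (contMDiff_fst.comp (contMDiff_fst.comp contMDiff_fst)).contMDiffAt
      (contMDiff_snd.comp (contMDiff_fst.comp contMDiff_fst)).contMDiffAt contMDiffAt_snd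
  have h3 : IsSmoothAlongAt (𝓡 m) (((𝓡 m).prod 𝓘(ℝ, W)).prod 𝓘(ℝ, ℝ)) γ
      (fun p => expVelocity exp p.1.1 (Φ.s p.1.1 p.1.2) p.2) p :=
    h2.apply (ξ := fun _ => (1 : ℝ))
      ((isSmoothAlongAt_model_iff contMDiffAt_snd).2 contMDiffAt_const) h1
  refine ContMDiffAt.neg (contMDiffAt_clm_of_apply fun c => ?_)
  simp only [Φ.conn_apply]
  exact Φ.contMDiff_repr ((((isSmoothHom_nabla hsmooth (Φ.s_smooth c)).at (γ p)).comp_right h1).apply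
    h3 h1)

lemma covAlong_real_eq_zero {γ : ℝ → M} {ζ : ∀ t, TangentSpace (𝓡 m) (γ t)} {t : ℝ}
    (h : covAlong (F := ℝ) nabla γ ζ t (1 : ℝ) = 0) : covAlong (F := ℝ) nabla γ ζ t = 0 := by
  refine ContinuousLinearMap.ext fun (c : ℝ) => ?_
  have h1 : c = c • (1 : ℝ) := by simp
  calc covAlong (F := ℝ) nabla γ ζ t c = covAlong (F := ℝ) nabla γ ζ t (c • (1 : ℝ)) :=
        congrArg _ h1
    _ = c • covAlong (F := ℝ) nabla γ ζ t (1 : ℝ) := map_smul _ _ _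
    _ = 0 := by rw [h, smul_zero]

lemma TangentFrame.covAlong_real (Φ : TangentFrame (m := m) W U) {γ : ℝ → M} {Z : ℝ → W} {Z' : W}
    {t : ℝ} (hγ : MDifferentiableAt 𝓘(ℝ, ℝ) (𝓡 m) γ t) (hZ : HasDerivAt Z Z' t) :
    covAlong (F := ℝ) nabla γ (fun t => Φ.s (γ t) (Z t)) t (1 : ℝ) =
      Φ.s (γ t) Z' + nabla (fun y => Φ.s y (Z t)) (γ t) (mfderiv 𝓘(ℝ, ℝ) (𝓡 m) γ t (1 : ℝ)) := by
  rw [Φ.covAlong_eq hγ hZ.differentiableAt.mdifferentiableAt]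
  have h1 : mvfderiv 𝓘(ℝ, ℝ) Z t (1 : ℝ) = Z' := by
    have h0 : fderiv ℝ Z t 1 = Z' := by
      rw [fderiv_apply_one_eq_deriv, hZ.deriv]
    simp only [mvfderiv, mfderiv_eq_fderiv]
    exact h0
  have h2 : ((Φ.s (γ t)).comp (mvfderiv 𝓘(ℝ, ℝ) Z t)) (1 : ℝ) = Φ.s (γ t) Z' :=
    congrArg (Φ.s (γ t)) h1
  exact congrArg₂ (· + ·) h2 rfl

/-- One has `∇_t (s Z) = s Z' + ∇_{γ'} (s Z)`. The equation makes the first term equal to `-s θ` of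
the second, and `s θ = id` over `U`. -/
lemma isParallelTransport_of_frame (hexp : IsExponentialLike (𝓡 m) exp)
    (Φ : TangentFrame (m := m) W U) {x : M} {v : TangentSpace (𝓡 m) x}
    (hU : ∀ t ∈ Icc (0 : ℝ) 1, expCurve exp x v t ∈ U) {Z : ℝ → W}
    (hZs : ContDiffOn ℝ ∞ Z (Ioo (-1) 2))
    (hZ : ∀ t ∈ Ioo (-1 : ℝ) 2, HasDerivAt Z
      (-Φ.conn nabla (expCurve exp x v t) (expVelocity exp x v t) (Z t)) t) :
    IsParallelTransport nabla exp x v (Φ.s x (Z 0)) (Φ.s (exp ⟨x, v⟩) (Z 1)) := by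
  have hsub : Icc (0 : ℝ) 1 ⊆ Ioo (-1) 2 := fun t ht => ⟨by linarith [ht.1], by linarith [ht.2]⟩
  -- `IsParallelTransport` asks for a field that is smooth on all of `ℝ`, while `Z` is only smooth
  -- on `(-1, 2)`. The cutoff is one near `[0, 1]` and vanishes off `(-1/2, 3/2)`.
  obtain ⟨χ, hχ1, hχ2, hχs⟩ : ∃ χ : ℝ → ℝ, (∀ t ∈ Icc (0 : ℝ) 1, ∀ᶠ t' in 𝓝 t, χ t' = 1) ∧
      (∀ t ∉ Ioo (-1 : ℝ) 2, ∀ᶠ t' in 𝓝 t, χ t' = 0) ∧ ContDiff ℝ ∞ χ := by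
    let χ : ContDiffBump (1 / 2 : ℝ) := ⟨3 / 4, 1, by norm_num, by norm_num⟩
    refine ⟨χ, fun t ht => ?_, fun t ht => ?_, χ.contDiff⟩
    · have : t ∈ Metric.ball (1 / 2 : ℝ) (3 / 4) := by
        rw [Metric.mem_ball, Real.dist_eq, abs_lt]
        constructor <;> linarith [ht.1, ht.2]
      filter_upwards [Metric.isOpen_ball.mem_nhds this] with t' ht'
      exact χ.one_of_mem_closedBall (Metric.ball_subset_closedBall ht')
    · have : 1 < dist t (1 / 2 : ℝ) := by
        rw [Real.dist_eq, lt_abs]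
        rw [mem_Ioo, not_and_or, not_lt, not_lt] at ht
        rcases ht with ht | ht
        · right; linarith
        · left; linarith
      have hc : ContinuousAt (fun t => dist t (1 / 2 : ℝ)) t := by fun_prop
      filter_upwards [hc (Ioi_mem_nhds this)] with t' ht'
      exact χ.zero_of_le_dist (le_of_lt ht')
  set Y : ℝ → W := fun t => χ t • Z t
  have hY : ContDiff ℝ ∞ Y := by
    rw [contDiff_iff_contDiffAt]
    intro t
    by_cases ht : t ∈ Ioo (-1 : ℝ) 2
    · exact hχs.contDiffAt.smul (hZs.contDiffAt (isOpen_Ioo.mem_nhds ht))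
    · refine (contDiffAt_const (c := (0 : W))).congr_of_eventuallyEq ?_
      filter_upwards [hχ2 t ht] with t' ht'
      simp [Y, ht']
  have hYZ : ∀ t ∈ Icc (0 : ℝ) 1, Y =ᶠ[𝓝 t] Z := fun t ht => by
    filter_upwards [hχ1 t ht] with t' ht'
    simp [Y, ht']
  have hγ := contMDiff_expCurve hexp.smooth x v
  have key : ∀ (y x' : M) (c : W), y = x' →
      (⟨y, Φ.s y c⟩ : TangentBundle (𝓡 m) M) = ⟨x', Φ.s x' c⟩ := by
    rintro y _ c rfl
    rfl
  refine ⟨fun t => Φ.s (expCurve exp x v t) (Y t), fun t =>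
    Φ.isSmoothAlongAt (hγ t) hY.contMDiff.contMDiffAt, fun t ht => ?_, ?_, ?_⟩
  · have h1 := hZ t (hsub ht)
    have h2 := h1.congr_of_eventuallyEq (hYZ t ht)
    refine covAlong_real_eq_zero ?_
    rw [Φ.covAlong_real ((hγ t).mdifferentiableAt (by simp)) h2, (hYZ t ht).eq_of_nhds, map_neg,
      Φ.conn_apply, Φ.s_θ _ (hU t ht)]
    exact neg_add_cancel _
  · beta_reduce
    rw [(hYZ 0 ⟨le_rfl, zero_le_one⟩).eq_of_nhds]
    exact key _ _ _ (by simp [expCurve, hexp.zero])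
  · beta_reduce
    rw [(hYZ 1 ⟨zero_le_one, le_rfl⟩).eq_of_nhds]
    exact key _ _ _ (by simp [expCurve])

lemma IsParallelTransport.map_J [T2Space M] (hexp : IsExponentialLike (𝓡 m) exp)
    {J : ∀ x : M, TangentSpace (𝓡 m) x →L[ℝ] TangentSpace (𝓡 m) x}
    (hJ : IsSmoothHom (𝓡 m) (𝓡 m) (𝓡 m) (id : M → M) (id : M → M) J) (hnablaJ : IsJLinear nabla J)
    {x : M} {v w₀ : TangentSpace (𝓡 m) x} {w₁ : TangentSpace (𝓡 m) (exp ⟨x, v⟩)}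
    (h : IsParallelTransport nabla exp x v w₀ w₁) :
    IsParallelTransport nabla exp x v (J x w₀) (J _ w₁) := by
  obtain ⟨ζ, hζ, hp, h0, h1⟩ := h
  have key : ∀ (y x' : M) (a : TangentSpace (𝓡 m) y) (c : TangentSpace (𝓡 m) x'),
      (⟨y, a⟩ : TangentBundle (𝓡 m) M) = ⟨x', c⟩ →
      (⟨y, J y a⟩ : TangentBundle (𝓡 m) M) = ⟨x', J x' c⟩ := by
    intro y x' a c hac
    obtain rfl : y = x' := congrArg TotalSpace.proj hac
    rw [eq_of_heq (TotalSpace.mk.inj hac).2]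
  have hγ := contMDiff_expCurve hexp.smooth x v
  refine ⟨fun t => J _ (ζ t), fun t => ?_, fun t ht => ?_, key _ _ _ _ h0, key _ _ _ _ h1⟩
  · exact ((hJ.at _).comp_right (hγ t)).apply (hζ.at t) (hγ t)
  · rw [covAlong_J hJ hnablaJ ((hζ.at t).alongDiffAt (F := ℝ)), hp t ht]
    exact ContinuousLinearMap.comp_zero _

/-- The parallel transport from `γ(1)` to `γ(0)` in a frame, for the curves
`γ(t) = exp(t s ê)`. -/
lemma exists_frame_transport (hsmooth : nabla.ContMDiffCovariantDerivative ∞)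
    (hexp : IsExponentialLike (𝓡 m) exp) (Φ : TangentFrame (m := m) W U) :
    ∃ Ψ : M × W → W →L[ℝ] W, ContMDiff ((𝓡 m).prod 𝓘(ℝ, W)) 𝓘(ℝ, W →L[ℝ] W) ∞ Ψ ∧
      ∀ (x : M) (c : W), (∀ t ∈ Icc (0 : ℝ) 1, expCurve exp x (Φ.s x c) t ∈ U) →
        ∀ X : TangentSpace (𝓡 m) (exp ⟨x, Φ.s x c⟩),
          IsParallelTransport nabla exp x (Φ.s x c) (Φ.s x (Ψ (x, c) (Φ.θ _ X))) X := by
  -- Normalising at `t = 1` and evaluating at `t = 0` transports backwards. The interval `[-1, 2]`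
  -- leaves room for two-sided derivatives on `[0, 1]`. The equation makes sense for every `(x, c)`,
  -- so `Ψ` is smooth everywhere; `U` enters only in its geometric meaning.
  obtain ⟨Y, hY1, hYd, hYs, hYp⟩ := exists_smooth_fundamentalSolution (l := -1) (r := 2) (t₀ := 1)
    (Φ.contMDiff_conn hsmooth hexp.smooth) (by norm_num)
  refine ⟨fun p => Y p 0, hYp 0, fun x c hU X => ?_⟩
  have h := isParallelTransport_of_frame (nabla := nabla) hexp Φ hU
    (Z := fun t => Y (x, c) t (Φ.θ _ X)) ?_ ?_
  · have h1 : exp ⟨x, Φ.s x c⟩ ∈ U := by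
      have := hU 1 ⟨zero_le_one, le_rfl⟩
      rwa [expCurve, one_smul] at this
    beta_reduce at h
    rw [hY1, ContinuousLinearMap.one_def, ContinuousLinearMap.id_apply, Φ.s_θ _ h1] at h
    exact h
  · exact (hYs (x, c)).clm_apply contDiffOn_const
  · intro t ht
    have := (hYd (x, c) t ht).clm_apply (hasDerivAt_const t (Φ.θ _ X))
    simpa using this

/-! ### Parallel transport is isometric, hence unique and invertible -/

section Metric

variable [T2Space M] [RiemannianBundle (fun x : M => TangentSpace (𝓡 m) x)]
  [IsContMDiffRiemannianBundle (𝓡 m) ∞ (EuclideanSpace ℝ (Fin m))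
    (fun x : M => TangentSpace (𝓡 m) x)]

lemma hasDerivAt_inner_along (hmetric : nabla.IsMetricCompatible) {γ : ℝ → M} {t : ℝ}
    {ζ ζ' : ∀ t, TangentSpace (𝓡 m) (γ t)} (hζ : AlongDiffAt (F := ℝ) γ ζ t)
    (hζ' : AlongDiffAt (F := ℝ) γ ζ' t) :
    HasDerivAt (fun t => inner ℝ (ζ t) (ζ' t))
      (inner ℝ (covAlong (F := ℝ) nabla γ ζ t (1 : ℝ)) (ζ' t) +
        inner ℝ (ζ t) (covAlong (F := ℝ) nabla γ ζ' t (1 : ℝ))) t := by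
  obtain ⟨h2, h3⟩ := mvfderiv_inner_along hmetric hζ hζ'
  have h4 := h3 (1 : ℝ)
  have h6 := h2.differentiableAt.hasDerivAt
  rw [← fderiv_apply_one_eq_deriv, ← mfderiv_eq_fderiv] at h6
  exact h4 ▸ h6

/-- Along a curve, the inner product of two parallel fields has derivative zero. Uniqueness and
invertibility of transport are both deduced from this. -/
lemma IsParallelTransport.inner_eq (hmetric : nabla.IsMetricCompatible) {x : M}
    {v w₀ w₀' : TangentSpace (𝓡 m) x} {w₁ w₁' : TangentSpace (𝓡 m) (exp ⟨x, v⟩)}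
    (h : IsParallelTransport nabla exp x v w₀ w₁) (h' : IsParallelTransport nabla exp x v w₀' w₁') :
    inner ℝ w₀ w₀' = inner ℝ w₁ w₁' := by
  obtain ⟨ζ, hζ, hp, h0, h1⟩ := h
  obtain ⟨ζ', hζ', hp', h0', h1'⟩ := h'
  have key : ∀ (y x' : M) (a b : TangentSpace (𝓡 m) y) (c d : TangentSpace (𝓡 m) x'),
      (⟨y, a⟩ : TangentBundle (𝓡 m) M) = ⟨x', c⟩ → (⟨y, b⟩ : TangentBundle (𝓡 m) M) = ⟨x', d⟩ →
      inner ℝ a b = inner ℝ c d := by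
    intro y x' a b c d hac hbd
    obtain rfl : y = x' := congrArg TotalSpace.proj hac
    rw [eq_of_heq (TotalSpace.mk.inj hac).2, eq_of_heq (TotalSpace.mk.inj hbd).2]
  rw [← key _ _ _ _ _ _ h0 h0', ← key _ _ _ _ _ _ h1 h1']
  have hd : ∀ t ∈ Icc (0 : ℝ) 1, HasDerivAt (fun t => inner ℝ (ζ t) (ζ' t)) 0 t := by
    intro t ht
    have h2 := hasDerivAt_inner_along hmetric ((hζ.at t).alongDiffAt (F := ℝ))
      ((hζ'.at t).alongDiffAt (F := ℝ))
    have h3 : covAlong (F := ℝ) nabla (expCurve exp x v) ζ t (1 : ℝ) = 0 := by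
      rw [hp t ht]
      rfl
    have h4 : covAlong (F := ℝ) nabla (expCurve exp x v) ζ' t (1 : ℝ) = 0 := by
      rw [hp' t ht]
      rfl
    simpa [h3, h4] using h2
  refine (constant_of_derivWithin_zero (fun t ht => (hd t ht).differentiableAt.differentiableWithinAt)
    (fun t ht => ?_) 1 ⟨zero_le_one, le_rfl⟩).symm
  exact (hd t (Ico_subset_Icc_self ht)).hasDerivWithinAt.derivWithin
    (uniqueDiffOn_Icc zero_lt_one t (Ico_subset_Icc_self ht))

/-- In the expansion of `|w₀ - w₀'|²` all four pairings equal `|w₁|²`. -/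
lemma IsParallelTransport.unique (hmetric : nabla.IsMetricCompatible) {x : M}
    {v w₀ w₀' : TangentSpace (𝓡 m) x} {w₁ : TangentSpace (𝓡 m) (exp ⟨x, v⟩)}
    (h : IsParallelTransport nabla exp x v w₀ w₁) (h' : IsParallelTransport nabla exp x v w₀' w₁) :
    w₀ = w₀' := by
  rw [← sub_eq_zero, ← inner_self_eq_zero (𝕜 := ℝ)]
  rw [inner_sub_left, inner_sub_right, inner_sub_right, h.inner_eq hmetric h,
    h.inner_eq hmetric h', h'.inner_eq hmetric h, h'.inner_eq hmetric h']
  ring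

/-- Over a frame on the compact curve, backward transport is a linear map `L`, injective because it
is isometric. Both fibres are `𝔼`, so `L` is an isomorphism by dimension, and its inverse is the
witness that the choice in `parallelTransport` needs. -/
lemma exists_isParallelTransport (hsmooth : nabla.ContMDiffCovariantDerivative ∞)
    (hexp : IsExponentialLike (𝓡 m) exp) (hmetric : nabla.IsMetricCompatible) (x : M)
    (v : TangentSpace (𝓡 m) x) :
    ∃ P : TangentSpace (𝓡 m) x ≃L[ℝ] TangentSpace (𝓡 m) (exp ⟨x, v⟩),
      ∀ w, IsParallelTransport nabla exp x v w (P w) := by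
  have hγ := contMDiff_expCurve hexp.smooth x v
  have hK : IsCompact (expCurve exp x v '' Icc 0 1) := isCompact_Icc.image hγ.continuous
  obtain ⟨q, U, hU, ⟨Φ⟩⟩ := exists_tangentFrame (M := M) (m := m) hK
  obtain ⟨Ψ, -, hΨ⟩ := exists_frame_transport hsmooth hexp Φ
  have hxU : x ∈ U := by
    have := hU (mem_image_of_mem _ (⟨le_rfl, zero_le_one⟩ : (0 : ℝ) ∈ Icc (0 : ℝ) 1))
    rwa [expCurve, zero_smul, hexp.zero] at this
  obtain ⟨c, rfl⟩ : ∃ c, v = Φ.s x c := ⟨Φ.θ x v, (Φ.s_θ x hxU v).symm⟩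
  have hΨ' := hΨ x c fun t ht => hU (mem_image_of_mem _ ht)
  let L : TangentSpace (𝓡 m) (exp ⟨x, Φ.s x c⟩) →L[ℝ] TangentSpace (𝓡 m) x :=
    (Φ.s x).comp ((Ψ (x, c)).comp (Φ.θ _))
  have hL : ∀ X, IsParallelTransport nabla exp x (Φ.s x c) (L X) X := hΨ'
  have hinj : Function.Injective L := by
    intro X X' hXX
    have h1 := (hL X).inner_eq hmetric (hL X)
    have h2 := (hL X).inner_eq hmetric (hL X')
    have h3 := (hL X').inner_eq hmetric (hL X')
    rw [← hXX] at h2 h3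
    rw [← sub_eq_zero, ← inner_self_eq_zero (𝕜 := ℝ)]
    rw [inner_sub_left, inner_sub_right, inner_sub_right, ← h1, ← h2, ← h3,
      real_inner_comm X X', ← h2]
    ring
  let L' : 𝔼 →L[ℝ] 𝔼 := L
  let e : 𝔼 ≃L[ℝ] 𝔼 := (LinearEquiv.ofInjectiveEndo (L' : 𝔼 →ₗ[ℝ] 𝔼) hinj).toContinuousLinearEquiv
  refine ⟨e.symm, fun w => ?_⟩
  have h := hL (e.symm w)
  have h' : L (e.symm w) = w := e.apply_symm_apply w
  rwa [h'] at h

lemma parallelTransport_spec (hsmooth : nabla.ContMDiffCovariantDerivative ∞)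
    (hexp : IsExponentialLike (𝓡 m) exp) (hmetric : nabla.IsMetricCompatible) (x : M)
    (v w : TangentSpace (𝓡 m) x) :
    IsParallelTransport nabla exp x v w (parallelTransport nabla exp x v w) :=
  Classical.epsilon_spec (exists_isParallelTransport hsmooth hexp hmetric x v) w

lemma IsParallelTransport.symm_eq (hsmooth : nabla.ContMDiffCovariantDerivative ∞)
    (hexp : IsExponentialLike (𝓡 m) exp) (hmetric : nabla.IsMetricCompatible) {x : M}
    {v w₀ : TangentSpace (𝓡 m) x} {w₁ : TangentSpace (𝓡 m) (exp ⟨x, v⟩)}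
    (h : IsParallelTransport nabla exp x v w₀ w₁) :
    (parallelTransport nabla exp x v).symm w₁ = w₀ := by
  have h1 := parallelTransport_spec hsmooth hexp hmetric x v
    ((parallelTransport nabla exp x v).symm w₁)
  rw [ContinuousLinearEquiv.apply_symm_apply] at h1
  exact h1.unique hmetric h

/-- `J` maps parallel fields to parallel fields, and the initial vector of a transport is unique. -/
lemma parallelTransport_symm_J (hsmooth : nabla.ContMDiffCovariantDerivative ∞)
    (hexp : IsExponentialLike (𝓡 m) exp) (hmetric : nabla.IsMetricCompatible)
    {J : ∀ x : M, TangentSpace (𝓡 m) x →L[ℝ] TangentSpace (𝓡 m) x}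
    (hJ : IsSmoothHom (𝓡 m) (𝓡 m) (𝓡 m) (id : M → M) (id : M → M) J) (hnablaJ : IsJLinear nabla J)
    {x : M} (v : TangentSpace (𝓡 m) x) (X : TangentSpace (𝓡 m) (exp ⟨x, v⟩)) :
    (parallelTransport nabla exp x v).symm (J _ X) =
      J x ((parallelTransport nabla exp x v).symm X) := by
  have h1 := parallelTransport_spec hsmooth hexp hmetric x v
    ((parallelTransport nabla exp x v).symm X)
  rw [ContinuousLinearEquiv.apply_symm_apply] at h1
  exact (h1.map_J hexp hJ hnablaJ).symm_eq hsmooth hexp hmetric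

end Metric

end Transport

end DbarExpansion

namespace DbarExpansion

/-! ### The torsion and mixed second derivatives -/

section Torsion

variable {m : ℕ} {M : Type*} [TopologicalSpace M] [ChartedSpace (EuclideanSpace ℝ (Fin m)) M]
  [IsManifold (𝓡 m) ∞ M]

local notation "𝔼" => EuclideanSpace ℝ (Fin m)

local notation "TM" => (TangentSpace (𝓡 m) : M → Type _)

variable {nabla : CovariantDerivative (𝓡 m) (EuclideanSpace ℝ (Fin m))
  (TangentSpace (𝓡 m) : M → Type _)}

/-- The vector field near `x` with constant coefficients `c` in the coordinates around `x`. -/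
noncomputable def coordField (x : M) (c : EuclideanSpace ℝ (Fin m)) (y : M) :
    TangentSpace (𝓡 m) y :=
  (trivializationAt (EuclideanSpace ℝ (Fin m)) (TangentSpace (𝓡 m) : M → Type _) x).symmL ℝ y c

lemma localFrame_apply_eq {x y : M} (hy : y ∈ (trivializationAt 𝔼 TM x).baseSet) (i : Fin m) :
    (trivializationAt 𝔼 TM x).localFrame (EuclideanSpace.basisFun (Fin m) ℝ).toBasis i y =
      coordField x (EuclideanSpace.basisFun (Fin m) ℝ i) y := by
  rw [Trivialization.localFrame_apply_of_mem_baseSet _ _ hy]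
  simp only [coordField, Trivialization.basisAt]
  rw [Trivialization.symmL_apply _ hy]
  simp

lemma lieBracketWithin_univ_eq_zero {E : Type*} [NormedAddCommGroup E] [NormedSpace ℝ E]
    {V V' : E → E} {y c c' : E} (h : V =ᶠ[𝓝 y] fun _ => c) (h' : V' =ᶠ[𝓝 y] fun _ => c') :
    VectorField.lieBracketWithin ℝ V V' univ y = 0 := by
  simp [VectorField.lieBracket_eq, h.fderiv_eq, h'.fderiv_eq]

lemma sum_smul_basisFun (c : 𝔼) : ∑ i, c i • EuclideanSpace.basisFun (Fin m) ℝ i = c := by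
  simpa using (EuclideanSpace.basisFun (Fin m) ℝ).sum_repr c

lemma coordField_eq_sum {x y : M} (hy : y ∈ (trivializationAt 𝔼 TM x).baseSet) (c : 𝔼) :
    coordField x c y = ∑ i, c i • (trivializationAt 𝔼 TM x).localFrame
      (EuclideanSpace.basisFun (Fin m) ℝ).toBasis i y := by
  simp_rw [localFrame_apply_eq hy]
  conv_lhs => rw [← sum_smul_basisFun c]
  simp only [coordField, map_sum, map_smul]

/-- In the chart at `x` both fields are constant. -/
lemma mlieBracket_coordField (x : M) (c c' : 𝔼) :
    VectorField.mlieBracket (𝓡 m) (coordField x c) (coordField x c') x = 0 := by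
  have key : ∀ c : 𝔼, VectorField.mpullbackWithin 𝓘(ℝ, 𝔼) (𝓡 m) (extChartAt (𝓡 m) x).symm
      (coordField x c) (range (𝓡 m)) =ᶠ[𝓝 (extChartAt (𝓡 m) x x)] fun _ => c := by
    intro c
    filter_upwards [extChartAt_target_mem_nhds (I := 𝓡 m) x] with y hy
    have hy' := (extChartAt (𝓡 m) x).map_target hy
    rw [extChartAt_source] at hy'
    rw [VectorField.mpullbackWithin_apply, coordField, TangentBundle.symmL_trivializationAt hy']
    rw [(extChartAt (𝓡 m) x).right_inv hy]
    exact (isInvertible_mfderivWithin_extChartAt_symm hy).inverse_apply_self _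
  rw [← VectorField.mlieBracketWithin_univ, VectorField.mlieBracketWithin_apply]
  have h0 : VectorField.lieBracketWithin ℝ
      (VectorField.mpullbackWithin 𝓘(ℝ, 𝔼) (𝓡 m) (extChartAt (𝓡 m) x).symm
        (coordField x c) (range (𝓡 m)))
      (VectorField.mpullbackWithin 𝓘(ℝ, 𝔼) (𝓡 m) (extChartAt (𝓡 m) x).symm
        (coordField x c') (range (𝓡 m)))
      ((extChartAt (𝓡 m) x).symm ⁻¹' univ ∩ range (𝓡 m)) (extChartAt (𝓡 m) x x) = 0 := by
    rw [preimage_univ, univ_inter, ModelWithCorners.range_eq_univ]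
    have h1 := key c
    have h2 := key c'
    rw [ModelWithCorners.range_eq_univ] at h1 h2
    exact lieBracketWithin_univ_eq_zero h1 h2
  rw [h0]
  exact map_zero _

lemma mdifferentiableAt_coordField (x : M) (c : 𝔼) :
    MDifferentiableAt (𝓡 m) (𝓡 m).tangent
      (fun y => (⟨y, coordField x c y⟩ : TangentBundle (𝓡 m) M)) x := by
  refine (mdifferentiableAt_totalSpace _ _).2 ⟨mdifferentiableAt_id,
    (mdifferentiableAt_const (c := c)).congr_of_eventuallyEq ?_⟩
  filter_upwards [eventually_mem_baseSet (I := 𝓡 m) (f := id) (z₀ := x) continuousAt_id] with y hy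
  replace hy : y ∈ (trivializationAt 𝔼 TM x).baseSet := hy
  rw [coordField, (trivializationAt 𝔼 TM x).symmL_apply hy]
  exact congrArg Prod.snd ((trivializationAt 𝔼 TM x).apply_mk_symm hy c)

lemma nabla_coordField (x : M) (c : 𝔼) : nabla (coordField x c) x = ∑ i, c i •
    nabla ((trivializationAt 𝔼 TM x).localFrame (EuclideanSpace.basisFun (Fin m) ℝ).toBasis i) x := by
  have hx : x ∈ (trivializationAt 𝔼 TM x).baseSet := mem_baseSet_trivializationAt 𝔼 TM x
  have he : ∀ i, MDifferentiableAt (𝓡 m) (𝓡 m).tangent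
      (fun y => (⟨y, (trivializationAt 𝔼 TM x).localFrame
        (EuclideanSpace.basisFun (Fin m) ℝ).toBasis i y⟩ : TangentBundle (𝓡 m) M)) x := fun i =>
    (contMDiffAt_localFrame_of_mem 1 _ _ i hx).mdifferentiableAt one_ne_zero
  have h1 : ∀ᶠ y in 𝓝 x, coordField x c y = ∑ i, (c i • (trivializationAt 𝔼 TM x).localFrame
      (EuclideanSpace.basisFun (Fin m) ℝ).toBasis i) y := by
    filter_upwards [eventually_mem_baseSet (I := 𝓡 m) (f := id) (z₀ := x) continuousAt_id] with y hy
    exact coordField_eq_sum hy c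
  have hge : ∀ i ∈ Finset.univ, MDifferentiableAt (𝓡 m) (𝓡 m).tangent
      (fun y => (⟨y, (c i • (trivializationAt 𝔼 TM x).localFrame
        (EuclideanSpace.basisFun (Fin m) ℝ).toBasis i) y⟩ : TangentBundle (𝓡 m) M)) x :=
    fun i _ => MDifferentiableAt.smul_section mdifferentiableAt_const (he i)
  rw [nabla.isCovariantDerivativeOnUniv.congr_of_eventuallyEq (mdifferentiableAt_coordField x c)
    (MDifferentiableAt.sum_section (s := Finset.univ) (I := 𝓡 m) (F := 𝔼) hge)
    Filter.univ_mem h1, nabla_sum _ hge]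
  exact Finset.sum_congr rfl fun i _ =>
    nabla.isCovariantDerivativeOnUniv.smul_const (c i) (he i)

/-- Extending both vectors with constant coefficients makes the bracket disappear and leaves the
antisymmetrised Christoffel term. -/
lemma torsion_eq_coordField (x : M) (a b : TangentSpace (𝓡 m) x) :
    nabla.torsion x a b = nabla (coordField x (trivializationAt 𝔼 TM x ⟨x, b⟩).2) x a -
      nabla (coordField x (trivializationAt 𝔼 TM x ⟨x, a⟩).2) x b := by
  have hx : x ∈ (trivializationAt 𝔼 TM x).baseSet := mem_baseSet_trivializationAt 𝔼 TM x
  have key : ∀ a : TangentSpace (𝓡 m) x,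
      coordField x (trivializationAt 𝔼 TM x ⟨x, a⟩).2 x = a := fun a => by
    have := (trivializationAt 𝔼 TM x).symmL_continuousLinearMapAt (R := ℝ) hx a
    rwa [Trivialization.continuousLinearMapAt_apply,
      Trivialization.coe_linearMapAt_of_mem _ hx] at this
  have h := nabla.torsion_apply (mdifferentiableAt_coordField x (trivializationAt 𝔼 TM x ⟨x, a⟩).2)
    (mdifferentiableAt_coordField x (trivializationAt 𝔼 TM x ⟨x, b⟩).2)
  rw [mlieBracket_coordField, sub_zero, key, key] at h
  exact h

variable {F : Type*} [NormedAddCommGroup F] [NormedSpace ℝ F]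
  {N : Type*} [TopologicalSpace N] [ChartedSpace F N]

/-- The derivative of the coordinate vector plus a Christoffel term, in the same fields as in
`torsion_eq_coordField`, so that the two can be compared. -/
lemma covAlong_eq_coordField {f : N → M} {ξ : ∀ z : N, TangentSpace (𝓡 m) (f z)} {z : N}
    (hξ : AlongDiffAt (F := F) f ξ z) (v : TangentSpace 𝓘(ℝ, F) z) :
    covAlong nabla f ξ z v = coordField (f z) (mvfderiv 𝓘(ℝ, F)
        (fun z' => (trivializationAt 𝔼 TM (f z) ⟨f z', ξ z'⟩).2) z v) (f z) +
      nabla (coordField (f z) (trivializationAt 𝔼 TM (f z) ⟨f z, ξ z⟩).2) (f z)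
        (mfderiv 𝓘(ℝ, F) (𝓡 m) f z v) := by
  have hx : f z ∈ (trivializationAt 𝔼 TM (f z)).baseSet := mem_baseSet_trivializationAt 𝔼 TM (f z)
  have h := (mdifferentiableAt_totalSpace _ _).1 hξ
  have h1 : ∀ i, mvfderiv 𝓘(ℝ, F) (fun z' : N => (trivializationAt 𝔼 TM (f z)).localFrameCoeff
      (𝓡 m) (EuclideanSpace.basisFun (Fin m) ℝ).toBasis i (f z') (ξ z')) z v =
      (mvfderiv 𝓘(ℝ, F) (fun z' => (trivializationAt 𝔼 TM (f z) ⟨f z', ξ z'⟩).2) z v) i := by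
    intro i
    have hp : MDifferentiableAt 𝓘(ℝ, 𝔼) 𝓘(ℝ, ℝ) (EuclideanSpace.proj i : 𝔼 →L[ℝ] ℝ)
        (trivializationAt 𝔼 TM (f z) ⟨f z, ξ z⟩).2 := ContinuousLinearMap.mdifferentiableAt _
    have h2 := mfderiv_comp (M := N) (I := 𝓘(ℝ, F)) (I' := 𝓘(ℝ, 𝔼)) (I'' := 𝓘(ℝ, ℝ)) z hp h.2
    rw [ContinuousLinearMap.mfderiv_eq] at h2
    have h5 : (fun z' : N => (trivializationAt 𝔼 TM (f z)).localFrameCoeff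
        (𝓡 m) (EuclideanSpace.basisFun (Fin m) ℝ).toBasis i (f z') (ξ z')) =ᶠ[𝓝 z]
        fun z' => (trivializationAt 𝔼 TM (f z) ⟨f z', ξ z'⟩).2 i := by
      filter_upwards [eventually_mem_baseSet (I := 𝓡 m) h.1.continuousAt] with z' hz'
      exact localFrameCoeff_apply_eq hz' (ξ z') i
    refine Eq.trans ?_ (DFunLike.congr_fun h2 v)
    exact DFunLike.congr_fun (h5.mfderiv_eq (I := 𝓘(ℝ, F)) (I' := 𝓘(ℝ, ℝ))) v
  rw [nabla_coordField]
  rw [coordField_eq_sum hx]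
  simp only [covAlong, sum_apply, add_apply, ContinuousLinearMap.smulRight_apply, smul_apply,
    ContinuousLinearMap.comp_apply, Finset.sum_add_distrib, h1]
  congr 1
  refine Finset.sum_congr rfl fun i _ => ?_
  rw [localFrameCoeff_apply_eq hx]

/-- The velocity `γ'(t)`. -/
noncomputable def vel (γ : ℝ → M) (t : ℝ) : TangentSpace (𝓡 m) (γ t) :=
  mfderiv 𝓘(ℝ, ℝ) (𝓡 m) γ t (1 : ℝ)

/-- The covariant derivative `D_t ζ` of a vector field along the curve `γ`. -/
noncomputable def covDeriv (nabla : CovariantDerivative (𝓡 m) (EuclideanSpace ℝ (Fin m))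
      (TangentSpace (𝓡 m) : M → Type _)) (γ : ℝ → M) (ζ : ∀ t, TangentSpace (𝓡 m) (γ t)) (t : ℝ) :
    TangentSpace (𝓡 m) (γ t) :=
  covAlong (F := ℝ) nabla γ ζ t (1 : ℝ)

lemma covDeriv_eq_coordField {γ : ℝ → M} {ζ : ∀ t, TangentSpace (𝓡 m) (γ t)} {t : ℝ}
    (hζ : AlongDiffAt (F := ℝ) γ ζ t) :
    covDeriv nabla γ ζ t = coordField (γ t)
        (deriv (fun t' => (trivializationAt 𝔼 TM (γ t) ⟨γ t', ζ t'⟩).2) t) (γ t) +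
      nabla (coordField (γ t) (trivializationAt 𝔼 TM (γ t) ⟨γ t, ζ t⟩).2) (γ t) (vel γ t) := by
  refine (covAlong_eq_coordField hζ (1 : ℝ)).trans ?_
  rw [← fderiv_apply_one_eq_deriv]
  simp only [mvfderiv, mfderiv_eq_fderiv]
  rfl

lemma trivializationAt_vel {x : M} {g : ℝ → M} {t : ℝ}
    (hg : MDifferentiableAt 𝓘(ℝ, ℝ) (𝓡 m) g t) (ht : g t ∈ (chartAt 𝔼 x).source) :
    (trivializationAt 𝔼 TM x ⟨g t, vel g t⟩).2 =
      deriv (fun t => extChartAt (𝓡 m) x (g t)) t := by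
  have h1 : g t ∈ (trivializationAt 𝔼 TM x).baseSet := ht
  have h2 := Trivialization.continuousLinearMapAt_apply (R := ℝ) (trivializationAt 𝔼 TM x)
    (g t)
  replace h2 := congrFun h2 (vel g t)
  rw [Trivialization.coe_linearMapAt_of_mem _ h1,
    TangentBundle.continuousLinearMapAt_trivializationAt ht] at h2
  have h3 := mfderiv_comp t (mdifferentiableAt_extChartAt (I := 𝓡 m) ht) hg
  rw [mfderiv_eq_fderiv] at h3
  rw [← fderiv_apply_one_eq_deriv]
  exact h2.symm.trans (DFunLike.congr_fun h3 (1 : ℝ)).symm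

/-- The torsion measures the failure of `D_t ∂_s α = D_s ∂_t α`. -/
lemma covDeriv_vel_sub {α : ℝ → ℝ → M}
    (hα : ContMDiff (𝓘(ℝ, ℝ).prod 𝓘(ℝ, ℝ)) (𝓡 m) ∞ (Function.uncurry α)) (s₀ t₀ : ℝ) :
    covDeriv nabla (fun t => α s₀ t)
        (fun t => vel (fun s => α s t) s₀) t₀ -
      covDeriv nabla (fun s => α s t₀)
        (fun s => vel (fun t => α s t) t₀) s₀ =
    nabla.torsion (α s₀ t₀) (vel (fun t => α s₀ t) t₀)
      (vel (fun s => α s t₀) s₀) := by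
  have hs : ∀ t s, ContMDiffAt 𝓘(ℝ, ℝ) (𝓡 m) ∞ (fun s => α s t) s := fun t s =>
    hα.contMDiffAt.comp (f := fun s => (s, t)) s
      (contMDiffAt_id.prodMk contMDiffAt_const)
  have ht : ∀ s t, ContMDiffAt 𝓘(ℝ, ℝ) (𝓡 m) ∞ (fun t => α s t) t := fun s t =>
    hα.contMDiffAt.comp (f := fun t => (s, t)) t
      (contMDiffAt_const.prodMk contMDiffAt_id)
  have hds : AlongDiffAt (F := ℝ) (fun t => α s₀ t)
      (fun t => vel (m := m) (fun s => α s t) s₀) t₀ := by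
    have h1 := isSmoothHomAt_partial_mfderiv (I := 𝓘(ℝ, ℝ)) (I' := 𝓡 m) (IN := 𝓘(ℝ, ℝ))
      (f := fun t s => α s t) (g := fun _ => s₀) (z₀ := t₀)
      (hα.contMDiffAt.comp (f := fun p : ℝ × ℝ => (p.2, p.1)) (t₀, s₀)
        (contMDiffAt_snd.prodMk contMDiffAt_fst)) contMDiffAt_const
    exact (h1.apply (ξ := fun _ => (1 : ℝ)) ((isSmoothAlongAt_model_iff contMDiffAt_const).2
      contMDiffAt_const) (ht s₀ t₀)).alongDiffAt
  have hdt : AlongDiffAt (F := ℝ) (fun s => α s t₀)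
      (fun s => vel (m := m) (fun t => α s t) t₀) s₀ := by
    have h1 := isSmoothHomAt_partial_mfderiv (I := 𝓘(ℝ, ℝ)) (I' := 𝓡 m) (IN := 𝓘(ℝ, ℝ))
      (f := fun s t => α s t) (g := fun _ => t₀) (z₀ := s₀)
      hα.contMDiffAt contMDiffAt_const
    exact (h1.apply (ξ := fun _ => (1 : ℝ)) ((isSmoothAlongAt_model_iff contMDiffAt_const).2
      contMDiffAt_const) (hs t₀ s₀)).alongDiffAt
  -- The Christoffel terms on the left are exactly the torsion. The coordinate derivatives are the
  -- two mixed second partials of `α` read in the chart at `α s₀ t₀`, which agree by symmetry.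
  rw [covDeriv_eq_coordField hds, covDeriv_eq_coordField hdt, torsion_eq_coordField]
  set φ := extChartAt (𝓡 m) (α s₀ t₀)
  have hmem : ∀ᶠ p in 𝓝 (s₀, t₀), α p.1 p.2 ∈ (chartAt 𝔼 (α s₀ t₀)).source :=
    hα.continuous.continuousAt ((chartAt 𝔼 (α s₀ t₀)).open_source.mem_nhds (mem_chart_source _ _))
  set β : ℝ × ℝ → 𝔼 := fun p => φ (α p.1 p.2)
  have hβ : ContDiffAt ℝ ∞ β (s₀, t₀) := by
    have h1 : ContMDiffAt (𝓘(ℝ, ℝ).prod 𝓘(ℝ, ℝ)) 𝓘(ℝ, 𝔼) ∞ β (s₀, t₀) :=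
      (contMDiffAt_extChartAt (I := 𝓡 m) (n := ∞) (x := α s₀ t₀)).comp (s₀, t₀) hα.contMDiffAt
    rw [← contMDiffAt_iff_contDiffAt, modelWithCornersSelf_prod, ← chartedSpaceSelf_prod]
    exact h1
  have hd : ∀ᶠ p in 𝓝 (s₀, t₀), DifferentiableAt ℝ β p := by
    filter_upwards [(hβ.of_le (m := 1) (by exact_mod_cast le_top)).eventually (by simp)] with p hp
    exact hp.differentiableAt (by simp)
  have h2 : DifferentiableAt ℝ (fderiv ℝ β) (s₀, t₀) :=
    (hβ.fderiv_right (m := ∞) (by rfl)).differentiableAt (by simp)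
  have hsymm : IsSymmSndFDerivAt ℝ β (s₀, t₀) := hβ.isSymmSndFDerivAt (by
    rw [minSmoothness_of_isRCLikeNormedField]; exact WithTop.coe_le_coe.2 le_top)
  have hc1 : ContinuousAt (fun t : ℝ => (s₀, t)) t₀ := by fun_prop
  have hc2 : ContinuousAt (fun s : ℝ => (s, t₀)) s₀ := by fun_prop
  have key1 : deriv (fun t => (trivializationAt 𝔼 TM (α s₀ t₀)
      ⟨α s₀ t, vel (fun s => α s t) s₀⟩).2) t₀ = fderiv ℝ (fderiv ℝ β) (s₀, t₀) (0, 1) (1, 0) := by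
    have h3 : (fun t => (trivializationAt 𝔼 TM (α s₀ t₀) ⟨α s₀ t, vel (fun s => α s t) s₀⟩).2)
        =ᶠ[𝓝 t₀] fun t => fderiv ℝ β (s₀, t) (1, 0) := by
      filter_upwards [hc1.eventually hmem, hc1.eventually hd] with t ht1 ht2
      rw [trivializationAt_vel ((hs t s₀).mdifferentiableAt (by simp)) ht1]
      exact (ht2.hasFDerivAt.comp_hasDerivAt (f := fun s => (s, t)) s₀
        ((hasDerivAt_id s₀).prodMk (hasDerivAt_const s₀ t))).deriv
    rw [h3.deriv_eq]
    have h4 := h2.hasFDerivAt.comp_hasDerivAt (f := fun t => (s₀, t)) t₀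
      ((hasDerivAt_const t₀ s₀).prodMk (hasDerivAt_id t₀))
    simpa using (h4.clm_apply (hasDerivAt_const t₀ ((1 : ℝ), (0 : ℝ)))).deriv
  have key2 : deriv (fun s => (trivializationAt 𝔼 TM (α s₀ t₀)
      ⟨α s t₀, vel (fun t => α s t) t₀⟩).2) s₀ = fderiv ℝ (fderiv ℝ β) (s₀, t₀) (1, 0) (0, 1) := by
    have h3 : (fun s => (trivializationAt 𝔼 TM (α s₀ t₀) ⟨α s t₀, vel (fun t => α s t) t₀⟩).2)
        =ᶠ[𝓝 s₀] fun s => fderiv ℝ β (s, t₀) (0, 1) := by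
      filter_upwards [hc2.eventually hmem, hc2.eventually hd] with s hs1 hs2
      rw [trivializationAt_vel ((ht s t₀).mdifferentiableAt (by simp)) hs1]
      exact (hs2.hasFDerivAt.comp_hasDerivAt (f := fun t => (s, t)) t₀
        ((hasDerivAt_const t₀ s).prodMk (hasDerivAt_id t₀))).deriv
    rw [h3.deriv_eq]
    have h4 := h2.hasFDerivAt.comp_hasDerivAt (f := fun s => (s, t₀)) s₀
      ((hasDerivAt_id s₀).prodMk (hasDerivAt_const s₀ t₀))
    simpa using (h4.clm_apply (hasDerivAt_const s₀ ((0 : ℝ), (1 : ℝ)))).deriv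
  rw [key1, key2, hsymm (0, 1) (1, 0)]
  exact add_sub_add_left_eq_sub _ _ _

end Torsion

end DbarExpansion

namespace DbarExpansion

/-! ### The first order expansion of parallel transport -/

section FirstOrder

variable {m : ℕ} {M : Type*} [TopologicalSpace M] [ChartedSpace (EuclideanSpace ℝ (Fin m)) M]
  [IsManifold (𝓡 m) ∞ M]

local notation "𝔼" => EuclideanSpace ℝ (Fin m)

local notation "TM" => (TangentSpace (𝓡 m) : M → Type _)

variable {nabla : CovariantDerivative (𝓡 m) (EuclideanSpace ℝ (Fin m))
  (TangentSpace (𝓡 m) : M → Type _)}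
  {exp : TangentBundle (𝓡 m) M → M}
  {W : Type} [NormedAddCommGroup W] [NormedSpace ℝ W] [FiniteDimensional ℝ W] {U : Set M}

/-- All tangent spaces are `𝔼` by definition, so fields along two equal curves can be compared as
`𝔼`-valued functions, with no cast along the equality. -/
lemma covDeriv_congr_curve {γ γ' : ℝ → M} (h : γ = γ') {ζ : ∀ t, TangentSpace (𝓡 m) (γ t)}
    {ζ' : ∀ t, TangentSpace (𝓡 m) (γ' t)} (hζ : ∀ t, (ζ t : 𝔼) = ζ' t) (t : ℝ) :
    (covDeriv nabla γ ζ t : 𝔼) = covDeriv nabla γ' ζ' t := by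
  subst h
  obtain rfl : ζ = ζ' := funext hζ
  rfl

lemma AlongDiffAt.congr_curve {γ γ' : ℝ → M} (h : γ = γ') {ζ : ∀ t, TangentSpace (𝓡 m) (γ t)}
    {ζ' : ∀ t, TangentSpace (𝓡 m) (γ' t)} (hζ : ∀ t, (ζ t : 𝔼) = ζ' t) {t : ℝ}
    (hd : AlongDiffAt (F := ℝ) γ ζ t) : AlongDiffAt (F := ℝ) γ' ζ' t := by
  subst h
  obtain rfl : ζ = ζ' := funext hζ
  exact hd

omit [IsManifold (𝓡 m) ∞ M] in
lemma tangent_mk_eq {y y' : M} {a : TangentSpace (𝓡 m) y} {a' : TangentSpace (𝓡 m) y'}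
    (h : y = y') (ha : (a : 𝔼) = a') :
    (⟨y, a⟩ : TangentBundle (𝓡 m) M) = ⟨y', a'⟩ := by
  subst h
  obtain rfl : a = a' := ha
  rfl

lemma expCurve_zero (hexp : IsExponentialLike (𝓡 m) exp) (x : M) (v : TangentSpace (𝓡 m) x) :
    expCurve exp x v 0 = x := by
  rw [expCurve, zero_smul, hexp.zero]

lemma vel_expCurve_zero (hexp : IsExponentialLike (𝓡 m) exp) (x : M) (v : TangentSpace (𝓡 m) x) :
    (vel (expCurve exp x v) 0 : 𝔼) = v := by
  set v' : 𝔼 := v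
  have h1 : HasMFDerivAt 𝓘(ℝ, ℝ) 𝓘(ℝ, 𝔼) (fun t : ℝ => t • v') 0
      ((ContinuousLinearMap.id ℝ ℝ).smulRight v') :=
    ((hasFDerivAt_id (𝕜 := ℝ) (0 : ℝ)).smul_const v').hasMFDerivAt
  have hv : ∀ w₀ : 𝔼, w₀ = 0 → HasMFDerivAt 𝓘(ℝ, 𝔼) (𝓡 m)
      (fun w : 𝔼 => exp ⟨x, (w : TangentSpace (𝓡 m) x)⟩) w₀ (ContinuousLinearMap.id ℝ 𝔼) := by
    rintro _ rfl
    exact hexp.vertical x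
  have h2 := HasMFDerivAt.comp (0 : ℝ) (hv _ (zero_smul ℝ v')) h1
  have h3 : mfderiv 𝓘(ℝ, ℝ) (𝓡 m) (expCurve exp x v) 0 = _ := h2.mfderiv
  refine (DFunLike.congr_fun h3 (1 : ℝ)).trans ?_
  exact one_smul ℝ v'

lemma covDeriv_comp_section {γ : ℝ → M} {t : ℝ} {σ : ∀ x : M, TangentSpace (𝓡 m) x}
    (hγ : MDifferentiableAt 𝓘(ℝ, ℝ) (𝓡 m) γ t) (hσ : IsSmoothAlong (𝓡 m) (𝓡 m) (id : M → M) σ) :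
    covDeriv nabla γ (fun t => σ (γ t)) t = nabla σ (γ t) (vel γ t) := by
  have h := covAlong_smul_comp (nabla := nabla) (h := fun _ => (1 : ℝ)) hγ mdifferentiableAt_const
    (mdifferentiableAt_of_isSmoothAlong hσ (γ t))
  simp only [one_smul] at h
  rw [covDeriv, h]
  have h2 : mvfderiv 𝓘(ℝ, ℝ) (fun _ : ℝ => (1 : ℝ)) t = 0 := by
    simp [mvfderiv]
  rw [h2]
  simp
  rfl

/-- The Leibniz rule at `t = 0`, where the term containing the derivative of `ζ` carries the factor
`t = 0`. -/
lemma covDeriv_smul_self {γ : ℝ → M} {ζ : ∀ t, TangentSpace (𝓡 m) (γ t)}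
    (hζ : AlongDiffAt (F := ℝ) γ ζ 0) :
    AlongDiffAt (F := ℝ) γ (fun t => t • ζ t) 0 ∧
      covDeriv nabla γ (fun t => t • ζ t) 0 = ζ 0 := by
  have h := (mdifferentiableAt_totalSpace _ _).1 hζ
  have he : (fun t => (trivializationAt 𝔼 TM (γ 0) ⟨γ t, t • ζ t⟩).2) =ᶠ[𝓝 (0 : ℝ)]
      fun t => t • (trivializationAt 𝔼 TM (γ 0) ⟨γ t, ζ t⟩).2 := by
    filter_upwards [eventually_mem_baseSet (I := 𝓡 m) h.1.continuousAt] with t ht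
    exact ((trivializationAt 𝔼 TM (γ 0)).linear ℝ ht).map_smul t (ζ t)
  have hx : γ 0 ∈ (trivializationAt 𝔼 TM (γ 0)).baseSet := mem_baseSet_trivializationAt 𝔼 TM (γ 0)
  have hd : AlongDiffAt (F := ℝ) γ (fun t => t • ζ t) 0 :=
    (mdifferentiableAt_totalSpace _ _).2 ⟨h.1, (mdifferentiableAt_id.smul h.2).congr_of_eventuallyEq he⟩
  refine ⟨hd, ?_⟩
  rw [covDeriv_eq_coordField hd, he.deriv_eq, he.eq_of_nhds, zero_smul]
  have h1 := ((hasDerivAt_id (0 : ℝ)).smul h.2.differentiableAt.hasDerivAt).deriv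
  have h2 : nabla (coordField (γ 0) (0 : 𝔼)) (γ 0) = 0 := by
    rw [nabla_coordField]
    simp
  rw [h2]
  refine (add_zero _).trans ?_
  have h3 : deriv (fun t => t • (trivializationAt 𝔼 TM (γ 0) ⟨γ t, ζ t⟩).2) 0 =
      (trivializationAt 𝔼 TM (γ 0) ⟨γ 0, ζ 0⟩).2 := by
    refine Eq.trans h1 ?_
    simp
  rw [h3]
  have := (trivializationAt 𝔼 TM (γ 0)).symmL_continuousLinearMapAt (R := ℝ) hx (ζ 0)
  rwa [Trivialization.continuousLinearMapAt_apply,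
    Trivialization.coe_linearMapAt_of_mem _ hx] at this

/-- Since `γ_{τv}(t) = γ_v(tτ)`, one parallel field along `γ_v` contains the transports along all
`γ_{τv}`. This allows differentiation in `τ`. -/
lemma IsParallelTransport.rescale {x : M}
    {v w₀ : TangentSpace (𝓡 m) x}
    {ζ : ∀ t : ℝ, TangentSpace (𝓡 m) (expCurve exp x v t)}
    (hζ : IsSmoothAlong (𝓡 m) 𝓘(ℝ, ℝ) (expCurve exp x v) ζ)
    (hp : ∀ t ∈ Icc (0 : ℝ) 1, covAlong (F := ℝ) nabla (expCurve exp x v) ζ t = 0)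
    (h0 : (⟨expCurve exp x v 0, ζ 0⟩ : TangentBundle (𝓡 m) M) = ⟨x, w₀⟩)
    {τ : ℝ} (hτ : τ ∈ Icc (0 : ℝ) 1) :
    IsParallelTransport nabla exp x (τ • v) w₀ (ζ τ) := by
  have hγ : expCurve exp x (τ • v) = fun t => expCurve exp x v (t * τ) := by
    funext t
    simp [expCurve, smul_smul]
  unfold IsParallelTransport
  rw [hγ]
  have hτs : ContMDiff 𝓘(ℝ, ℝ) 𝓘(ℝ, ℝ) ∞ fun t : ℝ => t * τ :=
    (contDiff_id.mul contDiff_const).contMDiff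
  refine ⟨fun t => ζ (t * τ), fun t => ?_, fun t ht => ?_, ?_, ?_⟩
  · exact (hζ.at (t * τ)).comp_right (k := fun t : ℝ => t * τ) (hτs t)
  · rw [covAlong_comp (k := fun t : ℝ => t * τ) ((hζ.at (t * τ)).alongDiffAt (F := ℝ))
      ((hτs t).mdifferentiableAt (by simp)),
      hp _ ⟨mul_nonneg ht.1 hτ.1, mul_le_one₀ ht.2 hτ.1 hτ.2⟩]
    exact ContinuousLinearMap.zero_comp _
  · rw [← h0]
    have : ∀ a : ℝ, a = 0 → (⟨expCurve exp x v a, ζ a⟩ : TangentBundle (𝓡 m) M) =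
      ⟨expCurve exp x v 0, ζ 0⟩ := by
      rintro a rfl
      rfl
    exact this _ (zero_mul _)
  · have : ∀ a : ℝ, a = τ → (⟨expCurve exp x v a, ζ a⟩ : TangentBundle (𝓡 m) M) =
      ⟨expCurve exp x v τ, ζ τ⟩ := by
      rintro a rfl
      rfl
    exact this _ (one_mul _)

end FirstOrder

end DbarExpansion

namespace DbarExpansion

/-! ### The differential of `exp` in a frame -/

section FrameExp

variable {m : ℕ} {M : Type*} [TopologicalSpace M] [ChartedSpace (EuclideanSpace ℝ (Fin m)) M]
  [IsManifold (𝓡 m) ∞ M]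

local notation "𝔼" => EuclideanSpace ℝ (Fin m)

local notation "TM" => (TangentSpace (𝓡 m) : M → Type _)

variable {nabla : CovariantDerivative (𝓡 m) (EuclideanSpace ℝ (Fin m))
  (TangentSpace (𝓡 m) : M → Type _)}
  {exp : TangentBundle (𝓡 m) M → M}
  {W : Type} [NormedAddCommGroup W] [NormedSpace ℝ W] [FiniteDimensional ℝ W] {U : Set M}
  (Φ : TangentFrame (m := m) W U)

namespace TangentFrame

/-- The map `(x, c) ↦ exp(s_x c)`. -/
noncomputable def fexp (exp : TangentBundle (𝓡 m) M → M) (x : M) (c : W) : M := exp ⟨x, Φ.s x c⟩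

/-- The partial derivative of `exp(s_x c)` in the direction of `c`. -/
noncomputable def vert (exp : TangentBundle (𝓡 m) M → M) (x : M) (c : W) :
    W →L[ℝ] TangentSpace (𝓡 m) (Φ.fexp exp x c) :=
  mfderiv 𝓘(ℝ, W) (𝓡 m) (fun c => Φ.fexp exp x c) c

/-- The derivative of `exp` along the horizontal lift of a tangent vector to `s_x c`. -/
noncomputable def horiz (nabla : CovariantDerivative (𝓡 m) (EuclideanSpace ℝ (Fin m))
      (TangentSpace (𝓡 m) : M → Type _)) (exp : TangentBundle (𝓡 m) M → M) (x : M) (c : W) :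
    TangentSpace (𝓡 m) x →L[ℝ] TangentSpace (𝓡 m) (Φ.fexp exp x c) :=
  mfderiv (𝓡 m) (𝓡 m) (fun x => Φ.fexp exp x c) x -
    (Φ.vert exp x c).comp ((Φ.θ x).comp (nabla (fun y => Φ.s y c) x))

variable {Φ}

lemma contMDiff_fexp (hexp : ContMDiff (𝓡 m).tangent (𝓡 m) ∞ exp) :
    ContMDiff ((𝓡 m).prod 𝓘(ℝ, W)) (𝓡 m) ∞ (fun p : M × W => Φ.fexp exp p.1 p.2) := fun p =>
  hexp.contMDiffAt.comp p (Φ.isSmoothAlongAt (f := fun p : M × W => p.1)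
    (Z := fun p : M × W => p.2) contMDiffAt_fst contMDiffAt_snd)

lemma isSmoothHomAt_vert (hexp : ContMDiff (𝓡 m).tangent (𝓡 m) ∞ exp) (p : M × W) :
    IsSmoothHomAt 𝓘(ℝ, W) (𝓡 m) ((𝓡 m).prod 𝓘(ℝ, W)) (fun _ => (0 : W))
      (fun p : M × W => Φ.fexp exp p.1 p.2) (fun p => Φ.vert exp p.1 p.2) p := by
  have h := isSmoothHomAt_partial_mfderiv (I := 𝓘(ℝ, W)) (I' := 𝓡 m)
    (IN := (𝓡 m).prod 𝓘(ℝ, W)) (f := fun (p : M × W) c => Φ.fexp exp p.1 c) (g := fun p => p.2)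
    (z₀ := p) ((contMDiff_fexp hexp).contMDiffAt.comp (f := fun q : (M × W) × W => (q.1.1, q.2))
      (p, p.2) ((contMDiff_fst.comp contMDiff_fst).prodMk contMDiff_snd).contMDiffAt)
    contMDiffAt_snd
  refine isSmoothHomAt_of_apply fun c => ?_
  exact h.apply (ξ := fun _ => c) ((isSmoothAlongAt_model_iff contMDiffAt_snd).2 contMDiffAt_const)
    (contMDiff_fexp hexp p)

lemma isSmoothHomAt_horiz (hsmooth : nabla.ContMDiffCovariantDerivative ∞)
    (hexp : ContMDiff (𝓡 m).tangent (𝓡 m) ∞ exp) (p : M × W) :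
    IsSmoothHomAt (𝓡 m) (𝓡 m) ((𝓡 m).prod 𝓘(ℝ, W)) (fun p => p.1)
      (fun p : M × W => Φ.fexp exp p.1 p.2) (fun p => Φ.horiz nabla exp p.1 p.2) p := by
  have h1 := isSmoothHomAt_partial_mfderiv (I := 𝓡 m) (I' := 𝓡 m)
    (IN := (𝓡 m).prod 𝓘(ℝ, W)) (f := fun (p : M × W) x => Φ.fexp exp x p.2) (g := fun p => p.1)
    (z₀ := p) ((contMDiff_fexp hexp).contMDiffAt.comp (f := fun q : (M × W) × M => (q.2, q.1.2))
      (p, p.1) (contMDiff_snd.prodMk (contMDiff_snd.comp contMDiff_fst)).contMDiffAt)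
    contMDiffAt_fst
  let b := Module.finBasis ℝ W
  have h2 : IsSmoothHomAt (𝓡 m) (𝓡 m) ((𝓡 m).prod 𝓘(ℝ, W)) (fun p : M × W => p.1)
      (fun p : M × W => p.1) (fun p => nabla (fun y => Φ.s y p.2) p.1) p := by
    refine (IsSmoothHomAt.sum Finset.univ fun i _ => IsSmoothHomAt.smul (c := fun p => b.coord i p.2)
      ?_ (((isSmoothHom_nabla hsmooth (Φ.s_smooth (b i))).at p.1).comp_right
        (k := fun p : M × W => p.1) contMDiffAt_fst)).congr (Filter.Eventually.of_forall fun p => ?_)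
    · exact (ContinuousLinearMap.contMDiff (LinearMap.toContinuousLinearMap (b.coord i))).contMDiffAt.comp
        p contMDiffAt_snd
    · conv_lhs => rw [← b.sum_repr p.2]
      rw [Φ.nabla_sum_smul]
      rfl
  have h3 := (Φ.θ_smooth.at p.1).comp_right (k := fun p : M × W => p.1) (z₀ := p)
    (IN' := (𝓡 m).prod 𝓘(ℝ, W)) contMDiffAt_fst
  exact h1.sub ((isSmoothHomAt_vert hexp p).comp (h3.comp h2 continuousAt_fst)
    continuousAt_const)

/-- Changing the coefficients of `s_x c` within the kernel of `s_x` does not change `exp`. -/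
lemma vert_θ_s (hexp : ContMDiff (𝓡 m).tangent (𝓡 m) ∞ exp) {x : M} (hx : x ∈ U) (c c' : W) :
    Φ.vert exp x c (Φ.θ x (Φ.s x c')) = Φ.vert exp x c c' := by
  have key : ∀ b : W, HasMFDerivAt 𝓘(ℝ, ℝ) (𝓡 m) (fun t : ℝ => Φ.fexp exp x (c + t • b)) 0
      (((Φ.vert exp x c).comp ((ContinuousLinearMap.id ℝ ℝ).smulRight b)) : ℝ →L[ℝ] 𝔼) := by
    intro b
    have h1 : HasMFDerivAt 𝓘(ℝ, ℝ) 𝓘(ℝ, W) (fun t : ℝ => c + t • b) 0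
        ((ContinuousLinearMap.id ℝ ℝ).smulRight b) :=
      (((hasFDerivAt_id (𝕜 := ℝ) (0 : ℝ)).smul_const b).const_add c).hasMFDerivAt
    have h3 : ContMDiffAt 𝓘(ℝ, W) (𝓡 m) ∞ (fun c => Φ.fexp exp x c) c :=
      (contMDiff_fexp hexp).contMDiffAt.comp (f := fun c => (x, c)) c
        (contMDiffAt_const.prodMk contMDiffAt_id)
    have h2 : ∀ c₀ : W, c₀ = c → HasMFDerivAt 𝓘(ℝ, W) (𝓡 m) (fun c => Φ.fexp exp x c) c₀
        (Φ.vert exp x c : W →L[ℝ] 𝔼) := by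
      rintro _ rfl
      exact (h3.mdifferentiableAt (by simp)).hasMFDerivAt
    have h4 := HasMFDerivAt.comp (g := fun c => Φ.fexp exp x c) (f := fun t : ℝ => c + t • b)
      (0 : ℝ) (h2 (c + (0 : ℝ) • b) (by simp)) h1
    exact h4
  have h1 := key (Φ.θ x (Φ.s x c'))
  have h2 := key c'
  have h3 : (fun t : ℝ => Φ.fexp exp x (c + t • Φ.θ x (Φ.s x c'))) =
      fun t : ℝ => Φ.fexp exp x (c + t • c') := by
    funext t
    simp [fexp, Φ.s_θ x hx]
  rw [h3] at h1
  have h4 := DFunLike.congr_fun (hasMFDerivAt_unique h1 h2) (1 : ℝ)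
  have h5 : ∀ b : W, ((Φ.vert exp x c).comp ((ContinuousLinearMap.id ℝ ℝ).smulRight b)) (1 : ℝ) =
      Φ.vert exp x c b := fun b => congrArg (Φ.vert exp x c) (one_smul ℝ b)
  exact (h5 _).symm.trans (h4.trans (h5 _))

/-- The chain rule for `(x, c) ↦ exp(s_x c)`, with `s dZ` expressed through `∇ξ` by
`TangentFrame.covAlong_eq`. Passing from `dZ` to `θ s dZ` costs nothing by `vert_θ_s`. -/
lemma mfderiv_exp_comp (hexp : ContMDiff (𝓡 m).tangent (𝓡 m) ∞ exp)
    {F : Type*} [NormedAddCommGroup F] [NormedSpace ℝ F]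
    {N : Type*} [TopologicalSpace N] [ChartedSpace F N]
    {f : N → M} {Z : N → W} {z : N} (hf : MDifferentiableAt 𝓘(ℝ, F) (𝓡 m) f z)
    (hZ : MDifferentiableAt 𝓘(ℝ, F) 𝓘(ℝ, W) Z z) (hz : f z ∈ U) (v : TangentSpace 𝓘(ℝ, F) z) :
    mfderiv 𝓘(ℝ, F) (𝓡 m) (fun z => Φ.fexp exp (f z) (Z z)) z v =
      Φ.horiz nabla exp (f z) (Z z) (mfderiv 𝓘(ℝ, F) (𝓡 m) f z v) +
        Φ.vert exp (f z) (Z z)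
          (Φ.θ (f z) (covAlong nabla f (fun z => Φ.s (f z) (Z z)) z v)) := by
  have hG : MDifferentiableAt ((𝓡 m).prod 𝓘(ℝ, W)) (𝓡 m) (fun p : M × W => Φ.fexp exp p.1 p.2)
      (f z, Z z) := (contMDiff_fexp hexp).contMDiffAt.mdifferentiableAt (by simp)
  have h1 := mfderiv_comp (I := 𝓘(ℝ, F)) (I' := (𝓡 m).prod 𝓘(ℝ, W)) (I'' := 𝓡 m) z
    (f := fun z => (f z, Z z)) hG (hf.prodMk hZ)
  have h2 := DFunLike.congr_fun h1 v
  refine h2.trans ?_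
  rw [ContinuousLinearMap.comp_apply, mfderiv_prodMk hf hZ, mfderiv_prod_eq_add_apply hG]
  have h3 := vert_θ_s (Φ := Φ) hexp hz (Z z) (mvfderiv 𝓘(ℝ, F) Z z v)
  rw [Φ.covAlong_eq hf hZ, horiz, add_apply, map_add, map_add, sub_apply]
  have h4 : Φ.vert exp (f z) (Z z) (Φ.θ (f z) (((Φ.s (f z)).comp (mvfderiv 𝓘(ℝ, F) Z z)) v)) =
      Φ.vert exp (f z) (Z z) (mvfderiv 𝓘(ℝ, F) Z z v) := h3
  rw [h4]
  refine (sub_add_add_cancel _ _ _).symm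

end TangentFrame

end FrameExp

end DbarExpansion

namespace DbarExpansion

/-! ### The pulled back differential of `exp` in a frame, to first order -/

section FrameFirstOrder

variable {m : ℕ} {M : Type*} [TopologicalSpace M] [ChartedSpace (EuclideanSpace ℝ (Fin m)) M]
  [IsManifold (𝓡 m) ∞ M]

local notation "𝔼" => EuclideanSpace ℝ (Fin m)

local notation "TM" => (TangentSpace (𝓡 m) : M → Type _)

variable {nabla : CovariantDerivative (𝓡 m) (EuclideanSpace ℝ (Fin m))
  (TangentSpace (𝓡 m) : M → Type _)}
  {exp : TangentBundle (𝓡 m) M → M}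
  {W : Type} [NormedAddCommGroup W] [NormedSpace ℝ W] [FiniteDimensional ℝ W] {U : Set M}
  {Φ : TangentFrame (m := m) W U}

lemma IsParallelTransport.congr {x : M} {v v' w₀ : TangentSpace (𝓡 m) x}
    {w₁ : TangentSpace (𝓡 m) (exp ⟨x, v⟩)} {w₁' : TangentSpace (𝓡 m) (exp ⟨x, v'⟩)}
    (h : IsParallelTransport nabla exp x v w₀ w₁) (hv : v = v') (hw : (w₁ : 𝔼) = w₁') :
    IsParallelTransport nabla exp x v' w₀ w₁' := by
  subst hv
  obtain rfl : w₁ = w₁' := hw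
  exact h

lemma covAlong_const (x : M) (w : TangentSpace (𝓡 m) x) (t : ℝ) :
    covAlong (F := ℝ) nabla (fun _ : ℝ => x) (fun _ => w) t = 0 := by
  simp [covAlong, mvfderiv, mfderiv_const]

lemma isParallelTransport_zero (hexp : IsExponentialLike (𝓡 m) exp) {x : M}
    {v w : TangentSpace (𝓡 m) x} {w₁ : TangentSpace (𝓡 m) (exp ⟨x, v⟩)} (hv : v = 0)
    (hw : (w₁ : 𝔼) = w) : IsParallelTransport nabla exp x v w w₁ := by
  subst hv
  have hγ : expCurve exp x (0 : TangentSpace (𝓡 m) x) = fun _ => x := by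
    funext t
    simp [expCurve, hexp.zero]
  unfold IsParallelTransport
  rw [hγ]
  exact ⟨fun _ => w, contMDiff_const, fun t _ => covAlong_const x w t, rfl,
    tangent_mk_eq (hexp.zero x).symm hw.symm⟩

/-- The transport map in a frame: `Ψ (x, c)` is the matrix of the parallel transport from
`exp(s_x c)` back to `x`. -/
structure IsFrameTransport (nabla : CovariantDerivative (𝓡 m) (EuclideanSpace ℝ (Fin m))
      (TangentSpace (𝓡 m) : M → Type _)) (exp : TangentBundle (𝓡 m) M → M)
    (Φ : TangentFrame (m := m) W U) (Ψ : M × W → W →L[ℝ] W) : Prop where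
  smooth : ContMDiff ((𝓡 m).prod 𝓘(ℝ, W)) 𝓘(ℝ, W →L[ℝ] W) ∞ Ψ
  spec : ∀ (x : M) (c : W), (∀ t ∈ Icc (0 : ℝ) 1, expCurve exp x (Φ.s x c) t ∈ U) →
    ∀ X : TangentSpace (𝓡 m) (exp ⟨x, Φ.s x c⟩),
      IsParallelTransport nabla exp x (Φ.s x c) (Φ.s x (Ψ (x, c) (Φ.θ _ X))) X

namespace TangentFrame

variable (Φ) in
/-- The matrix of the horizontal part of the pulled back differential of `exp`. -/
noncomputable def matH (nabla : CovariantDerivative (𝓡 m) (EuclideanSpace ℝ (Fin m))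
      (TangentSpace (𝓡 m) : M → Type _)) (exp : TangentBundle (𝓡 m) M → M)
    (Ψ : M × W → W →L[ℝ] W) (x : M) (c : W) : W →L[ℝ] W :=
  (Ψ (x, c)).comp ((Φ.θ (Φ.fexp exp x c)).comp ((Φ.horiz nabla exp x c).comp (Φ.s x)))

variable (Φ) in
/-- The matrix of the vertical part of the pulled back differential of `exp`. -/
noncomputable def matV (exp : TangentBundle (𝓡 m) M → M)
    (Ψ : M × W → W →L[ℝ] W) (x : M) (c : W) : W →L[ℝ] W :=
  (Ψ (x, c)).comp ((Φ.θ (Φ.fexp exp x c)).comp (Φ.vert exp x c))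

lemma contMDiff_matV (hexp : ContMDiff (𝓡 m).tangent (𝓡 m) ∞ exp) {Ψ : M × W → W →L[ℝ] W}
    (hΨ : ContMDiff ((𝓡 m).prod 𝓘(ℝ, W)) 𝓘(ℝ, W →L[ℝ] W) ∞ Ψ) :
    ContMDiff ((𝓡 m).prod 𝓘(ℝ, W)) 𝓘(ℝ, W →L[ℝ] W) ∞
      (fun p : M × W => Φ.matV exp Ψ p.1 p.2) := by
  intro p
  have hf := contMDiff_fexp (Φ := Φ) hexp p
  have h1 := ((Φ.θ_smooth.at _).comp_right (z₀ := p) hf).comp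
    (isSmoothHomAt_vert (Φ := Φ) hexp p) hf.continuousAt
  have h2 : ContMDiffAt ((𝓡 m).prod 𝓘(ℝ, W)) 𝓘(ℝ, W →L[ℝ] W) ∞
    (fun p : M × W => (Φ.θ (Φ.fexp exp p.1 p.2)).comp (Φ.vert exp p.1 p.2)) p :=
      isSmoothHomAt_model_iff.1 h1
  exact (hΨ p).clm_comp h2

lemma contMDiff_matH (hsmooth : nabla.ContMDiffCovariantDerivative ∞)
    (hexp : ContMDiff (𝓡 m).tangent (𝓡 m) ∞ exp) {Ψ : M × W → W →L[ℝ] W}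
    (hΨ : ContMDiff ((𝓡 m).prod 𝓘(ℝ, W)) 𝓘(ℝ, W →L[ℝ] W) ∞ Ψ) :
    ContMDiff ((𝓡 m).prod 𝓘(ℝ, W)) 𝓘(ℝ, W →L[ℝ] W) ∞
      (fun p : M × W => Φ.matH nabla exp Ψ p.1 p.2) := by
  intro p
  have hf := contMDiff_fexp (Φ := Φ) hexp p
  have hs : IsSmoothHomAt 𝓘(ℝ, W) (𝓡 m) ((𝓡 m).prod 𝓘(ℝ, W)) (fun _ => (0 : W))
      (fun p : M × W => p.1) (fun p => Φ.s p.1) p :=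
    isSmoothHomAt_of_apply fun c => ((Φ.s_smooth c).at p.1).comp_right contMDiffAt_fst
  have h1 := ((Φ.θ_smooth.at _).comp_right (z₀ := p) hf).comp
    ((isSmoothHomAt_horiz (Φ := Φ) hsmooth hexp p).comp hs continuousAt_fst)
      hf.continuousAt
  have h2 : ContMDiffAt ((𝓡 m).prod 𝓘(ℝ, W)) 𝓘(ℝ, W →L[ℝ] W) ∞
    (fun p : M × W => (Φ.θ (Φ.fexp exp p.1 p.2)).comp
      ((Φ.horiz nabla exp p.1 p.2).comp (Φ.s p.1))) p :=
      isSmoothHomAt_model_iff.1 h1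
  exact (hΨ p).clm_comp h2

omit [FiniteDimensional ℝ W] in
lemma vert_zero (hexp : IsExponentialLike (𝓡 m) exp) (x : M) (c : W) :
    (Φ.vert exp x 0 c : 𝔼) = Φ.s x c := by
  let L : W →L[ℝ] 𝔼 := Φ.s x
  have h1 : HasMFDerivAt 𝓘(ℝ, W) 𝓘(ℝ, 𝔼) L 0 L := L.hasFDerivAt.hasMFDerivAt
  have hv : ∀ w₀ : 𝔼, w₀ = 0 → HasMFDerivAt 𝓘(ℝ, 𝔼) (𝓡 m)
      (fun w : 𝔼 => exp ⟨x, (w : TangentSpace (𝓡 m) x)⟩) w₀ (ContinuousLinearMap.id ℝ 𝔼) := by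
    rintro _ rfl
    exact hexp.vertical x
  have h2 := HasMFDerivAt.comp (g := fun w : 𝔼 => exp ⟨x, (w : TangentSpace (𝓡 m) x)⟩)
    (f := L) (0 : W) (hv _ (map_zero L)) h1
  have h3 : mfderiv 𝓘(ℝ, W) (𝓡 m) (fun c => Φ.fexp exp x c) 0 = _ := h2.mfderiv
  exact DFunLike.congr_fun h3 c

-- On the zero section `exp` is the identity, and the correction term disappears because `s 0` is
-- the zero field.
omit [FiniteDimensional ℝ W] in
lemma horiz_zero (hexp : IsExponentialLike (𝓡 m) exp) (x : M) (w : TangentSpace (𝓡 m) x) :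
    (Φ.horiz nabla exp x 0 w : 𝔼) = w := by
  have h1 : nabla (fun y => Φ.s y (0 : W)) x = 0 := by
    have := Φ.nabla_sum_smul (nabla := nabla) (∅ : Finset ℕ) (fun _ => (0 : ℝ)) (fun _ => (0 : W)) x
    simpa using this
  have h2 : (fun y => Φ.fexp exp y (0 : W)) = id := by
    funext y
    simp [fexp, hexp.zero]
  have h3 : (mfderiv (𝓡 m) (𝓡 m) (fun y => Φ.fexp exp y (0 : W)) x w : 𝔼) = w := by
    rw [h2, mfderiv_id]
    rfl
  rw [horiz, sub_apply, ContinuousLinearMap.comp_apply, ContinuousLinearMap.comp_apply, h1]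
  have h5 : Φ.vert exp x (0 : W) (Φ.θ x ((0 : TangentSpace (𝓡 m) x →L[ℝ] TangentSpace (𝓡 m) x) w))
      = 0 := by simp
  rw [h5, sub_zero]
  exact h3

omit [FiniteDimensional ℝ W] in
lemma expCurve_zero_mem (hexp : IsExponentialLike (𝓡 m) exp) {x : M} (hx : x ∈ U) (t : ℝ) :
    expCurve exp x (Φ.s x (0 : W)) t ∈ U := by
  simpa [expCurve, hexp.zero] using hx

section Metric

variable [T2Space M] [RiemannianBundle (fun x : M => TangentSpace (𝓡 m) x)]
  [IsContMDiffRiemannianBundle (𝓡 m) ∞ (EuclideanSpace ℝ (Fin m))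
    (fun x : M => TangentSpace (𝓡 m) x)]

-- For `c = 0` the curve is constant, so its transport is the identity, and `vert` is `s` by the
-- vertical condition on `exp`.
omit [FiniteDimensional ℝ W] in
lemma s_matV_zero (hexp : IsExponentialLike (𝓡 m) exp) (hmetric : nabla.IsMetricCompatible)
    {Ψ : M × W → W →L[ℝ] W} (hΨ : IsFrameTransport nabla exp Φ Ψ) {x : M} (hx : x ∈ U)
    (w : TangentSpace (𝓡 m) x) : Φ.s x (Φ.matV exp Ψ x 0 (Φ.θ x w)) = w := by
  have h1 := hΨ.spec x 0 (fun t _ => expCurve_zero_mem hexp hx t) (Φ.vert exp x 0 (Φ.θ x w))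
  refine h1.unique hmetric (isParallelTransport_zero hexp (map_zero _) ?_)
  exact (vert_zero hexp x _).trans (Φ.s_θ x hx w)

omit [FiniteDimensional ℝ W] in
lemma s_matH_zero (hexp : IsExponentialLike (𝓡 m) exp) (hmetric : nabla.IsMetricCompatible)
    {Ψ : M × W → W →L[ℝ] W} (hΨ : IsFrameTransport nabla exp Φ Ψ) {x : M} (hx : x ∈ U)
    (w : TangentSpace (𝓡 m) x) : Φ.s x (Φ.matH nabla exp Ψ x 0 (Φ.θ x w)) = w := by
  have h1 := hΨ.spec x 0 (fun t _ => expCurve_zero_mem hexp hx t)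
    (Φ.horiz nabla exp x 0 (Φ.s x (Φ.θ x w)))
  refine h1.unique hmetric (isParallelTransport_zero hexp (map_zero _) ?_)
  exact (horiz_zero hexp x _).trans (Φ.s_θ x hx w)

end Metric

end TangentFrame

end FrameFirstOrder

end DbarExpansion

namespace DbarExpansion

/-! ### The torsion as a first order term -/

section TorsionTerm

variable {m : ℕ} {M : Type*} [TopologicalSpace M] [ChartedSpace (EuclideanSpace ℝ (Fin m)) M]
  [IsManifold (𝓡 m) ∞ M]

local notation "𝔼" => EuclideanSpace ℝ (Fin m)

local notation "TM" => (TangentSpace (𝓡 m) : M → Type _)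

variable {nabla : CovariantDerivative (𝓡 m) (EuclideanSpace ℝ (Fin m))
  (TangentSpace (𝓡 m) : M → Type _)}
  {exp : TangentBundle (𝓡 m) M → M}
  {W : Type} [NormedAddCommGroup W] [NormedSpace ℝ W] [FiniteDimensional ℝ W] {U : Set M}
  {Φ : TangentFrame (m := m) W U}

variable [T2Space M] [RiemannianBundle (fun x : M => TangentSpace (𝓡 m) x)]
  [IsContMDiffRiemannianBundle (𝓡 m) ∞ (EuclideanSpace ℝ (Fin m))
    (fun x : M => TangentSpace (𝓡 m) x)]

namespace TangentFrame

omit [T2Space M] [RiemannianBundle (fun x : M => TangentSpace (𝓡 m) x)]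
  [IsContMDiffRiemannianBundle (𝓡 m) ∞ (EuclideanSpace ℝ (Fin m))
    (fun x : M => TangentSpace (𝓡 m) x)] in
/-- The covariant derivative at `t = 0` of the horizontal variation of `t ↦ exp(t s c)` along a
curve `β` is the torsion. -/
lemma covDeriv_horizontal_variation (hexp : IsExponentialLike (𝓡 m) exp) {β : ℝ → M}
    (hβ : ContMDiff 𝓘(ℝ, ℝ) (𝓡 m) ∞ β) (hU : β 0 ∈ U) (c : W) :
    ∃ ζ : ∀ t, TangentSpace (𝓡 m) (expCurve exp (β 0) (Φ.s (β 0) c) t),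
      (∀ t, (ζ t : 𝔼) = Φ.horiz nabla exp (β 0) (t • c) (vel β 0)) ∧
      AlongDiffAt (F := ℝ) _ ζ 0 ∧
      (covDeriv nabla _ ζ 0 : 𝔼) = nabla.torsion (β 0) (Φ.s (β 0) c) (vel β 0) := by
  set α : ℝ → ℝ → M := fun s t => expCurve exp (β s) (Φ.s (β s) c) t with hα_def
  have hα : ContMDiff (𝓘(ℝ, ℝ).prod 𝓘(ℝ, ℝ)) (𝓡 m) ∞ (Function.uncurry α) := fun p =>
    Φ.contMDiff_expCurve hexp.smooth (hβ.comp contMDiff_fst p) contMDiffAt_const contMDiffAt_snd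
  have ht : ∀ s t, ContMDiffAt 𝓘(ℝ, ℝ) (𝓡 m) ∞ (fun t => α s t) t := fun s t =>
    hα.contMDiffAt.comp (f := fun t => (s, t)) t
      (contMDiffAt_const.prodMk contMDiffAt_id)
  have hds : AlongDiffAt (F := ℝ) (fun t => α 0 t)
      (fun t => vel (m := m) (fun s => α s t) 0) 0 := by
    have h1 := isSmoothHomAt_partial_mfderiv (I := 𝓘(ℝ, ℝ)) (I' := 𝓡 m) (IN := 𝓘(ℝ, ℝ))
      (f := fun t s => α s t) (g := fun _ => (0 : ℝ)) (z₀ := (0 : ℝ))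
      (hα.contMDiffAt.comp (f := fun p : ℝ × ℝ => (p.2, p.1)) ((0 : ℝ), (0 : ℝ))
        (contMDiffAt_snd.prodMk contMDiffAt_fst)) contMDiffAt_const
    exact (h1.apply (ξ := fun _ => (1 : ℝ)) ((isSmoothAlongAt_model_iff contMDiffAt_const).2
      contMDiffAt_const) (ht 0 0)).alongDiffAt
  set x := β 0
  -- Along `β` the coefficients `t c` are kept constant, so the vector `t s c` is not moved
  -- horizontally. Hence `∂_s α` exceeds the horizontal variation by `t vert(b)`, and the field `V =
  -- vert(-b)` compensates for this.
  set b : W := Φ.conn nabla x (vel β 0) c with hb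
  have hcurve : (fun t : ℝ => Φ.fexp exp x (t • c)) = fun t => α 0 t := by
    funext t
    simp [fexp, hα_def, expCurve, x]
  let V : ∀ t : ℝ, TangentSpace (𝓡 m) (α 0 t) := fun t => (Φ.vert exp x (t • c) (-b) : 𝔼)
  have hV : AlongDiffAt (F := ℝ) (fun t => α 0 t) V 0 := by
    have hk : ContMDiff 𝓘(ℝ, ℝ) ((𝓡 m).prod 𝓘(ℝ, W)) ∞ (fun t : ℝ => (x, t • c)) :=
      contMDiff_const.prodMk (contDiff_id.smul contDiff_const).contMDiff
    have h1 := (isSmoothHomAt_vert (Φ := Φ) hexp.smooth (x, (0 : ℝ) • c)).comp_right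
      (k := fun t : ℝ => (x, t • c)) (z₀ := (0 : ℝ)) (hk 0)
    have h2 := h1.apply (ξ := fun _ => -b) ((isSmoothAlongAt_model_iff contMDiffAt_const).2
      contMDiffAt_const) ((contMDiff_fexp hexp.smooth).contMDiffAt.comp (0 : ℝ) (hk 0))
    exact (h2.alongDiffAt (F := ℝ)).congr_curve hcurve fun t => rfl
  obtain ⟨hV1, hV2⟩ := covDeriv_smul_self (nabla := nabla) hV
  refine ⟨fun t => vel (m := m) (fun s => α s t) 0 + t • V t, fun t => ?_, hds.add hV1, ?_⟩
  · have h1 : (vel (m := m) (fun s => α s t) 0 : 𝔼) =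
        vel (m := m) (fun s => Φ.fexp exp (β s) (t • c)) 0 := by
      have : (fun s => α s t) = fun s => Φ.fexp exp (β s) (t • c) := by
        funext s
        simp [fexp, hα_def, expCurve]
      rw [this]
    have h2 : vel (m := m) (fun s => Φ.fexp exp (β s) (t • c)) 0 =
        Φ.horiz nabla exp (β 0) (t • c) (vel β 0) + Φ.vert exp (β 0) (t • c)
          (Φ.θ (β 0) (covDeriv nabla β (fun s => Φ.s (β s) (t • c)) 0)) :=
      mfderiv_exp_comp (Φ := Φ) (nabla := nabla) (Z := fun _ : ℝ => t • c) hexp.smooth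
        ((hβ 0).mdifferentiableAt (by simp)) mdifferentiableAt_const hU (1 : ℝ)
    rw [covDeriv_comp_section (σ := fun y => Φ.s y (t • c)) ((hβ 0).mdifferentiableAt (by simp))
      (Φ.s_smooth _), ← Φ.conn_apply, map_smul] at h2
    have h3 : t • Φ.vert exp x (t • c) (-b) = -Φ.vert exp (β 0) (t • c) (t • b) := by
      rw [map_neg, smul_neg, map_smul]
    refine (congrArg₂ (fun a b : 𝔼 => a + b) (h1.trans h2) h3).trans ?_
    exact add_neg_cancel_right (G := 𝔼) _ _
  -- At `t = 0` one has `D_t ∂_s α = D_s ∂_t α + T = ∇_{β'}(s c) + T`, whereas `D_t (t V) = V(0) =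
  -- -∇_{β'}(s c)`. Only the torsion is left.
  · have h1 := covAlong_add (nabla := nabla) hds hV1
    have h2 := covDeriv_vel_sub (nabla := nabla) hα 0 0
    have h3 : (covDeriv nabla (fun s => α s 0) (fun s => vel (m := m) (fun t => α s t) 0) 0 : 𝔼) =
        covDeriv nabla β (fun s => Φ.s (β s) c) 0 :=
      covDeriv_congr_curve (funext fun s => expCurve_zero hexp _ _)
        (fun s => vel_expCurve_zero hexp _ _) 0
    rw [covDeriv_comp_section (σ := fun y => Φ.s y c) ((hβ 0).mdifferentiableAt (by simp))
      (Φ.s_smooth _)] at h3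
    have h4 : (V 0 : 𝔼) = -nabla (fun y => Φ.s y c) x (vel β 0) := by
      have h5 : (V 0 : 𝔼) = Φ.vert exp x 0 (-b) := by
        have h6 : ∀ c' : W, c' = 0 → (Φ.vert exp x c' (-b) : 𝔼) = Φ.vert exp x 0 (-b) := by
          rintro _ rfl
          rfl
        exact h6 _ (zero_smul ℝ c)
      refine h5.trans ((vert_zero hexp x _).trans ?_)
      rw [map_neg, hb, Φ.conn_apply, Φ.s_θ x hU]
    have h5 : ∀ (y y' : M) (a a' : TangentSpace (𝓡 m) y) (e e' : TangentSpace (𝓡 m) y'), y = y' →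
        (a : 𝔼) = e → (a' : 𝔼) = e' →
        (nabla.torsion y a a' : 𝔼) = nabla.torsion y' e e' := by
      rintro y _ a a' e e' rfl h h'
      obtain rfl : a = e := h
      obtain rfl : a' = e' := h'
      rfl
    have h6 : (vel (m := m) (fun s => α s 0) 0 : 𝔼) = vel β 0 := by
      have : (fun s => α s 0) = β := funext fun s => expCurve_zero hexp _ _
      rw [this]
    have h7 := h5 (α 0 0) x _ _ (Φ.s x c) (vel β 0) (expCurve_zero hexp _ _)
      (vel_expCurve_zero hexp x (Φ.s x c)) h6
    have key : ∀ A B T V N T' : 𝔼, A - B = T → B = N → V = -N → T = T' → A + V = T' := by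
      rintro A _ _ _ N T' rfl rfl rfl h
      rw [← sub_eq_add_neg, h]
    refine Eq.trans (DFunLike.congr_fun h1 (1 : ℝ)) ?_
    let A : 𝔼 := covDeriv nabla (fun t => α 0 t) (fun t => vel (m := m) (fun s => α s t) 0) 0
    refine Eq.trans (congrArg (fun a : 𝔼 => A + a) hV2) ?_
    exact key _ _ _ _ _ _ h2 h3 h4 h7

-- Any curve through `x` with velocity `w` serves as `β`; `t ↦ exp(tw)` is one, globally defined and
-- smooth.
omit [T2Space M] [RiemannianBundle (fun x : M => TangentSpace (𝓡 m) x)]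
  [IsContMDiffRiemannianBundle (𝓡 m) ∞ (EuclideanSpace ℝ (Fin m))
    (fun x : M => TangentSpace (𝓡 m) x)] in
lemma exists_horizontal_variation (hexp : IsExponentialLike (𝓡 m) exp) {x : M} (hU : x ∈ U) (c : W)
    (w : TangentSpace (𝓡 m) x) :
    ∃ ζ : ∀ t, TangentSpace (𝓡 m) (expCurve exp x (Φ.s x c) t),
      (∀ t, (ζ t : 𝔼) = Φ.horiz nabla exp x (t • c) w) ∧
      AlongDiffAt (F := ℝ) _ ζ 0 ∧
      (covDeriv nabla _ ζ 0 : 𝔼) = nabla.torsion x (Φ.s x c) w := by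
  obtain ⟨β, hβ, h0, hv⟩ : ∃ β : ℝ → M, ContMDiff 𝓘(ℝ, ℝ) (𝓡 m) ∞ β ∧ β 0 = x ∧
      (vel (m := m) β 0 : 𝔼) = w :=
    ⟨expCurve exp x w, DbarExpansion.contMDiff_expCurve hexp.smooth x w, expCurve_zero hexp x w,
      vel_expCurve_zero hexp x w⟩
  subst h0
  obtain rfl : vel β 0 = w := hv
  exact covDeriv_horizontal_variation hexp hβ hU c

variable {Ψ : M × W → W →L[ℝ] W}

omit [FiniteDimensional ℝ W] in
lemma hasDerivAt_smul_of_contMDiff {V : Type*} [NormedAddCommGroup V] [NormedSpace ℝ V]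
    {h : W → V} (hh : ContDiff ℝ ∞ h) (c : W) :
    HasDerivAt (fun t : ℝ => h (t • c)) (fderiv ℝ h 0 c) 0 := by
  have h1 : HasFDerivAt h (fderiv ℝ h 0) ((0 : ℝ) • c) := by
    rw [zero_smul]
    exact ((hh.contDiffAt (x := 0)).differentiableAt (by simp)).hasFDerivAt
  have h2 : HasDerivAt (fun t : ℝ => t • c) c 0 := by
    simpa using (hasDerivAt_id (0 : ℝ)).smul_const c
  exact h1.comp_hasDerivAt (0 : ℝ) h2

/-- The differential of `matH` at zero is the negative of the torsion. -/
lemma s_fderiv_matH (hsmooth : nabla.ContMDiffCovariantDerivative ∞)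
    (hexp : IsExponentialLike (𝓡 m) exp) (hmetric : nabla.IsMetricCompatible)
    (hΨ : IsFrameTransport nabla exp Φ Ψ) {x : M} (hx : x ∈ U) {c : W}
    (hU : ∀ t ∈ Icc (0 : ℝ) 1, expCurve exp x (Φ.s x c) t ∈ U) (w : TangentSpace (𝓡 m) x) :
    Φ.s x (fderiv ℝ (Φ.matH nabla exp Ψ x) 0 c (Φ.θ x w)) =
      nabla.torsion x (Φ.s x c) w := by
  obtain ⟨ζ, hζ1, hζ2, hζ3⟩ := exists_horizontal_variation (nabla := nabla) hexp hx c w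
  -- Pair with `e` and extend `e` to a parallel field `η` along the curve. By isometry the pairing
  -- at time `t` is `⟨ζ(t), η(t)⟩`, with derivative `⟨D_t ζ, e⟩` at zero, so transport itself is
  -- never differentiated.
  refine ext_inner_right ℝ fun e => ?_
  obtain ⟨η, hη, hp, h0, -⟩ := parallelTransport_spec hsmooth hexp hmetric x (Φ.s x c) e
  have hs : ContDiff ℝ ∞ (Φ.matH nabla exp Ψ x) := by
    rw [← contMDiff_iff_contDiff]
    exact (contMDiff_matH hsmooth hexp.smooth hΨ.smooth).comp (contMDiff_const.prodMk contMDiff_id)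
  let ℓ : W →L[ℝ] ℝ := (innerSL ℝ e).comp (Φ.s x)
  have hd1 : HasDerivAt (fun t : ℝ => inner ℝ (Φ.s x (Φ.matH nabla exp Ψ x (t • c) (Φ.θ x w))) e)
      (inner ℝ (Φ.s x (fderiv ℝ (Φ.matH nabla exp Ψ x) 0 c (Φ.θ x w))) e) 0 := by
    have h1 := (hasDerivAt_smul_of_contMDiff hs c).clm_apply (hasDerivAt_const 0 (Φ.θ x w))
    have h2 := ℓ.hasFDerivAt.comp_hasDerivAt (0 : ℝ) h1
    simpa [ℓ, real_inner_comm, Function.comp_def] using h2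
  have hd2 := hasDerivAt_inner_along hmetric hζ2 ((hη.at 0).alongDiffAt (F := ℝ))
  have heq : ∀ t ∈ Icc (0 : ℝ) 1, inner ℝ (Φ.s x (Φ.matH nabla exp Ψ x (t • c) (Φ.θ x w))) e =
      inner ℝ (ζ t) (η t) := by
    intro t ht
    have h1 := IsParallelTransport.rescale hη hp h0 ht
    have h2 := hΨ.spec x (t • c) (fun τ hτ => by
      have := hU (τ * t) ⟨mul_nonneg hτ.1 ht.1, mul_le_one₀ hτ.2 ht.1 ht.2⟩
      simpa [expCurve, smul_smul] using this)
      (Φ.horiz nabla exp x (t • c) (Φ.s x (Φ.θ x w)))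
    have h3 : (Φ.horiz nabla exp x (t • c) (Φ.s x (Φ.θ x w)) : 𝔼) = ζ t := by
      rw [Φ.s_θ x hx, hζ1]
    exact (h2.congr (map_smul _ _ _) h3).inner_eq hmetric h1
  have h1 : covAlong (F := ℝ) nabla (expCurve exp x (Φ.s x c)) η 0 (1 : ℝ) = 0 := by
    rw [hp 0 ⟨le_rfl, zero_le_one⟩]
    rfl
  rw [h1, inner_zero_right, add_zero] at hd2
  -- The two functions are known to agree only on `[0, 1]`, so one-sided derivatives at `0` are
  -- compared.
  have h2 := (hd1.hasDerivWithinAt (s := Icc 0 1)).congr (fun t ht => (heq t ht).symm)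
    (heq 0 ⟨le_rfl, zero_le_one⟩).symm
  have h3 := (uniqueDiffOn_Icc zero_lt_one 0 ⟨le_rfl, zero_le_one⟩).eq_deriv _ h2
    hd2.hasDerivWithinAt
  rw [h3]
  have key : ∀ (y y' : M) (a b : TangentSpace (𝓡 m) y) (a' b' : TangentSpace (𝓡 m) y'), y = y' →
      (a : 𝔼) = a' → (b : 𝔼) = b' → inner ℝ a b = inner ℝ a' b' := by
    rintro y _ a b a' b' rfl h h'
    obtain rfl : a = a' := h
    obtain rfl : b = b' := h'
    rfl
  exact key _ _ _ _ _ _ (expCurve_zero hexp _ _) hζ3 (congrArg (fun a : TangentBundle (𝓡 m) M => (a.2 : 𝔼)) h0)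

end TangentFrame

end TorsionTerm

end DbarExpansion

namespace DbarExpansion

/-! ### The remainder in a frame -/

section FrameRemainder

variable {m : ℕ} {M : Type*} [TopologicalSpace M] [ChartedSpace (EuclideanSpace ℝ (Fin m)) M]
  [IsManifold (𝓡 m) ∞ M]

local notation "𝔼" => EuclideanSpace ℝ (Fin m)

local notation "TM" => (TangentSpace (𝓡 m) : M → Type _)

variable {nabla : CovariantDerivative (𝓡 m) (EuclideanSpace ℝ (Fin m))
  (TangentSpace (𝓡 m) : M → Type _)}
  {exp : TangentBundle (𝓡 m) M → M}
  {W : Type} [NormedAddCommGroup W] [NormedSpace ℝ W] [FiniteDimensional ℝ W] {U : Set M}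
  {Φ : TangentFrame (m := m) W U}

variable [T2Space M] [RiemannianBundle (fun x : M => TangentSpace (𝓡 m) x)]
  [IsContMDiffRiemannianBundle (𝓡 m) ∞ (EuclideanSpace ℝ (Fin m))
    (fun x : M => TangentSpace (𝓡 m) x)]
  {Ψ : M × W → W →L[ℝ] W}

namespace TangentFrame

variable {F : Type*} [NormedAddCommGroup F] [NormedSpace ℝ F]
    {N : Type*} [TopologicalSpace N] [ChartedSpace F N]

lemma parallelTransport_symm_mfderiv (hsmooth : nabla.ContMDiffCovariantDerivative ∞)
    (hexp : IsExponentialLike (𝓡 m) exp) (hmetric : nabla.IsMetricCompatible)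
    (hΨ : IsFrameTransport nabla exp Φ Ψ) {f : N → M} {ξ : ∀ z : N, TangentSpace (𝓡 m) (f z)}
    {z : N} (hξ : AlongDiffAt (F := F) f ξ z)
    (hU : ∀ t ∈ Icc (0 : ℝ) 1, expCurve exp (f z) (ξ z) t ∈ U) (v : TangentSpace 𝓘(ℝ, F) z) :
    (parallelTransport nabla exp (f z) (ξ z)).symm
      (mfderiv 𝓘(ℝ, F) (𝓡 m) (fun z' => exp ⟨f z', ξ z'⟩) z v) =
    Φ.s (f z) (Φ.matH nabla exp Ψ (f z) (Φ.θ (f z) (ξ z))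
        (Φ.θ (f z) (mfderiv 𝓘(ℝ, F) (𝓡 m) f z v)) +
      Φ.matV exp Ψ (f z) (Φ.θ (f z) (ξ z)) (Φ.θ (f z) (covAlong nabla f ξ z v))) := by
  have hf : MDifferentiableAt 𝓘(ℝ, F) (𝓡 m) f z := ((mdifferentiableAt_totalSpace _ _).1 hξ).1
  have hz : f z ∈ U := by
    have := hU 0 ⟨le_rfl, zero_le_one⟩
    rwa [expCurve_zero hexp] at this
  set Z : N → W := fun z => Φ.θ (f z) (ξ z) with hZ_def
  have hZ : MDifferentiableAt 𝓘(ℝ, F) 𝓘(ℝ, W) Z z := Φ.mdifferentiableAt_repr hξ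
  have he := Φ.eventually_eq ξ hf.continuousAt hz
  have h1 := mfderiv_exp_comp (Φ := Φ) (nabla := nabla) hexp.smooth hf hZ hz v
  have h2 : covAlong (F := F) nabla f (fun z' => Φ.s (f z') (Z z')) z = covAlong nabla f ξ z :=
    (covAlong_congr he).symm
  rw [h2] at h1
  have h3 : (fun z' => exp ⟨f z', ξ z'⟩) =ᶠ[𝓝 z] fun z' => Φ.fexp exp (f z') (Z z') := by
    filter_upwards [he] with z' hz'
    exact congrArg (fun a => exp ⟨f z', a⟩) hz'
  have hv : Φ.s (f z) (Z z) = ξ z := Φ.s_θ _ hz _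
  set X : TangentSpace (𝓡 m) (Φ.fexp exp (f z) (Z z)) :=
    mfderiv 𝓘(ℝ, F) (𝓡 m) (fun z => Φ.fexp exp (f z) (Z z)) z v with hX
  have h4 := hΨ.spec (f z) (Z z) (by rwa [hv]) X
  have h5 : (X : 𝔼) = mfderiv 𝓘(ℝ, F) (𝓡 m) (fun z' => exp ⟨f z', ξ z'⟩) z v := by
    rw [hX, h3.mfderiv_eq]
    rfl
  have h6 := (h4.congr hv h5).symm_eq hsmooth hexp hmetric
  refine h6.trans (congrArg (Φ.s (f z)) ?_)
  have h7 : X = Φ.horiz nabla exp (f z) (Z z) (Φ.s (f z) (Φ.θ (f z)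
        (mfderiv 𝓘(ℝ, F) (𝓡 m) f z v))) +
      Φ.vert exp (f z) (Z z) (Φ.θ (f z) (covAlong nabla f ξ z v)) := by
    rw [Φ.s_θ _ hz]
    exact h1
  have h8 := congrArg (fun Y => Ψ (f z, Z z) (Φ.θ (Φ.fexp exp (f z) (Z z)) Y)) h7
  refine h8.trans ?_
  rw [map_add, map_add]
  rfl

variable (Φ) in
/-- The remainder of `matH` after its first order expansion. -/
noncomputable def remH (nabla : CovariantDerivative (𝓡 m) (EuclideanSpace ℝ (Fin m))
      (TangentSpace (𝓡 m) : M → Type _)) (exp : TangentBundle (𝓡 m) M → M)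
    (Ψ : M × W → W →L[ℝ] W) (x : M) (c : W) : W →L[ℝ] W :=
  Φ.matH nabla exp Ψ x c - Φ.matH nabla exp Ψ x 0 - fderiv ℝ (Φ.matH nabla exp Ψ x) 0 c

variable (Φ) in
/-- The remainder of `matV` after its zeroth order expansion. -/
noncomputable def remV (exp : TangentBundle (𝓡 m) M → M)
    (Ψ : M × W → W →L[ℝ] W) (x : M) (c : W) : W →L[ℝ] W :=
  Φ.matV exp Ψ x c - Φ.matV exp Ψ x 0

variable (Φ) in
/-- `remH` as an endomorphism of the tangent space. -/
noncomputable def endoH (nabla : CovariantDerivative (𝓡 m) (EuclideanSpace ℝ (Fin m))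
      (TangentSpace (𝓡 m) : M → Type _)) (exp : TangentBundle (𝓡 m) M → M)
    (Ψ : M × W → W →L[ℝ] W) (x : M) (v : TangentSpace (𝓡 m) x) :
    TangentSpace (𝓡 m) x →L[ℝ] TangentSpace (𝓡 m) x :=
  (Φ.s x).comp ((Φ.remH nabla exp Ψ x (Φ.θ x v)).comp (Φ.θ x))

variable (Φ) in
/-- `remV` as an endomorphism of the tangent space. -/
noncomputable def endoV (exp : TangentBundle (𝓡 m) M → M)
    (Ψ : M × W → W →L[ℝ] W) (x : M) (v : TangentSpace (𝓡 m) x) :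
    TangentSpace (𝓡 m) x →L[ℝ] TangentSpace (𝓡 m) x :=
  (Φ.s x).comp ((Φ.remV exp Ψ x (Φ.θ x v)).comp (Φ.θ x))

/-- The part of the pulled back differential of `exp ∘ ξ` that is of higher order in `ξ`. -/
noncomputable def higherOrder (nabla : CovariantDerivative (𝓡 m) (EuclideanSpace ℝ (Fin m))
      (TangentSpace (𝓡 m) : M → Type _)) (exp : TangentBundle (𝓡 m) M → M)
    (Φ : TangentFrame (m := m) W U) (Ψ : M × W → W →L[ℝ] W) (f : N → M)
    (ξ : ∀ z : N, TangentSpace (𝓡 m) (f z)) (z : N) :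
    TangentSpace 𝓘(ℝ, F) z →L[ℝ] TangentSpace (𝓡 m) (f z) :=
  (Φ.endoH nabla exp Ψ (f z) (ξ z)).comp (mfderiv 𝓘(ℝ, F) (𝓡 m) f z) +
    (Φ.endoV exp Ψ (f z) (ξ z)).comp (covAlong nabla f ξ z)

/-- The leading Taylor terms of `matH` and `matV` act as the identity. The linear term of `matH` is
`T(ξ, ·)`, which is `-T(·, ξ)` by antisymmetry. What remains is `higherOrder`. -/
lemma parallelTransport_symm_mfderiv_eq (hsmooth : nabla.ContMDiffCovariantDerivative ∞)
    (hexp : IsExponentialLike (𝓡 m) exp) (hmetric : nabla.IsMetricCompatible)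
    (hΨ : IsFrameTransport nabla exp Φ Ψ) {f : N → M} {ξ : ∀ z : N, TangentSpace (𝓡 m) (f z)}
    {z : N} (hξ : AlongDiffAt (F := F) f ξ z)
    (hU : ∀ t ∈ Icc (0 : ℝ) 1, expCurve exp (f z) (ξ z) t ∈ U) (v : TangentSpace 𝓘(ℝ, F) z) :
    (parallelTransport nabla exp (f z) (ξ z)).symm
      (mfderiv 𝓘(ℝ, F) (𝓡 m) (fun z' => exp ⟨f z', ξ z'⟩) z v) =
    higherOrder nabla exp Φ Ψ f ξ z v + mfderiv 𝓘(ℝ, F) (𝓡 m) f z v + covAlong nabla f ξ z v -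
      nabla.torsion (f z) (mfderiv 𝓘(ℝ, F) (𝓡 m) f z v) (ξ z) := by
  have hz : f z ∈ U := by
    have := hU 0 ⟨le_rfl, zero_le_one⟩
    rwa [expCurve_zero hexp] at this
  have h1 := s_matH_zero hexp hmetric hΨ hz (mfderiv 𝓘(ℝ, F) (𝓡 m) f z v)
  have h2 := s_matV_zero hexp hmetric hΨ hz (covAlong nabla f ξ z v)
  have h3 := s_fderiv_matH (c := Φ.θ (f z) (ξ z)) hsmooth hexp hmetric hΨ hz
    (by rwa [Φ.s_θ _ hz]) (mfderiv 𝓘(ℝ, F) (𝓡 m) f z v)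
  rw [Φ.s_θ _ hz, CovariantDerivative.torsion_antisymm] at h3
  rw [parallelTransport_symm_mfderiv hsmooth hexp hmetric hΨ hξ hU v]
  simp only [higherOrder, endoH, endoV, remH, remV, ContinuousLinearMap.comp_apply, add_apply, sub_apply,
    map_add, map_sub, h1, h2, h3]
  abel

end TangentFrame

section Surface

variable {d : ℕ} {S : Type*} [TopologicalSpace S] [ChartedSpace (EuclideanSpace ℝ (Fin d)) S]

/-- `∂̄`-type projection of a one-form. -/
noncomputable def zeroOnePart (J : ∀ x : M, TangentSpace (𝓡 m) x →L[ℝ] TangentSpace (𝓡 m) x)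
    (j : ∀ z : S, TangentSpace (𝓡 d) z →L[ℝ] TangentSpace (𝓡 d) z) (f : S → M)
    (η : ∀ z : S, TangentSpace (𝓡 d) z →L[ℝ] TangentSpace (𝓡 m) (f z)) (z : S) :
    TangentSpace (𝓡 d) z →L[ℝ] TangentSpace (𝓡 m) (f z) :=
  (1 / 2 : ℝ) • (η z + (J (f z)).comp ((η z).comp (j z)))

/-- As `Π⁻¹` commutes with `J`, the left side of `key` has `(0,1)`-part `∂̄_u ξ`, and the terms
other than `η` contribute `∂̄u + D_u ξ`. The form `η` is arbitrary so that the same computation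
serves the frame expansion and, with `η = 0`, the flat chart. -/
lemma remainder_eq_zeroOnePart_of_pullback (hsmooth : nabla.ContMDiffCovariantDerivative ∞)
    (hexp : IsExponentialLike (𝓡 m) exp) (hmetric : nabla.IsMetricCompatible)
    {J : ∀ x : M, TangentSpace (𝓡 m) x →L[ℝ] TangentSpace (𝓡 m) x}
    (hJ : IsSmoothHom (𝓡 m) (𝓡 m) (𝓡 m) (id : M → M) (id : M → M) J) (hnablaJ : IsJLinear nabla J)
    (j : ∀ z : S, TangentSpace (𝓡 d) z →L[ℝ] TangentSpace (𝓡 d) z) {f : S → M}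
    {ξ : ∀ z : S, TangentSpace (𝓡 m) (f z)} {z : S}
    {η : ∀ z : S, TangentSpace (𝓡 d) z →L[ℝ] TangentSpace (𝓡 m) (f z)}
    (key : ∀ v : TangentSpace (𝓡 d) z, (parallelTransport nabla exp (f z) (ξ z)).symm
      (mfderiv (𝓡 d) (𝓡 m) (fun z' => exp ⟨f z', ξ z'⟩) z v) =
      η z v + mfderiv (𝓡 d) (𝓡 m) f z v + covAlong nabla f ξ z v -
        nabla.torsion (f z) (mfderiv (𝓡 d) (𝓡 m) f z v) (ξ z)) :
    remainder nabla exp J j f ξ z = zeroOnePart J j f η z := by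
  ext1 v
  have h1 : dbarAt nabla exp J j f ξ z v = (1 / 2 : ℝ) •
      ((parallelTransport nabla exp (f z) (ξ z)).symm
        (mfderiv (𝓡 d) (𝓡 m) (fun z' => exp ⟨f z', ξ z'⟩) z v) +
       J (f z) ((parallelTransport nabla exp (f z) (ξ z)).symm
        (mfderiv (𝓡 d) (𝓡 m) (fun z' => exp ⟨f z', ξ z'⟩) z (j z v)))) := by
    rw [← parallelTransport_symm_J hsmooth hexp hmetric hJ hnablaJ]
    rw [← map_add, ← map_smul]
    rfl
  have h2 : remainder nabla exp J j f ξ z v =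
      dbarAt nabla exp J j f ξ z v - dbar J j f z v - linDbar nabla J j f ξ z v := rfl
  have h3 : linDbar nabla J j f ξ z v = (1 / 2 : ℝ) • (covAlong nabla f ξ z v +
      J (f z) (covAlong nabla f ξ z (j z v))) - (1 / 2 : ℝ) •
      (nabla.torsion (f z) (mfderiv (𝓡 d) (𝓡 m) f z v) (ξ z) +
        J (f z) (nabla.torsion (f z) (mfderiv (𝓡 d) (𝓡 m) f z (j z v)) (ξ z))) := rfl
  have h4 : dbar J j f z v = (1 / 2 : ℝ) • (mfderiv (𝓡 d) (𝓡 m) f z v +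
    J (f z) (mfderiv (𝓡 d) (𝓡 m) f z (j z v))) := rfl
  rw [h2, h1, h3, h4, key v, key (j z v)]
  simp only [zeroOnePart, smul_apply, add_apply, ContinuousLinearMap.comp_apply, map_add, map_sub]
  module

lemma remainder_eq_zeroOnePart (hsmooth : nabla.ContMDiffCovariantDerivative ∞)
    (hexp : IsExponentialLike (𝓡 m) exp) (hmetric : nabla.IsMetricCompatible)
    {J : ∀ x : M, TangentSpace (𝓡 m) x →L[ℝ] TangentSpace (𝓡 m) x}
    (hJ : IsSmoothHom (𝓡 m) (𝓡 m) (𝓡 m) (id : M → M) (id : M → M) J) (hnablaJ : IsJLinear nabla J)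
    (j : ∀ z : S, TangentSpace (𝓡 d) z →L[ℝ] TangentSpace (𝓡 d) z)
    (hΨ : IsFrameTransport nabla exp Φ Ψ) {f : S → M} {ξ : ∀ z : S, TangentSpace (𝓡 m) (f z)}
    {z : S} (hξ : AlongDiffAt (F := EuclideanSpace ℝ (Fin d)) f ξ z)
    (hU : ∀ t ∈ Icc (0 : ℝ) 1, expCurve exp (f z) (ξ z) t ∈ U) :
    remainder nabla exp J j f ξ z = zeroOnePart J j f
      (TangentFrame.higherOrder (F := EuclideanSpace ℝ (Fin d)) nabla exp Φ Ψ f ξ) z :=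
   remainder_eq_zeroOnePart_of_pullback hsmooth hexp hmetric hJ hnablaJ j
    (TangentFrame.parallelTransport_symm_mfderiv_eq hsmooth hexp hmetric hΨ hξ hU)

end Surface

end FrameRemainder

end DbarExpansion

namespace DbarExpansion

/-! ### Smoothness and type of the remainder -/

section RemainderSmooth

variable {m : ℕ} {M : Type*} [TopologicalSpace M] [ChartedSpace (EuclideanSpace ℝ (Fin m)) M]
  [IsManifold (𝓡 m) ∞ M]

local notation "𝔼" => EuclideanSpace ℝ (Fin m)

local notation "TM" => (TangentSpace (𝓡 m) : M → Type _)

variable {nabla : CovariantDerivative (𝓡 m) (EuclideanSpace ℝ (Fin m))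
  (TangentSpace (𝓡 m) : M → Type _)}
  {exp : TangentBundle (𝓡 m) M → M}
  {W : Type} [NormedAddCommGroup W] [NormedSpace ℝ W] [FiniteDimensional ℝ W] {U : Set M}
  {Φ : TangentFrame (m := m) W U}

variable {Ψ : M × W → W →L[ℝ] W}

namespace TangentFrame

lemma contMDiff_remV (hexp : ContMDiff (𝓡 m).tangent (𝓡 m) ∞ exp)
    (hΨ : ContMDiff ((𝓡 m).prod 𝓘(ℝ, W)) 𝓘(ℝ, W →L[ℝ] W) ∞ Ψ) :
    ContMDiff ((𝓡 m).prod 𝓘(ℝ, W)) 𝓘(ℝ, W →L[ℝ] W) ∞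
      (fun p : M × W => Φ.remV exp Ψ p.1 p.2) := by
  have h := contMDiff_matV (Φ := Φ) hexp hΨ
  exact h.sub (h.comp (contMDiff_fst.prodMk contMDiff_const))

omit [FiniteDimensional ℝ W] in
lemma contMDiff_fderiv_zero {V : Type*} [NormedAddCommGroup V] [NormedSpace ℝ V] {h : M → W → V}
    (hh : ContMDiff ((𝓡 m).prod 𝓘(ℝ, W)) 𝓘(ℝ, V) ∞ (Function.uncurry h)) :
    ContMDiff ((𝓡 m).prod 𝓘(ℝ, W)) 𝓘(ℝ, V) ∞ (fun p : M × W => fderiv ℝ (h p.1) 0 p.2) := by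
  intro p
  have h1 := isSmoothHomAt_partial_mfderiv (I := 𝓘(ℝ, W)) (I' := 𝓘(ℝ, V))
    (IN := (𝓡 m).prod 𝓘(ℝ, W)) (f := fun (p : M × W) c => h p.1 c) (g := fun _ => (0 : W))
    (z₀ := p) (hh.contMDiffAt.comp (f := fun q : (M × W) × W => (q.1.1, q.2))
      (p, 0) ((contMDiff_fst.comp contMDiff_fst).prodMk contMDiff_snd).contMDiffAt)
    contMDiffAt_const
  simp only [mfderiv_eq_fderiv] at h1
  have h2 : ContMDiffAt ((𝓡 m).prod 𝓘(ℝ, W)) 𝓘(ℝ, W →L[ℝ] V) ∞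
    (fun p : M × W => fderiv ℝ (h p.1) 0) p := isSmoothHomAt_model_iff.1 h1
  exact h2.clm_apply contMDiffAt_snd

lemma contMDiff_remH (hsmooth : nabla.ContMDiffCovariantDerivative ∞)
    (hexp : ContMDiff (𝓡 m).tangent (𝓡 m) ∞ exp)
    (hΨ : ContMDiff ((𝓡 m).prod 𝓘(ℝ, W)) 𝓘(ℝ, W →L[ℝ] W) ∞ Ψ) :
    ContMDiff ((𝓡 m).prod 𝓘(ℝ, W)) 𝓘(ℝ, W →L[ℝ] W) ∞
      (fun p : M × W => Φ.remH nabla exp Ψ p.1 p.2) := by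
  have h := contMDiff_matH (Φ := Φ) hsmooth hexp hΨ
  exact (h.sub (h.comp (contMDiff_fst.prodMk contMDiff_const))).sub
    (contMDiff_fderiv_zero (h := fun x => Φ.matH nabla exp Ψ x) h)

section Along

variable {E₁ : Type*} [NormedAddCommGroup E₁] [NormedSpace ℝ E₁]
    {G : Type*} [TopologicalSpace G] {IN : ModelWithCorners ℝ E₁ G}
    {N : Type*} [TopologicalSpace N] [ChartedSpace G N] {f : N → M}
    {ξ : ∀ z : N, TangentSpace (𝓡 m) (f z)} {z : N}

lemma isSmoothHomAt_endo {h : M → W → W →L[ℝ] W}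
    (hh : ContMDiff ((𝓡 m).prod 𝓘(ℝ, W)) 𝓘(ℝ, W →L[ℝ] W) ∞ (fun p : M × W => h p.1 p.2))
    (hξ : IsSmoothAlongAt (𝓡 m) IN f ξ z) :
    IsSmoothHomAt (𝓡 m) (𝓡 m) IN f f
      (fun z => (Φ.s (f z)).comp ((h (f z) (Φ.θ (f z) (ξ z))).comp (Φ.θ (f z)))) z := by
  have hf := hξ.contMDiffAt
  have hs : IsSmoothHomAt 𝓘(ℝ, W) (𝓡 m) IN (fun _ => (0 : W)) f (fun z => Φ.s (f z)) z :=
    isSmoothHomAt_of_apply fun c => ((Φ.s_smooth c).at (f z)).comp_right hf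
  have hθ := (Φ.θ_smooth.at (f z)).comp_right hf
  have hh' : IsSmoothHomAt 𝓘(ℝ, W) 𝓘(ℝ, W) IN (fun _ => (0 : W)) (fun _ => (0 : W))
      (fun z => h (f z) (Φ.θ (f z) (ξ z))) z :=
    isSmoothHomAt_model_iff.2 (hh.contMDiffAt.comp z (hf.prodMk (Φ.contMDiff_repr hξ)))
  exact hs.comp (hh'.comp hθ continuousAt_const) continuousAt_const

/-- A tube argument over the compact interval `[0, 1]`: the open set `U` still contains the curves
that start at nearby points. -/
lemma eventually_expCurve_mem (Φ : TangentFrame (m := m) W U) (hexp : IsExponentialLike (𝓡 m) exp)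
    (hξ : IsSmoothAlongAt (𝓡 m) IN f ξ z)
    (hU : ∀ t ∈ Icc (0 : ℝ) 1, expCurve exp (f z) (ξ z) t ∈ U) :
    ∀ᶠ z' in 𝓝 z, ∀ t ∈ Icc (0 : ℝ) 1, expCurve exp (f z') (ξ z') t ∈ U := by
  have hf := hξ.contMDiffAt
  have hz : f z ∈ U := by
    have := hU 0 ⟨le_rfl, zero_le_one⟩
    rwa [expCurve_zero hexp] at this
  refine isCompact_Icc.eventually_forall_of_forall_eventually fun t ht => ?_
  have h1 : ContMDiffAt (IN.prod 𝓘(ℝ, ℝ)) (𝓡 m) ∞ (fun p : N × ℝ =>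
      expCurve exp (f p.1) (Φ.s (f p.1) (Φ.θ (f p.1) (ξ p.1))) p.2) (z, t) :=
    Φ.contMDiff_expCurve (f := fun p : N × ℝ => f p.1) (Z := fun p : N × ℝ => Φ.θ (f p.1) (ξ p.1))
      (τ := fun p => p.2) hexp.smooth
      (hf.comp (f := fun p : N × ℝ => p.1) (z, t) contMDiffAt_fst)
      ((Φ.contMDiff_repr hξ).comp (f := fun p : N × ℝ => p.1) (z, t) contMDiffAt_fst)
      contMDiffAt_snd
  have h2 : expCurve exp (f z) (Φ.s (f z) (Φ.θ (f z) (ξ z))) t ∈ U := by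
    rw [Φ.s_θ _ hz]
    exact hU t ht
  have h3 := h1.continuousAt (Φ.isOpen.mem_nhds h2)
  have h4 : ∀ᶠ p : N × ℝ in 𝓝 (z, t), ξ p.1 = Φ.s (f p.1) (Φ.θ (f p.1) (ξ p.1)) :=
    continuousAt_fst.eventually (Φ.eventually_eq ξ hf.continuousAt hz)
  filter_upwards [h3, h4] with p hp hp'
  rw [hp']
  exact hp

end Along

end TangentFrame

lemma exists_frameTransport [T2Space M] (hsmooth : nabla.ContMDiffCovariantDerivative ∞)
    (hexp : IsExponentialLike (𝓡 m) exp) {C : Set M} (hC : IsCompact C) :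
    ∃ (q : ℕ) (U : Set M) (Φ : TangentFrame (m := m) (Fin q → 𝔼) U)
      (Ψ : M × (Fin q → 𝔼) → (Fin q → 𝔼) →L[ℝ] (Fin q → 𝔼)),
      C ⊆ U ∧ IsFrameTransport nabla exp Φ Ψ := by
  obtain ⟨q, U, hU, ⟨Φ⟩⟩ := exists_tangentFrame (M := M) (m := m) hC
  obtain ⟨Ψ, h1, h2⟩ := exists_frame_transport hsmooth hexp Φ
  exact ⟨q, U, Φ, Ψ, hU, h1, h2⟩

section Surface

variable {d : ℕ} {S : Type*} [TopologicalSpace S] [ChartedSpace (EuclideanSpace ℝ (Fin d)) S]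
  {J : ∀ x : M, TangentSpace (𝓡 m) x →L[ℝ] TangentSpace (𝓡 m) x}
  {j : ∀ z : S, TangentSpace (𝓡 d) z →L[ℝ] TangentSpace (𝓡 d) z} {f : S → M}

omit [IsManifold (𝓡 m) ∞ M] in
lemma zeroOnePart_comp_j (hJ : ∀ (x : M) (v : TangentSpace (𝓡 m) x), J x (J x v) = -v)
    (hj : ∀ (z : S) (v : TangentSpace (𝓡 d) z), j z (j z v) = -v)
    (η : ∀ z : S, TangentSpace (𝓡 d) z →L[ℝ] TangentSpace (𝓡 m) (f z)) (z : S)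
    (v : TangentSpace (𝓡 d) z) :
    zeroOnePart J j f η z (j z v) = -J (f z) (zeroOnePart J j f η z v) := by
  simp only [zeroOnePart, smul_apply, add_apply, ContinuousLinearMap.comp_apply, map_add, map_smul,
    hJ, hj, map_neg]
  module

lemma isSmoothHomAt_zeroOnePart [IsManifold (𝓡 d) ∞ S]
    (hJ : IsSmoothHom (𝓡 m) (𝓡 m) (𝓡 m) (id : M → M) (id : M → M) J)
    (hj : IsSmoothHom (𝓡 d) (𝓡 d) (𝓡 d) (id : S → S) (id : S → S) j) {z : S}
    (hf : ContMDiffAt (𝓡 d) (𝓡 m) ∞ f z)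
    {η : ∀ z : S, TangentSpace (𝓡 d) z →L[ℝ] TangentSpace (𝓡 m) (f z)}
    (hη : IsSmoothHomAt (𝓡 d) (𝓡 m) (𝓡 d) (id : S → S) f η z) :
    IsSmoothHomAt (𝓡 d) (𝓡 m) (𝓡 d) (id : S → S) f (zeroOnePart J j f η) z := by
  refine IsSmoothHomAt.const_smul (1 / 2 : ℝ) (hη.add ?_)
  exact ((hJ.at (f z)).comp_right hf).comp (hη.comp (hj.at z) continuousAt_id) hf.continuousAt

lemma isSmoothHomAt_higherOrder [T2Space M] [IsManifold (𝓡 d) ∞ S] (hsmooth : nabla.ContMDiffCovariantDerivative ∞)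
    (hexp : ContMDiff (𝓡 m).tangent (𝓡 m) ∞ exp)
    (hΨ : ContMDiff ((𝓡 m).prod 𝓘(ℝ, W)) 𝓘(ℝ, W →L[ℝ] W) ∞ Ψ)
    {ξ : ∀ z : S, TangentSpace (𝓡 m) (f z)} (hξ : IsSmoothAlong (𝓡 m) (𝓡 d) f ξ) (z : S) :
    IsSmoothHomAt (𝓡 d) (𝓡 m) (𝓡 d) (id : S → S) f
      (TangentFrame.higherOrder (F := EuclideanSpace ℝ (Fin d)) nabla exp Φ Ψ f ξ) z := by
  have hf := (hξ.at z).contMDiffAt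
  have h1 := TangentFrame.isSmoothHomAt_endo (Φ := Φ)
    (TangentFrame.contMDiff_remH (Φ := Φ) hsmooth hexp hΨ) (hξ.at z)
  have h2 := TangentFrame.isSmoothHomAt_endo (Φ := Φ)
    (TangentFrame.contMDiff_remV (Φ := Φ) hexp hΨ) (hξ.at z)
  exact (h1.comp (isSmoothHomAt_mfderiv hf) hf.continuousAt).add
    (h2.comp ((isSmoothHom_covAlong hsmooth hξ).at z) hf.continuousAt)

variable [T2Space M] [RiemannianBundle (fun x : M => TangentSpace (𝓡 m) x)]
  [IsContMDiffRiemannianBundle (𝓡 m) ∞ (EuclideanSpace ℝ (Fin m))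
    (fun x : M => TangentSpace (𝓡 m) x)]

lemma remainder_zero (hsmooth : nabla.ContMDiffCovariantDerivative ∞)
    (hexp : IsExponentialLike (𝓡 m) exp) (hmetric : nabla.IsMetricCompatible)
    (hJ : IsSmoothHom (𝓡 m) (𝓡 m) (𝓡 m) (id : M → M) (id : M → M) J) (hnablaJ : IsJLinear nabla J)
    (hf : ContMDiff (𝓡 d) (𝓡 m) ∞ f) :
    remainder nabla exp J j f 0 = 0 := by
  funext z
  obtain ⟨q, U, Φ, Ψ, hU, hΨ⟩ := exists_frameTransport hsmooth hexp (isCompact_singleton (x := f z))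
  have h0 : AlongDiffAt (F := EuclideanSpace ℝ (Fin d)) f
      (0 : ∀ z, TangentSpace (𝓡 m) (f z)) z := AlongDiffAt.zero (hf.mdifferentiable (by simp) z)
  rw [remainder_eq_zeroOnePart hsmooth hexp hmetric hJ hnablaJ j hΨ h0 (fun t _ => hU (by
    simp [expCurve, hexp.zero]))]
  have h1 : TangentFrame.higherOrder (F := EuclideanSpace ℝ (Fin d)) nabla exp Φ Ψ f
      (0 : ∀ z, TangentSpace (𝓡 m) (f z)) z = 0 := by
    ext v
    simp [TangentFrame.higherOrder, TangentFrame.endoH, TangentFrame.endoV, TangentFrame.remH,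
      TangentFrame.remV]
  rw [zeroOnePart, h1]
  ext v
  simp

variable [IsManifold (𝓡 d) ∞ S]

/-- `parallelTransport` is chosen separately at every point, so smoothness has to come from a
formula. A frame around the curve at `z` gives one that is valid for all points near `z`. -/
lemma isZeroOneForm_remainder (hsmooth : nabla.ContMDiffCovariantDerivative ∞)
    (hexp : IsExponentialLike (𝓡 m) exp) (hmetric : nabla.IsMetricCompatible)
    (hJ : IsAlmostComplex (𝓡 m) J) (hnablaJ : IsJLinear nabla J) (hj : IsAlmostComplex (𝓡 d) j)
    {ξ : ∀ z : S, TangentSpace (𝓡 m) (f z)} (hξ : IsSmoothAlong (𝓡 m) (𝓡 d) f ξ) :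
    IsZeroOneForm J j f (remainder nabla exp J j f ξ) := by
  have key : ∀ z : S, ∃ η : ∀ z : S, TangentSpace (𝓡 d) z →L[ℝ] TangentSpace (𝓡 m) (f z),
      IsSmoothHomAt (𝓡 d) (𝓡 m) (𝓡 d) (id : S → S) f η z ∧
      ∀ᶠ z' in 𝓝 z, remainder nabla exp J j f ξ z' = zeroOnePart J j f η z' := by
    intro z
    have hC : IsCompact (expCurve exp (f z) (ξ z) '' Icc 0 1) :=
      isCompact_Icc.image (contMDiff_expCurve hexp.smooth _ _).continuous
    obtain ⟨q, U, Φ, Ψ, hU, hΨ⟩ := exists_frameTransport hsmooth hexp hC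
    refine ⟨TangentFrame.higherOrder (F := EuclideanSpace ℝ (Fin d)) nabla exp Φ Ψ f ξ,
      isSmoothHomAt_higherOrder hsmooth hexp.smooth hΨ.smooth hξ z, ?_⟩
    filter_upwards [Φ.eventually_expCurve_mem hexp (hξ.at z)
      fun t ht => hU (mem_image_of_mem _ ht)] with z' hz'
    exact remainder_eq_zeroOnePart hsmooth hexp hmetric hJ.smooth hnablaJ j hΨ
      ((hξ.at z').alongDiffAt (F := EuclideanSpace ℝ (Fin d))) hz'
  refine ⟨fun z => ?_, fun z v => ?_⟩
  · obtain ⟨η, hη, he⟩ := key z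
    exact (isSmoothHomAt_zeroOnePart hJ.smooth hj.smooth (hξ.at z).contMDiffAt hη).congr he
  · obtain ⟨η, -, he⟩ := key z
    rw [he.self_of_nhds]
    exact zeroOnePart_comp_j hJ.sq hj.sq η z v

end Surface

end RemainderSmooth

end DbarExpansion

namespace DbarExpansion

/-! ### Uniform bounds over compact sets -/

section Bounds

variable {m : ℕ} {M : Type*} [TopologicalSpace M] [ChartedSpace (EuclideanSpace ℝ (Fin m)) M]
  [IsManifold (𝓡 m) ∞ M]

local notation "𝔼" => EuclideanSpace ℝ (Fin m)

local notation "TM" => (TangentSpace (𝓡 m) : M → Type _)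

variable {W : Type} [NormedAddCommGroup W] [NormedSpace ℝ W] [FiniteDimensional ℝ W] {U : Set M}
  {V : Type*} [NormedAddCommGroup V] [NormedSpace ℝ V]

omit [FiniteDimensional ℝ W] in
lemma contMDiff_partial_fderiv {h : M → W → V}
    (hh : ContMDiff ((𝓡 m).prod 𝓘(ℝ, W)) 𝓘(ℝ, V) ∞ (fun p : M × W => h p.1 p.2)) :
    ContMDiff ((𝓡 m).prod 𝓘(ℝ, W)) 𝓘(ℝ, W →L[ℝ] V) ∞
      (fun p : M × W => fderiv ℝ (h p.1) p.2) := by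
  intro p
  have h1 := isSmoothHomAt_partial_mfderiv (I := 𝓘(ℝ, W)) (I' := 𝓘(ℝ, V))
    (IN := (𝓡 m).prod 𝓘(ℝ, W)) (f := fun (p : M × W) c => h p.1 c) (g := fun p => p.2)
    (z₀ := p) (hh.contMDiffAt.comp (f := fun q : (M × W) × W => (q.1.1, q.2))
      (p, p.2) ((contMDiff_fst.comp contMDiff_fst).prodMk contMDiff_snd).contMDiffAt)
    contMDiffAt_snd
  simp only [mfderiv_eq_fderiv] at h1
  exact isSmoothHomAt_model_iff.1 h1

omit [IsManifold (𝓡 m) ∞ M] [FiniteDimensional ℝ W] in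
lemma contDiff_partial {h : M → W → V}
    (hh : ContMDiff ((𝓡 m).prod 𝓘(ℝ, W)) 𝓘(ℝ, V) ∞ (fun p : M × W => h p.1 p.2)) (x : M) :
    ContDiff ℝ ∞ (h x) := by
  rw [← contMDiff_iff_contDiff]
  exact hh.comp (contMDiff_const.prodMk contMDiff_id)

lemma exists_lipschitz_bound {h : M → W → V}
    (hh : ContMDiff ((𝓡 m).prod 𝓘(ℝ, W)) 𝓘(ℝ, V) ∞ (fun p : M × W => h p.1 p.2))
    {K : Set M} (hK : IsCompact K) (R : ℝ) :
    ∃ C : ℝ, 0 ≤ C ∧ ∀ x ∈ K, ∀ c c' : W, ‖c‖ ≤ R → ‖c'‖ ≤ R →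
      ‖h x c - h x c'‖ ≤ C * ‖c - c'‖ := by
  obtain ⟨C, hC⟩ := (hK.prod (isCompact_closedBall (0 : W) R)).exists_bound_of_continuousOn
    (contMDiff_partial_fderiv hh).continuous.continuousOn
  refine ⟨max C 0, le_max_right _ _, fun x hx c c' hc hc' => ?_⟩
  refine (convex_closedBall (0 : W) R).norm_image_sub_le_of_norm_fderiv_le (𝕜 := ℝ)
    (fun y _ => (contDiff_partial hh x).differentiable (by simp) y) (fun y hy =>
      (hC (x, y) ⟨hx, hy⟩).trans (le_max_left _ _)) ?_ ?_ <;> simpa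

/-- The map `c ↦ h x c - Dh(0) c` has derivative `Dh(y) - Dh(0)`, of norm at most `C ‖y‖` by the
Lipschitz bound for `Dh`. The mean value inequality is applied on the ball of radius `max ‖c‖ ‖c'‖`,
not on that of radius `R`. -/
lemma exists_second_order_bound {h : M → W → V}
    (hh : ContMDiff ((𝓡 m).prod 𝓘(ℝ, W)) 𝓘(ℝ, V) ∞ (fun p : M × W => h p.1 p.2))
    {K : Set M} (hK : IsCompact K) (R : ℝ) :
    ∃ C : ℝ, 0 ≤ C ∧ ∀ x ∈ K, ∀ c c' : W, ‖c‖ ≤ R → ‖c'‖ ≤ R →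
      ‖(h x c - fderiv ℝ (h x) 0 c) - (h x c' - fderiv ℝ (h x) 0 c')‖ ≤
        C * (‖c‖ + ‖c'‖) * ‖c - c'‖ := by
  obtain ⟨C, hC0, hC⟩ := exists_lipschitz_bound (h := fun x c => fderiv ℝ (h x) c)
    (contMDiff_partial_fderiv hh) hK R
  refine ⟨C, hC0, fun x hx c c' hc hc' => ?_⟩
  have hd : ∀ y, HasFDerivAt (fun c => h x c - fderiv ℝ (h x) 0 c)
      (fderiv ℝ (h x) y - fderiv ℝ (h x) 0) y := fun y =>
    ((contDiff_partial hh x).differentiable (by simp) y).hasFDerivAt.sub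
      (fderiv ℝ (h x) 0).hasFDerivAt
  have hR : max ‖c‖ ‖c'‖ ≤ R := max_le hc hc'
  refine (convex_closedBall (0 : W) (max ‖c‖ ‖c'‖)).norm_image_sub_le_of_norm_hasFDerivWithin_le
    (fun y _ => (hd y).hasFDerivWithinAt) (fun y hy => ?_) ?_ ?_
  · rw [mem_closedBall_zero_iff] at hy
    refine (hC x hx y 0 (hy.trans hR) ?_).trans ?_
    · rw [norm_zero]
      exact (norm_nonneg c).trans hc
    · rw [sub_zero]
      refine mul_le_mul_of_nonneg_left (hy.trans ?_) hC0
      exact max_le (le_add_of_nonneg_right (norm_nonneg _)) (le_add_of_nonneg_left (norm_nonneg _))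
  · simp
  · simp

variable [RiemannianBundle (fun x : M => TangentSpace (𝓡 m) x)]
  [IsContMDiffRiemannianBundle (𝓡 m) ∞ (EuclideanSpace ℝ (Fin m))
    (fun x : M => TangentSpace (𝓡 m) x)]

lemma continuous_norm_comp {A : ∀ x : M, W →L[ℝ] TangentSpace (𝓡 m) x}
    (hA : ∀ c, IsSmoothAlong (𝓡 m) (𝓡 m) (id : M → M) (fun x => A x c)) :
    Continuous (fun p : M × W => ‖A p.1 p.2‖) := by
  have h1 : ContMDiff ((𝓡 m).prod 𝓘(ℝ, W)) (𝓡 m).tangent ∞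
      (fun p : M × W => (⟨p.1, A p.1 p.2⟩ : TangentBundle (𝓡 m) M)) := fun p => by
    have hs : IsSmoothHomAt 𝓘(ℝ, W) (𝓡 m) ((𝓡 m).prod 𝓘(ℝ, W)) (fun _ => (0 : W))
        (fun p : M × W => p.1) (fun p => A p.1) p :=
      isSmoothHomAt_of_apply fun c => ((hA c).at p.1).comp_right contMDiffAt_fst
    exact hs.apply (ξ := fun p => p.2) ((isSmoothAlongAt_model_iff contMDiffAt_const).2
      contMDiffAt_snd) contMDiffAt_fst
  have h2 := (ContMDiff.inner_bundle (F := 𝔼) (E := TM) (b := fun p : M × W => p.1) h1 h1).continuous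
  simp only [real_inner_self_eq_norm_sq] at h2
  have h3 := h2.sqrt
  simpa [Real.sqrt_sq] using h3

lemma exists_norm_le_of_smooth {A : ∀ x : M, W →L[ℝ] TangentSpace (𝓡 m) x}
    (hA : ∀ c, IsSmoothAlong (𝓡 m) (𝓡 m) (id : M → M) (fun x => A x c))
    {K : Set M} (hK : IsCompact K) :
    ∃ C : ℝ, 0 ≤ C ∧ ∀ x ∈ K, ∀ c, ‖A x c‖ ≤ C * ‖c‖ := by
  obtain ⟨C, hC⟩ := (hK.prod (isCompact_sphere (0 : W) 1)).exists_bound_of_continuousOn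
    (continuous_norm_comp hA).continuousOn
  refine ⟨max C 0, le_max_right _ _, fun x hx c => ?_⟩
  rcases eq_or_ne c 0 with rfl | hc
  · simp
  have h1 := hC (x, ‖c‖⁻¹ • c) ⟨hx, by simp [norm_smul, hc]⟩
  rw [norm_norm, map_smul, norm_smul, norm_inv, norm_norm, inv_mul_le_iff₀ (norm_pos_iff.2 hc),
    mul_comm] at h1
  exact h1.trans (mul_le_mul_of_nonneg_right (le_max_left _ _) (norm_nonneg c))

/-- Unit vectors `c` with `θ s c = c` form a compact set over `K`, on which `s c ≠ 0`, so `‖s c‖` is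
bounded below there. The normalisation of `θ v` lies in this set because `s θ v = v`. -/
lemma TangentFrame.exists_norm_θ_le (Φ : TangentFrame (m := m) W U) {K : Set M}
    (hK : IsCompact K) (hKU : K ⊆ U) :
    ∃ C : ℝ, 0 ≤ C ∧ ∀ x ∈ K, ∀ v : TangentSpace (𝓡 m) x, ‖Φ.θ x v‖ ≤ C * ‖v‖ := by
  have hθs : Continuous (fun p : M × W => Φ.θ p.1 (Φ.s p.1 p.2)) := by
    rw [continuous_iff_continuousAt]
    intro p
    have h1 := Φ.contMDiff_repr (Φ.isSmoothAlongAt (f := fun p : M × W => p.1)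
      (Z := fun p : M × W => p.2) (z := p) contMDiffAt_fst contMDiffAt_snd)
    exact h1.continuousAt
  let T : Set (M × W) := (K ×ˢ Metric.sphere (0 : W) 1) ∩ {p | Φ.θ p.1 (Φ.s p.1 p.2) = p.2}
  have hT : IsCompact T :=
    (hK.prod (isCompact_sphere (0 : W) 1)).inter_right (isClosed_eq hθs continuous_snd)
  have hpos : ∀ p ∈ T, 0 < ‖Φ.s p.1 p.2‖ := by
    intro p hp
    rw [norm_pos_iff]
    intro h0
    have h1 : Φ.θ p.1 (Φ.s p.1 p.2) = p.2 := hp.2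
    rw [h0, map_zero] at h1
    have h2 := hp.1.2
    rw [← h1] at h2
    simp at h2
  have hcont := continuous_norm_comp Φ.s_smooth
  obtain ⟨C, hC⟩ := hT.exists_bound_of_continuousOn (f := fun p => ‖Φ.s p.1 p.2‖⁻¹)
    (hcont.continuousOn.inv₀ fun p hp => (hpos p hp).ne')
  refine ⟨max C 0, le_max_right _ _, fun x hx v => ?_⟩
  set c := Φ.θ x v with hc_def
  have hsc : Φ.s x c = v := Φ.s_θ x (hKU hx) v
  rcases eq_or_ne c 0 with hc | hc
  · rw [hc, norm_zero]
    positivity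
  have hp : (x, ‖c‖⁻¹ • c) ∈ T := by
    refine ⟨⟨hx, by simp [norm_smul, hc]⟩, ?_⟩
    change Φ.θ x (Φ.s x (‖c‖⁻¹ • c)) = ‖c‖⁻¹ • c
    rw [map_smul, map_smul, hsc]
  have h1 := hC _ hp
  have h2 := hpos _ hp
  dsimp only at h1 h2
  rw [norm_inv, norm_norm, map_smul, hsc, norm_smul, norm_inv, norm_norm, mul_inv, inv_inv] at h1
  rw [map_smul, hsc, norm_smul, norm_inv, norm_norm] at h2
  have h3 : 0 < ‖v‖ := pos_of_mul_pos_right h2 (by positivity)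
  rw [← div_eq_mul_inv, div_le_iff₀ h3] at h1
  exact h1.trans (mul_le_mul_of_nonneg_right (le_max_left _ _) h3.le)

end Bounds

end DbarExpansion

namespace DbarExpansion

/-! ### The quadratic estimate -/

section Estimate

variable {m : ℕ} {M : Type*} [TopologicalSpace M] [ChartedSpace (EuclideanSpace ℝ (Fin m)) M]
  [IsManifold (𝓡 m) ∞ M]

local notation "𝔼" => EuclideanSpace ℝ (Fin m)

local notation "TM" => (TangentSpace (𝓡 m) : M → Type _)

variable {nabla : CovariantDerivative (𝓡 m) (EuclideanSpace ℝ (Fin m))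
  (TangentSpace (𝓡 m) : M → Type _)}
  {exp : TangentBundle (𝓡 m) M → M}

/-- From `0 = p (x - x) ≤ 2 p x`; nonnegativity is not part of `IsNormOn`. -/
lemma IsNormOn.nonneg {V : Type*} [AddCommGroup V] [Module ℝ V] {s : Set V} {p : V → ℝ}
    (hp : IsNormOn s p) {x : V} (hx : x ∈ s) (hx' : (-1 : ℝ) • x ∈ s) : 0 ≤ p x := by
  have h1 := hp.add_le x hx _ hx'
  have h2 := hp.smul (-1) x hx
  have h3 := hp.smul 0 x hx
  rw [zero_smul, abs_zero, zero_mul] at h3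
  rw [show x + (-1 : ℝ) • x = 0 by module, h3, h2] at h1
  norm_num at h1
  linarith

section Along

variable {E₁ : Type*} [NormedAddCommGroup E₁] [NormedSpace ℝ E₁]
    {G : Type*} [TopologicalSpace G] {IN : ModelWithCorners ℝ E₁ G}
    {N : Type*} [TopologicalSpace N] [ChartedSpace G N] {f : N → M}

lemma IsSmoothAlong.smul_add_smul [T2Space M] {ξ ξ' : ∀ z : N, TangentSpace (𝓡 m) (f z)} (a b : ℝ)
    (h : IsSmoothAlong (𝓡 m) IN f ξ) (h' : IsSmoothAlong (𝓡 m) IN f ξ') :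
    IsSmoothAlong (𝓡 m) IN f (a • ξ + b • ξ') := by
  intro z
  have hf := (h.at z).contMDiffAt
  obtain ⟨q, U, hU, ⟨Φ⟩⟩ := exists_tangentFrame (M := M) (m := m) (isCompact_singleton (x := f z))
  have hc : ∀ a : ℝ, ContMDiffAt IN 𝓘(ℝ, ℝ) ∞ (fun _ : N => a) z := fun a => contMDiffAt_const
  have ha : ContMDiffAt IN 𝓘(ℝ, Fin q → 𝔼) ∞ (fun z => a • Φ.θ (f z) (ξ z)) z :=
    (hc a).smul (Φ.contMDiff_repr (h.at z))
  have hb : ContMDiffAt IN 𝓘(ℝ, Fin q → 𝔼) ∞ (fun z => b • Φ.θ (f z) (ξ' z)) z :=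
    (hc b).smul (Φ.contMDiff_repr (h'.at z))
  have h1 := Φ.isSmoothAlongAt hf (ha.add hb)
  refine h1.congr ?_
  filter_upwards [Φ.eventually_eq ξ hf.continuousAt (hU rfl),
    Φ.eventually_eq ξ' hf.continuousAt (hU rfl)] with z' h2 h3
  have : (a • ξ + b • ξ') z' = a • ξ z' + b • ξ' z' := rfl
  rw [this]
  conv_lhs => rw [h2, h3]
  rw [Pi.add_apply, map_add, map_smul, map_smul]

lemma IsSmoothAlong.sub [T2Space M] {ξ ξ' : ∀ z : N, TangentSpace (𝓡 m) (f z)}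
    (h : IsSmoothAlong (𝓡 m) IN f ξ) (h' : IsSmoothAlong (𝓡 m) IN f ξ') :
    IsSmoothAlong (𝓡 m) IN f (ξ - ξ') := by
  have := h.smul_add_smul 1 (-1) h'
  rwa [one_smul, neg_one_smul, ← sub_eq_add_neg] at this

lemma IsSmoothAlong.neg_one_smul [T2Space M] {ξ : ∀ z : N, TangentSpace (𝓡 m) (f z)}
    (h : IsSmoothAlong (𝓡 m) IN f ξ) : IsSmoothAlong (𝓡 m) IN f ((-1 : ℝ) • ξ) := by
  have := h.smul_add_smul (-1) 0 h
  rwa [zero_smul, add_zero] at this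

end Along

variable [T2Space M] [RiemannianBundle (fun x : M => TangentSpace (𝓡 m) x)]
  [IsContMDiffRiemannianBundle (𝓡 m) ∞ (EuclideanSpace ℝ (Fin m))
    (fun x : M => TangentSpace (𝓡 m) x)]

/-- Uniform bounds for the higher order part over a compact set. -/
structure HigherOrderBound {W : Type} [NormedAddCommGroup W] [NormedSpace ℝ W]
    [FiniteDimensional ℝ W] {U : Set M} (nabla : CovariantDerivative (𝓡 m)
      (EuclideanSpace ℝ (Fin m)) (TangentSpace (𝓡 m) : M → Type _))
    (exp : TangentBundle (𝓡 m) M → M) (Φ : TangentFrame (m := m) W U) (Ψ : M × W → W →L[ℝ] W)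
    (K : Set M) (R c : ℝ) : Prop where
  mem : ∀ x ∈ K, ∀ v : TangentSpace (𝓡 m) x, ‖v‖ ≤ R →
    ∀ t ∈ Icc (0 : ℝ) 1, expCurve exp x v t ∈ U
  horizontal : ∀ x ∈ K, ∀ v v' : TangentSpace (𝓡 m) x, ‖v‖ ≤ R → ‖v'‖ ≤ R →
    ∀ w, ‖(Φ.endoH nabla exp Ψ x v - Φ.endoH nabla exp Ψ x v') w‖ ≤
      c * ((‖v‖ + ‖v'‖) * ‖v - v'‖) * ‖w‖
  vertical : ∀ x ∈ K, ∀ v v' : TangentSpace (𝓡 m) x, ‖v‖ ≤ R → ‖v'‖ ≤ R →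
    ∀ w, ‖(Φ.endoV exp Ψ x v - Φ.endoV exp Ψ x v') w‖ ≤ c * ‖v - v'‖ * ‖w‖

/-- Two frames are needed. The first, over `K`, only bounds coefficients by `c₀ ‖v‖`, which places
all points `exp(tv)` with `‖v‖ ≤ R` in one compact set. The second lives over that larger set, where
transport has to be computed. -/
lemma exists_higherOrderBound (hsmooth : nabla.ContMDiffCovariantDerivative ∞)
    (hexp : IsExponentialLike (𝓡 m) exp) {K : Set M} (hK : IsCompact K) (R : ℝ) :
    ∃ (q : ℕ) (U : Set M) (Φ : TangentFrame (m := m) (Fin q → 𝔼) U)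
      (Ψ : M × (Fin q → 𝔼) → (Fin q → 𝔼) →L[ℝ] (Fin q → 𝔼)) (c : ℝ),
      IsFrameTransport nabla exp Φ Ψ ∧ 0 ≤ c ∧ HigherOrderBound nabla exp Φ Ψ K R c := by
  obtain ⟨q₀, U₀, hU₀, ⟨Φ₀⟩⟩ := exists_tangentFrame (M := M) (m := m) hK
  obtain ⟨c₀, hc₀, hθ₀⟩ := Φ₀.exists_norm_θ_le hK hU₀
  have hC : IsCompact (K ∪ (fun p : M × (Fin q₀ → 𝔼) => Φ₀.fexp exp p.1 p.2) ''
      (K ×ˢ Metric.closedBall 0 (c₀ * R))) :=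
    hK.union ((hK.prod (isCompact_closedBall _ _)).image
      (TangentFrame.contMDiff_fexp hexp.smooth).continuous)
  obtain ⟨q, U, Φ, Ψ, hU, hΨ⟩ := exists_frameTransport hsmooth hexp hC
  have hKU : K ⊆ U := subset_union_left.trans hU
  obtain ⟨a, ha, hθ⟩ := Φ.exists_norm_θ_le hK hKU
  obtain ⟨b, hb, hs⟩ := exists_norm_le_of_smooth Φ.s_smooth hK
  obtain ⟨l, hl, hV⟩ := exists_lipschitz_bound
    (TangentFrame.contMDiff_matV (Φ := Φ) hexp.smooth hΨ.smooth) hK (a * R)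
  obtain ⟨k, hk, hH⟩ := exists_second_order_bound
    (TangentFrame.contMDiff_matH (Φ := Φ) hsmooth hexp.smooth hΨ.smooth) hK (a * R)
  have hθR : ∀ x ∈ K, ∀ v : TangentSpace (𝓡 m) x, ‖v‖ ≤ R → ‖Φ.θ x v‖ ≤ a * R := fun x hx v hv =>
    (hθ x hx v).trans (mul_le_mul_of_nonneg_left hv ha)
  have hAB : ∀ x ∈ K, ∀ (A B : (Fin q → 𝔼) →L[ℝ] (Fin q → 𝔼)) (r : ℝ), ‖A - B‖ ≤ r →
      ∀ w : TangentSpace (𝓡 m) x, ‖((Φ.s x).comp (A.comp (Φ.θ x)) -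
        (Φ.s x).comp (B.comp (Φ.θ x))) w‖ ≤ b * (r * (a * ‖w‖)) := by
    intro x hx A B r hr w
    have h1 : ((Φ.s x).comp (A.comp (Φ.θ x)) - (Φ.s x).comp (B.comp (Φ.θ x))) w =
        Φ.s x ((A - B) (Φ.θ x w)) := by
      simp only [sub_apply, ContinuousLinearMap.comp_apply, map_sub]
    rw [h1]
    refine (hs x hx _).trans (mul_le_mul_of_nonneg_left ?_ hb)
    exact (ContinuousLinearMap.le_opNorm _ _).trans
      (mul_le_mul hr (hθ x hx w) (norm_nonneg _) ((norm_nonneg _).trans hr))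
  have hc1 : 0 ≤ b * l * a ^ 2 := by positivity
  have hc2 : 0 ≤ b * k * a ^ 3 := by positivity
  -- A factor `a` for each use of `θ`: on `v - v'` and `w`, and in the second order bound also on
  -- the sizes of `v` and `v'`. A factor `b` comes from `s`.
  refine ⟨q, U, Φ, Ψ, b * l * a ^ 2 + b * k * a ^ 3, hΨ, add_nonneg hc1 hc2, ?_, ?_, ?_⟩
  · intro x hx v hv t ht
    refine hU (Or.inr ⟨(x, t • Φ₀.θ x v), ⟨hx, ?_⟩, ?_⟩)
    · rw [mem_closedBall_zero_iff, norm_smul, Real.norm_of_nonneg ht.1]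
      refine (mul_le_of_le_one_left (norm_nonneg _) ht.2).trans ((hθ₀ x hx v).trans ?_)
      exact mul_le_mul_of_nonneg_left hv hc₀
    · simp only [TangentFrame.fexp, expCurve]
      rw [map_smul, Φ₀.s_θ x (hU₀ hx)]
  · intro x hx v v' hv hv' w
    have h1 := hH x hx _ _ (hθR x hx v hv) (hθR x hx v' hv')
    have h2 : Φ.remH nabla exp Ψ x (Φ.θ x v) - Φ.remH nabla exp Ψ x (Φ.θ x v') =
        (Φ.matH nabla exp Ψ x (Φ.θ x v) - fderiv ℝ (Φ.matH nabla exp Ψ x) 0 (Φ.θ x v)) -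
        (Φ.matH nabla exp Ψ x (Φ.θ x v') - fderiv ℝ (Φ.matH nabla exp Ψ x) 0 (Φ.θ x v')) := by
      simp only [TangentFrame.remH]
      abel
    rw [← h2, ← map_sub] at h1
    have h3 : ‖Φ.remH nabla exp Ψ x (Φ.θ x v) - Φ.remH nabla exp Ψ x (Φ.θ x v')‖ ≤
        k * (a * ‖v‖ + a * ‖v'‖) * (a * ‖v - v'‖) := by
      refine h1.trans ?_
      gcongr
      · exact hθ x hx v
      · exact hθ x hx v'
      · exact hθ x hx _
    refine (hAB x hx _ _ _ h3 w).trans ?_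
    have h4 : b * (k * (a * ‖v‖ + a * ‖v'‖) * (a * ‖v - v'‖) * (a * ‖w‖)) =
      b * k * a ^ 3 * ((‖v‖ + ‖v'‖) * ‖v - v'‖) * ‖w‖ := by ring
    rw [h4]
    gcongr
    exact le_add_of_nonneg_left hc1
  · intro x hx v v' hv hv' w
    have h1 := hV x hx _ _ (hθR x hx v hv) (hθR x hx v' hv')
    have h2 : Φ.remV exp Ψ x (Φ.θ x v) - Φ.remV exp Ψ x (Φ.θ x v') =
        Φ.matV exp Ψ x (Φ.θ x v) - Φ.matV exp Ψ x (Φ.θ x v') := by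
      simp only [TangentFrame.remV]
      abel
    rw [← h2, ← map_sub] at h1
    have h3 : ‖Φ.remV exp Ψ x (Φ.θ x v) - Φ.remV exp Ψ x (Φ.θ x v')‖ ≤
        l * (a * ‖v - v'‖) :=
      h1.trans (mul_le_mul_of_nonneg_left (hθ x hx _) hl)
    refine (hAB x hx _ _ _ h3 w).trans ?_
    have h4 : b * (l * (a * ‖v - v'‖) * (a * ‖w‖)) = b * l * a ^ 2 * ‖v - v'‖ * ‖w‖ := by ring
    rw [h4]
    gcongr
    exact le_add_of_nonneg_right hc2

end Estimate

end DbarExpansion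

namespace DbarExpansion

/-! ### The estimate for admissible norms -/

section AdmissibleEstimate

variable {m : ℕ} {M : Type*} [TopologicalSpace M] [ChartedSpace (EuclideanSpace ℝ (Fin m)) M]
  [IsManifold (𝓡 m) ∞ M]

local notation "𝔼" => EuclideanSpace ℝ (Fin m)

local notation "TM" => (TangentSpace (𝓡 m) : M → Type _)

variable {nabla : CovariantDerivative (𝓡 m) (EuclideanSpace ℝ (Fin m))
  (TangentSpace (𝓡 m) : M → Type _)}
  {exp : TangentBundle (𝓡 m) M → M}

variable [RiemannianBundle (fun x : M => TangentSpace (𝓡 m) x)]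
  {W : Type} [NormedAddCommGroup W] [NormedSpace ℝ W] [FiniteDimensional ℝ W] {U : Set M}
  {Φ : TangentFrame (m := m) W U} {Ψ : M × W → W →L[ℝ] W}
  {d : ℕ} {S : Type*} [TopologicalSpace S] [ChartedSpace (EuclideanSpace ℝ (Fin d)) S]
  [IsManifold (𝓡 d) ∞ S]
  {J : ∀ x : M, TangentSpace (𝓡 m) x →L[ℝ] TangentSpace (𝓡 m) x}
  {j : ∀ z : S, TangentSpace (𝓡 d) z →L[ℝ] TangentSpace (𝓡 d) z} {f : S → M}
  {C₀ : ℝ} {normOne : (∀ z : S, TangentSpace (𝓡 m) (f z)) → ℝ}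
  {normZero : (∀ z : S, TangentSpace (𝓡 d) z →L[ℝ] TangentSpace (𝓡 m) (f z)) → ℝ}

/-- The constant `c` appears because `J` is not assumed to be isometric for `g`. -/
lemma normZero_zeroOnePart_le (hadm : IsAdmissible nabla j f C₀ normOne normZero)
    (hf : ContMDiff (𝓡 d) (𝓡 m) ∞ f)
    (hJ : IsSmoothHom (𝓡 m) (𝓡 m) (𝓡 m) (id : M → M) (id : M → M) J)
    (hj : IsSmoothHom (𝓡 d) (𝓡 d) (𝓡 d) (id : S → S) (id : S → S) j) {c : ℝ} (hc : 0 ≤ c)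
    (hJc : ∀ (z : S) (w : TangentSpace (𝓡 m) (f z)), ‖J (f z) w‖ ≤ c * ‖w‖)
    {η : ∀ z : S, TangentSpace (𝓡 d) z →L[ℝ] TangentSpace (𝓡 m) (f z)}
    (hη : IsSmoothHom (𝓡 d) (𝓡 m) (𝓡 d) (id : S → S) f η) :
    normZero (zeroOnePart J j f η) ≤ 1 / 2 * ((1 + c) * normZero η) := by
  have hηj : IsSmoothHom (𝓡 d) (𝓡 m) (𝓡 d) (id : S → S) f (fun z => (η z).comp (j z)) := fun z =>
    (hη.at z).comp (hj.at z) continuousAt_id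
  have hJf : IsSmoothHom (𝓡 m) (𝓡 m) (𝓡 d) f f (fun z => J (f z)) := fun z =>
    (hJ.at (f z)).comp_right (hf z)
  have hJη : IsSmoothHom (𝓡 d) (𝓡 m) (𝓡 d) (id : S → S) f
      (fun z => (J (f z)).comp ((η z).comp (j z))) := fun z =>
    (hJf.at z).comp (hηj.at z) (hf z).continuousAt
  have h1 := hadm.endo _ hJf c hc hJc _ hηj
  rw [hadm.comp_j η hη] at h1
  have h2 := hadm.isNormOn_zero.add_le _ hη _ hJη
  have h3 := hadm.isNormOn_zero.smul (1 / 2) (η + fun z => (J (f z)).comp ((η z).comp (j z)))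
    (fun z => (hη.at z).add (hJη.at z))
  have h4 : zeroOnePart J j f η =
      (1 / 2 : ℝ) • (η + fun z => (J (f z)).comp ((η z).comp (j z))) := rfl
  rw [h4, h3, abs_of_pos (by norm_num)]
  refine mul_le_mul_of_nonneg_left ?_ (by norm_num)
  linarith

/-- The difference is `A du + B ∇ξ + B' ∇(ξ - ξ')`, with `A` and `B` the differences of the
horizontal and vertical endomorphisms and `B'` the vertical one at `ξ'`. `A` is quadratic, giving
`C₀² ‖du‖_p`; the other two are linear and pair with `‖∇·‖_p ≤ ‖·‖_{p,1}`. -/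
lemma normZero_higherOrder_sub_le [T2Space M] (hsmooth : nabla.ContMDiffCovariantDerivative ∞)
    (hexp : IsExponentialLike (𝓡 m) exp)
    (hΨ : IsFrameTransport nabla exp Φ Ψ) {K : Set M} {R c : ℝ} (hc : 0 ≤ c)
    (hb : HigherOrderBound nabla exp Φ Ψ K R c) (hfK : ∀ z, f z ∈ K)
    (hadm : IsAdmissible nabla j f C₀ normOne normZero) (hC₀ : 0 ≤ C₀)
    (hf : ContMDiff (𝓡 d) (𝓡 m) ∞ f) {ξ ξ' : ∀ z : S, TangentSpace (𝓡 m) (f z)}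
    (hξ : IsSmoothAlong (𝓡 m) (𝓡 d) f ξ) (hξ' : IsSmoothAlong (𝓡 m) (𝓡 d) f ξ')
    (hR : C₀ * normOne ξ ≤ R) (hR' : C₀ * normOne ξ' ≤ R) :
    normZero (TangentFrame.higherOrder (F := EuclideanSpace ℝ (Fin d)) nabla exp Φ Ψ f ξ -
        TangentFrame.higherOrder (F := EuclideanSpace ℝ (Fin d)) nabla exp Φ Ψ f ξ') ≤
      c * (C₀ ^ 2 * normZero (mfderiv (𝓡 d) (𝓡 m) f) + C₀) * (normOne ξ + normOne ξ') *
        normOne (ξ - ξ') := by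
  have hδ := hξ.sub hξ'
  have hn := hadm.isNormOn_one.nonneg hξ hξ.neg_one_smul
  have hn' := hadm.isNormOn_one.nonneg hξ' hξ'.neg_one_smul
  have hnδ := hadm.isNormOn_one.nonneg hδ hδ.neg_one_smul
  have hs := hadm.sup_le ξ hξ
  have hs' := hadm.sup_le ξ' hξ'
  have hsδ := hadm.sup_le (ξ - ξ') hδ
  have hHs : ∀ {ζ : ∀ z : S, TangentSpace (𝓡 m) (f z)}, IsSmoothAlong (𝓡 m) (𝓡 d) f ζ →
      IsSmoothHom (𝓡 m) (𝓡 m) (𝓡 d) f f (fun z => Φ.endoH nabla exp Ψ (f z) (ζ z)) :=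
    fun hζ z => TangentFrame.isSmoothHomAt_endo (Φ := Φ)
      (TangentFrame.contMDiff_remH (Φ := Φ) hsmooth hexp.smooth hΨ.smooth) (hζ.at z)
  have hVs : ∀ {ζ : ∀ z : S, TangentSpace (𝓡 m) (f z)}, IsSmoothAlong (𝓡 m) (𝓡 d) f ζ →
      IsSmoothHom (𝓡 m) (𝓡 m) (𝓡 d) f f (fun z => Φ.endoV exp Ψ (f z) (ζ z)) :=
    fun hζ z => TangentFrame.isSmoothHomAt_endo (Φ := Φ)
      (TangentFrame.contMDiff_remV (Φ := Φ) hexp.smooth hΨ.smooth) (hζ.at z)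
  set A : ∀ z : S, TangentSpace (𝓡 m) (f z) →L[ℝ] TangentSpace (𝓡 m) (f z) := fun z =>
    Φ.endoH nabla exp Ψ (f z) (ξ z) - Φ.endoH nabla exp Ψ (f z) (ξ' z) with hA_def
  set B : ∀ z : S, TangentSpace (𝓡 m) (f z) →L[ℝ] TangentSpace (𝓡 m) (f z) := fun z =>
    Φ.endoV exp Ψ (f z) (ξ z) - Φ.endoV exp Ψ (f z) (ξ' z) with hB_def
  set B' : ∀ z : S, TangentSpace (𝓡 m) (f z) →L[ℝ] TangentSpace (𝓡 m) (f z) := fun z =>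
    Φ.endoV exp Ψ (f z) (ξ' z) with hB'_def
  have hA : IsSmoothHom (𝓡 m) (𝓡 m) (𝓡 d) f f A := fun z => ((hHs hξ).at z).sub ((hHs hξ').at z)
  have hB : IsSmoothHom (𝓡 m) (𝓡 m) (𝓡 d) f f B := fun z => ((hVs hξ).at z).sub ((hVs hξ').at z)
  have hB' : IsSmoothHom (𝓡 m) (𝓡 m) (𝓡 d) f f B' := hVs hξ'
  have hdf : IsSmoothHom (𝓡 d) (𝓡 m) (𝓡 d) (id : S → S) f (mfderiv (𝓡 d) (𝓡 m) f) := fun z =>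
    isSmoothHomAt_mfderiv (hf z)
  have hcξ := isSmoothHom_covAlong hsmooth hξ
  have hcδ := isSmoothHom_covAlong hsmooth hδ
  have e1 := hadm.endo A hA (c * ((C₀ * normOne ξ + C₀ * normOne ξ') * (C₀ * normOne (ξ - ξ'))))
    (by positivity) (fun z w => by
      refine (hb.horizontal _ (hfK z) _ _ ((hs z).trans hR) ((hs' z).trans hR') w).trans ?_
      gcongr
      · exact hs z
      · exact hs' z
      · exact hsδ z) _ hdf
  have e2 := hadm.endo B hB (c * (C₀ * normOne (ξ - ξ')))
    (by positivity) (fun z w => by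
      refine (hb.vertical _ (hfK z) _ _ ((hs z).trans hR) ((hs' z).trans hR') w).trans ?_
      gcongr
      exact hsδ z) _ hcξ
  -- The vertical endomorphism vanishes at zero, so its Lipschitz bound against `0` gives its size.
  have e3 := hadm.endo B' hB' (c * (C₀ * normOne ξ'))
    (by positivity) (fun z w => by
      have h0 : Φ.endoV exp Ψ (f z) (0 : TangentSpace (𝓡 m) (f z)) = 0 := by
        ext w
        simp [TangentFrame.endoV, TangentFrame.remV]
      have h1 := hb.vertical _ (hfK z) (ξ' z) 0 ((hs' z).trans hR')
        (by rw [norm_zero]; exact (norm_nonneg _).trans ((hs z).trans hR)) w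
      rw [h0, sub_zero, sub_zero] at h1
      refine h1.trans ?_
      gcongr
      exact hs' z) _ hcδ
  have hdec : TangentFrame.higherOrder (F := EuclideanSpace ℝ (Fin d)) nabla exp Φ Ψ f ξ -
        TangentFrame.higherOrder (F := EuclideanSpace ℝ (Fin d)) nabla exp Φ Ψ f ξ' =
      (fun z => (A z).comp (mfderiv (𝓡 d) (𝓡 m) f z)) +
        ((fun z => (B z).comp (covAlong nabla f ξ z)) +
          fun z => (B' z).comp (covAlong nabla f (ξ - ξ') z)) := by
    funext z
    have h1 : covAlong nabla f (ξ - ξ') z = covAlong nabla f ξ z - covAlong nabla f ξ' z :=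
      covAlong_sub ((hδ.at z).alongDiffAt (F := EuclideanSpace ℝ (Fin d)))
        ((hξ'.at z).alongDiffAt (F := EuclideanSpace ℝ (Fin d)))
    simp only [Pi.add_apply, Pi.sub_apply, TangentFrame.higherOrder, hA_def, hB_def, hB'_def, h1]
    ext v
    simp only [add_apply, sub_apply, ContinuousLinearMap.comp_apply, map_sub]
    abel
  have s1 : IsSmoothHom (𝓡 d) (𝓡 m) (𝓡 d) (id : S → S) f
      (fun z => (A z).comp (mfderiv (𝓡 d) (𝓡 m) f z)) := fun z =>
    (hA.at z).comp (hdf.at z) (hf z).continuousAt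
  have s2 : IsSmoothHom (𝓡 d) (𝓡 m) (𝓡 d) (id : S → S) f
      (fun z => (B z).comp (covAlong nabla f ξ z)) := fun z =>
    (hB.at z).comp (hcξ.at z) (hf z).continuousAt
  have s3 : IsSmoothHom (𝓡 d) (𝓡 m) (𝓡 d) (id : S → S) f
      (fun z => (B' z).comp (covAlong nabla f (ξ - ξ') z)) := fun z =>
    (hB'.at z).comp (hcδ.at z) (hf z).continuousAt
  have t1 := hadm.isNormOn_zero.add_le _ s1 _ (fun z => (s2.at z).add (s3.at z))
  have t2 := hadm.isNormOn_zero.add_le _ s2 _ s3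
  have c1 := mul_le_mul_of_nonneg_left (hadm.cov_le ξ hξ)
    (show 0 ≤ c * (C₀ * normOne (ξ - ξ')) by positivity)
  have c2 := mul_le_mul_of_nonneg_left (hadm.cov_le (ξ - ξ') hδ)
    (show 0 ≤ c * (C₀ * normOne ξ') by positivity)
  rw [hdec]
  refine t1.trans ((add_le_add e1 (t2.trans (add_le_add (e2.trans c1) (e3.trans c2)))).trans
    (le_of_eq ?_))
  ring

end AdmissibleEstimate

end DbarExpansion

namespace DbarExpansion

/-! ### The estimate of the remainder -/

section RemainderEstimate

variable {m : ℕ} {M : Type*} [TopologicalSpace M] [ChartedSpace (EuclideanSpace ℝ (Fin m)) M]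
  [IsManifold (𝓡 m) ∞ M]

local notation "𝔼" => EuclideanSpace ℝ (Fin m)

local notation "TM" => (TangentSpace (𝓡 m) : M → Type _)

variable {nabla : CovariantDerivative (𝓡 m) (EuclideanSpace ℝ (Fin m))
  (TangentSpace (𝓡 m) : M → Type _)}
  {exp : TangentBundle (𝓡 m) M → M}
-- The half-lines `[h x, ∞)` are convex and local upper bounds are locally constant selections,
-- which a partition of unity glues.
lemma exists_contDiff_majorant {h : ℝ → ℝ} (hb : ∀ x, ∃ b, ∀ᶠ y in 𝓝 x, h y ≤ b) :
    ∃ C : ℝ → ℝ, ContDiff ℝ ∞ C ∧ ∀ x, h x ≤ C x := by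
  obtain ⟨g, hg⟩ := exists_contMDiffMap_forall_mem_convex_of_local_const (n := ⊤) 𝓘(ℝ, ℝ)
    (t := fun x => Ici (h x)) (fun x => convex_Ici _) (fun x => hb x)
  exact ⟨g, g.contMDiff.contDiff, hg⟩

/-- One constant `g n` is available per integer radius, so the bound jumps with `x`. On bounded sets
only finitely many radii occur, which gives the local bound. -/
lemma exists_contDiff_majorant_ceil (g : ℕ → ℝ) :
    ∃ C : ℝ → ℝ, ContDiff ℝ ∞ C ∧ ∀ x, |g ⌈x ^ 2⌉₊| * |x ^ 3 + x| ≤ C x := by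
  refine exists_contDiff_majorant fun x => ?_
  refine ⟨(∑ i ∈ Finset.range (⌈(|x| + 1) ^ 2⌉₊ + 1), |g i|) * ((|x| + 1) ^ 3 + (|x| + 1)), ?_⟩
  filter_upwards [Metric.ball_mem_nhds x one_pos] with y hy
  have hy' : |y| ≤ |x| + 1 := by
    rw [Metric.mem_ball, Real.dist_eq] at hy
    have := abs_sub_abs_le_abs_sub y x
    linarith
  refine mul_le_mul ?_ ?_ (abs_nonneg _) (Finset.sum_nonneg fun _ _ => abs_nonneg _)
  · refine Finset.single_le_sum (f := fun i => |g i|) (fun i _ => abs_nonneg _) ?_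
    rw [Finset.mem_range, Nat.lt_succ_iff]
    refine Nat.ceil_mono ?_
    rw [← sq_abs y]
    gcongr
  · refine (abs_add_le _ _).trans ?_
    rw [abs_pow]
    gcongr

variable [T2Space M] [RiemannianBundle (fun x : M => TangentSpace (𝓡 m) x)]
  [IsContMDiffRiemannianBundle (𝓡 m) ∞ (EuclideanSpace ℝ (Fin m))
    (fun x : M => TangentSpace (𝓡 m) x)]
  {J : ∀ x : M, TangentSpace (𝓡 m) x →L[ℝ] TangentSpace (𝓡 m) x}

lemma exists_norm_endomorphism_le
    (hJ : IsSmoothHom (𝓡 m) (𝓡 m) (𝓡 m) (id : M → M) (id : M → M) J)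
    {K : Set M} (hK : IsCompact K) :
    ∃ C : ℝ, 0 ≤ C ∧ ∀ x ∈ K, ∀ v : TangentSpace (𝓡 m) x, ‖J x v‖ ≤ C * ‖v‖ := by
  obtain ⟨q, U, hU, ⟨Φ⟩⟩ := exists_tangentFrame (M := M) (m := m) hK
  obtain ⟨a, ha, hθ⟩ := Φ.exists_norm_θ_le hK hU
  obtain ⟨b, hb, hs⟩ := exists_norm_le_of_smooth (A := fun x => (J x).comp (Φ.s x))
    (fun c x => (hJ.at x).apply ((Φ.s_smooth c).at x) contMDiffAt_id) hK
  refine ⟨b * a, mul_nonneg hb ha, fun x hx v => ?_⟩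
  have h1 := hs x hx (Φ.θ x v)
  rw [ContinuousLinearMap.comp_apply, Φ.s_θ x (hU hx)] at h1
  refine h1.trans ?_
  rw [mul_assoc]
  exact mul_le_mul_of_nonneg_left (hθ x hx v) hb

/-- Let `s` be the argument of `C` and `n = ⌈s²⌉`. Both factors of `C₀ ‖ξ‖_{p,1}` are at most `s`,
so `ξ` and `ξ'` are bounded by `n` pointwise and the frame chosen for the radius `n` applies. The
factor `C₀² ‖du‖_p + C₀` is at most `s³ + s`. Thus the constant depends on `K` and `s` alone. -/
lemma exists_remainder_estimate (hsmooth : nabla.ContMDiffCovariantDerivative ∞)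
    (hexp : IsExponentialLike (𝓡 m) exp) (hmetric : nabla.IsMetricCompatible)
    (hJ : IsAlmostComplex (𝓡 m) J) (hnablaJ : IsJLinear nabla J)
    {K : Set M} (hK : IsCompact K) : ∃ C : ℝ → ℝ, ContDiff ℝ ∞ C ∧
      ∀ (d : ℕ) (S : Type w) [TopologicalSpace S] [ChartedSpace (EuclideanSpace ℝ (Fin d)) S]
        [IsManifold (𝓡 d) ∞ S]
        (j : ∀ z : S, TangentSpace (𝓡 d) z →L[ℝ] TangentSpace (𝓡 d) z), IsAlmostComplex (𝓡 d) j →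
      ∀ f : S → M, ContMDiff (𝓡 d) (𝓡 m) ∞ f → range f ⊆ K →
      ∀ C₀ : ℝ, 0 < C₀ →
      ∀ (normOne : (∀ z : S, TangentSpace (𝓡 m) (f z)) → ℝ)
        (normZero : (∀ z : S, TangentSpace (𝓡 d) z →L[ℝ] TangentSpace (𝓡 m) (f z)) → ℝ),
      IsAdmissible nabla j f C₀ normOne normZero →
      ∀ ξ ξ' : (∀ z : S, TangentSpace (𝓡 m) (f z)),
      IsSmoothAlong (𝓡 m) (𝓡 d) f ξ →
      IsSmoothAlong (𝓡 m) (𝓡 d) f ξ' →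
        normZero (remainder nabla exp J j f ξ - remainder nabla exp J j f ξ') ≤
          C (C₀ + normZero (mfderiv (𝓡 d) (𝓡 m) f) + normOne ξ + normOne ξ') *
            (normOne ξ + normOne ξ') * normOne (ξ - ξ') := by
  obtain ⟨a, ha, hJa⟩ := exists_norm_endomorphism_le hJ.smooth hK
  choose q U Φ Ψ c hΨ hc hb using fun n : ℕ =>
    exists_higherOrderBound hsmooth hexp hK (n : ℝ)
  obtain ⟨C, hC, hCle⟩ := exists_contDiff_majorant_ceil fun n => 1 / 2 * ((1 + a) * c n)
  refine ⟨C, hC, fun d S _ _ _ j hj f hf hfK C₀ hC₀ normOne normZero hadm ξ ξ' hξ hξ' => ?_⟩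
  have hfK' : ∀ z, f z ∈ K := fun z => hfK ⟨z, rfl⟩
  have hδ := hξ.sub hξ'
  have hn := hadm.isNormOn_one.nonneg hξ hξ.neg_one_smul
  have hn' := hadm.isNormOn_one.nonneg hξ' hξ'.neg_one_smul
  have hnδ := hadm.isNormOn_one.nonneg hδ hδ.neg_one_smul
  have hdf : IsSmoothHom (𝓡 d) (𝓡 m) (𝓡 d) (id : S → S) f (mfderiv (𝓡 d) (𝓡 m) f) := fun z =>
    isSmoothHomAt_mfderiv (hf z)
  have hnf := hadm.isNormOn_zero.nonneg hdf (fun z => (hdf.at z).const_smul (-1))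
  set s := C₀ + normZero (mfderiv (𝓡 d) (𝓡 m) f) + normOne ξ + normOne ξ' with hs
  set n := ⌈s ^ 2⌉₊
  have hsn : s ^ 2 ≤ n := Nat.le_ceil _
  have hCs : C₀ ≤ s := by linarith
  have hs0 : 0 ≤ s := hC₀.le.trans hCs
  have hR : C₀ * normOne ξ ≤ n := by
    refine le_trans ?_ hsn
    rw [sq]
    exact mul_le_mul hCs (by linarith) hn hs0
  have hR' : C₀ * normOne ξ' ≤ n := by
    refine le_trans ?_ hsn
    rw [sq]
    exact mul_le_mul hCs (by linarith) hn' hs0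
  have hmem : ∀ ζ : ∀ z : S, TangentSpace (𝓡 m) (f z), IsSmoothAlong (𝓡 m) (𝓡 d) f ζ →
      C₀ * normOne ζ ≤ n → remainder nabla exp J j f ζ = zeroOnePart J j f
        (TangentFrame.higherOrder (F := EuclideanSpace ℝ (Fin d)) nabla exp (Φ n) (Ψ n) f ζ) :=
    fun ζ hζ hζn => funext fun z =>
      remainder_eq_zeroOnePart hsmooth hexp hmetric hJ.smooth hnablaJ j (hΨ n)
        ((hζ.at z).alongDiffAt (F := EuclideanSpace ℝ (Fin d)))
        ((hb n).mem _ (hfK' z) _ ((hadm.sup_le ζ hζ z).trans hζn))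
  set η := TangentFrame.higherOrder (F := EuclideanSpace ℝ (Fin d)) nabla exp (Φ n) (Ψ n) f ξ
  set η' := TangentFrame.higherOrder (F := EuclideanSpace ℝ (Fin d)) nabla exp (Φ n) (Ψ n) f ξ'
  have hsub : remainder nabla exp J j f ξ - remainder nabla exp J j f ξ' =
      zeroOnePart J j f (η - η') := by
    rw [hmem ξ hξ hR, hmem ξ' hξ' hR']
    funext z
    ext v
    simp only [zeroOnePart, Pi.sub_apply, sub_apply, smul_apply, add_apply,
      ContinuousLinearMap.comp_apply, map_sub]
    module
  have hη : IsSmoothHom (𝓡 d) (𝓡 m) (𝓡 d) (id : S → S) f (η - η') := fun z =>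
    (isSmoothHomAt_higherOrder hsmooth hexp.smooth (hΨ n).smooth hξ z).sub
      (isSmoothHomAt_higherOrder hsmooth hexp.smooth (hΨ n).smooth hξ' z)
  have e1 := normZero_zeroOnePart_le hadm hf hJ.smooth hj.smooth ha
    (fun z w => hJa _ (hfK' z) w) hη
  have e2 := normZero_higherOrder_sub_le hsmooth hexp (hΨ n) (hc n) (hb n) hfK' hadm hC₀.le hf
    hξ hξ' hR hR'
  have e3 : C₀ ^ 2 * normZero (mfderiv (𝓡 d) (𝓡 m) f) + C₀ ≤ s ^ 3 + s := by
    have : s ^ 3 = s ^ 2 * s := by ring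
    rw [this]
    gcongr
    linarith
  have e4 := hCle s
  have hcn := hc n
  rw [abs_of_nonneg (by positivity), abs_of_nonneg (by positivity)] at e4
  rw [hsub]
  calc normZero (zeroOnePart J j f (η - η'))
      ≤ 1 / 2 * ((1 + a) * normZero (η - η')) := e1
    _ ≤ 1 / 2 * ((1 + a) * (c n * (C₀ ^ 2 * normZero (mfderiv (𝓡 d) (𝓡 m) f) + C₀) *
          (normOne ξ + normOne ξ') * normOne (ξ - ξ'))) := by gcongr
    _ ≤ 1 / 2 * ((1 + a) * (c n * (s ^ 3 + s) * (normOne ξ + normOne ξ') * normOne (ξ - ξ'))) := by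
        gcongr
    _ = (1 / 2 * ((1 + a) * c n) * (s ^ 3 + s)) * (normOne ξ + normOne ξ') * normOne (ξ - ξ') := by
        ring
    _ ≤ C s * (normOne ξ + normOne ξ') * normOne (ξ - ξ') := by gcongr

end RemainderEstimate

end DbarExpansion

namespace DbarExpansion

/-! ### Flat charts -/

section FlatChart

variable {m : ℕ} {M : Type*} [TopologicalSpace M] [ChartedSpace (EuclideanSpace ℝ (Fin m)) M]
  [IsManifold (𝓡 m) ∞ M]

local notation "𝔼" => EuclideanSpace ℝ (Fin m)

local notation "TM" => (TangentSpace (𝓡 m) : M → Type _)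

variable {nabla : CovariantDerivative (𝓡 m) (EuclideanSpace ℝ (Fin m))
  (TangentSpace (𝓡 m) : M → Type _)}
  {exp : TangentBundle (𝓡 m) M → M}
  {V : Type*} [NormedAddCommGroup V] [NormedSpace ℝ V]

/-- A chart in which `∇` is the standard flat connection and `exp` is addition. -/
structure IsFlatChart (nabla : CovariantDerivative (𝓡 m) (EuclideanSpace ℝ (Fin m))
      (TangentSpace (𝓡 m) : M → Type _)) (exp : TangentBundle (𝓡 m) M → M)
    (φ : OpenPartialHomeomorph M V) : Prop where
  smooth : ContMDiffOn (𝓡 m) 𝓘(ℝ, V) ∞ φ φ.source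
  smooth_symm : ContMDiffOn 𝓘(ℝ, V) (𝓡 m) ∞ φ.symm φ.target
  conn : ∀ σ : (∀ x : M, TangentSpace (𝓡 m) x), IsSmoothAlong (𝓡 m) (𝓡 m) (id : M → M) σ →
    ∀ x ∈ φ.source, ∀ v : TangentSpace (𝓡 m) x,
      mvfderiv (𝓡 m) φ x (nabla σ x v) =
        fderiv ℝ (fun y => mvfderiv (𝓡 m) φ (φ.symm y) (σ (φ.symm y))) (φ x)
          (mvfderiv (𝓡 m) φ x v)
  exp_eq : ∀ x ∈ φ.source, ∀ v : TangentSpace (𝓡 m) x,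
    segment ℝ (φ x) (φ x + mvfderiv (𝓡 m) φ x v) ⊆ φ.target →
      exp ⟨x, v⟩ = φ.symm (φ x + mvfderiv (𝓡 m) φ x v)

namespace IsFlatChart

variable {φ : OpenPartialHomeomorph M V} (hφ : IsFlatChart nabla exp φ)
include hφ

lemma contMDiffAt {x : M} (hx : x ∈ φ.source) : ContMDiffAt (𝓡 m) 𝓘(ℝ, V) ∞ φ x :=
  hφ.smooth.contMDiffAt (φ.open_source.mem_nhds hx)

lemma contMDiffAt_symm {y : V} (hy : y ∈ φ.target) : ContMDiffAt 𝓘(ℝ, V) (𝓡 m) ∞ φ.symm y :=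
  hφ.smooth_symm.contMDiffAt (φ.open_target.mem_nhds hy)

lemma mvfderiv_injective {x : M} (hx : x ∈ φ.source) {v v' : TangentSpace (𝓡 m) x}
    (h : mvfderiv (𝓡 m) φ x v = mvfderiv (𝓡 m) φ x v') : v = v' := by
  have h1 := mfderiv_comp x ((hφ.contMDiffAt_symm (φ.map_source hx)).mdifferentiableAt (by simp))
    ((hφ.contMDiffAt hx).mdifferentiableAt (by simp))
  have h2 : (φ.symm ∘ φ) =ᶠ[𝓝 x] id := by
    filter_upwards [φ.open_source.mem_nhds hx] with y hy
    exact φ.left_inv hy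
  rw [h2.mfderiv_eq, mfderiv_id] at h1
  have h3 := fun v => DFunLike.congr_fun h1 v
  have h4 : ∀ v : TangentSpace (𝓡 m) x, (v : 𝔼) = mfderiv 𝓘(ℝ, V) (𝓡 m) φ.symm (φ x)
    (mvfderiv (𝓡 m) φ x v) := h3
  have h5 := h4 v
  rw [h, ← h4 v'] at h5
  exact h5

lemma isSmoothHomAt_mvfderiv {x : M} (hx : x ∈ φ.source) :
    IsSmoothHomAt (𝓡 m) 𝓘(ℝ, V) (𝓡 m) (id : M → M) (fun _ => (0 : V))
      (fun x => mvfderiv (𝓡 m) φ x) x :=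
  (isSmoothHomAt_mfderiv (hφ.contMDiffAt hx)).change_model _

lemma contMDiffAt_repr {E₁ : Type*} [NormedAddCommGroup E₁] [NormedSpace ℝ E₁]
    {G : Type*} [TopologicalSpace G] {IN : ModelWithCorners ℝ E₁ G}
    {N : Type*} [TopologicalSpace N] [ChartedSpace G N]
    {f : N → M} {ξ : ∀ z : N, TangentSpace (𝓡 m) (f z)} {z : N}
    (hξ : IsSmoothAlongAt (𝓡 m) IN f ξ z) (hz : f z ∈ φ.source) :
    ContMDiffAt IN 𝓘(ℝ, V) ∞ (fun z => mvfderiv (𝓡 m) φ (f z) (ξ z)) z := by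
  have h1 := ((hφ.isSmoothHomAt_mvfderiv hz).comp_right hξ.contMDiffAt).apply hξ contMDiffAt_const
  exact (isSmoothAlongAt_model_iff contMDiffAt_const).1 h1

variable [T2Space M] {F : Type*} [NormedAddCommGroup F] [NormedSpace ℝ F]
  {N : Type*} [TopologicalSpace N] [ChartedSpace F N]

/-- In a flat chart the pulled back connection is differentiation. -/
lemma mvfderiv_covAlong {f : N → M} {ξ : ∀ z : N, TangentSpace (𝓡 m) (f z)} {z : N}
    (hξ : IsSmoothAlongAt (𝓡 m) 𝓘(ℝ, F) f ξ z) (hz : f z ∈ φ.source) (w : TangentSpace 𝓘(ℝ, F) z) :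
    mvfderiv (𝓡 m) φ (f z) (covAlong nabla f ξ z w) =
      mvfderiv 𝓘(ℝ, F) (fun z' => mvfderiv (𝓡 m) φ (f z') (ξ z')) z w := by
  obtain ⟨q, U, hU, ⟨Φ⟩⟩ := exists_tangentFrame (M := M) (m := m) (isCompact_singleton (x := f z))
  have hf := hξ.contMDiffAt
  set Z : N → Fin q → 𝔼 := fun z => Φ.θ (f z) (ξ z) with hZ_def
  have hZ : ContMDiffAt 𝓘(ℝ, F) 𝓘(ℝ, Fin q → 𝔼) ∞ Z z := Φ.contMDiff_repr hξ
  have he := Φ.eventually_eq ξ hf.continuousAt (hU rfl)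
  have hfd := hf.mdifferentiableAt (show (∞ : WithTop ℕ∞) ≠ 0 by simp)
  have hZd := hZ.mdifferentiableAt (show (∞ : WithTop ℕ∞) ≠ 0 by simp)
  -- `hφ.conn` concerns vector fields on `M`, so `ξ` is written as `s Z` and `P x c = dφ(s_x c)` is
  -- differentiated along `(f, Z)`. The derivative in `c` matches `s dZ`, and the derivative in `x`
  -- matches `∇(s c)` by `hφ.conn`.
  let P : M → (Fin q → 𝔼) →L[ℝ] V := fun x => (mvfderiv (𝓡 m) φ x).comp (Φ.s x)
  have hP : ∀ x ∈ φ.source, ContMDiffAt (𝓡 m) 𝓘(ℝ, (Fin q → 𝔼) →L[ℝ] V) ∞ P x := by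
    intro x hx
    have hs : IsSmoothHomAt 𝓘(ℝ, Fin q → 𝔼) (𝓡 m) (𝓡 m) (fun _ => (0 : Fin q → 𝔼)) id
        (fun x => Φ.s x) x := isSmoothHomAt_of_apply fun c => (Φ.s_smooth c).at x
    exact isSmoothHomAt_model_iff.1 ((hφ.isSmoothHomAt_mvfderiv hx).comp hs continuousAt_id)
  have hG : MDifferentiableAt ((𝓡 m).prod 𝓘(ℝ, Fin q → 𝔼)) 𝓘(ℝ, V)
      (fun p : M × (Fin q → 𝔼) => P p.1 p.2) (f z, Z z) := by
    have h1 : ContMDiffAt ((𝓡 m).prod 𝓘(ℝ, Fin q → 𝔼)) 𝓘(ℝ, V) ∞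
        (fun p : M × (Fin q → 𝔼) => P p.1 p.2) (f z, Z z) :=
      ((hP (f z) hz).comp (f := fun p : M × (Fin q → 𝔼) => p.1) (f z, Z z)
        contMDiffAt_fst).clm_apply contMDiffAt_snd
    exact h1.mdifferentiableAt (by simp)
  have h1 := mfderiv_comp (I := 𝓘(ℝ, F)) (I' := (𝓡 m).prod 𝓘(ℝ, Fin q → 𝔼)) (I'' := 𝓘(ℝ, V)) z
    (f := fun z => (f z, Z z)) hG (hfd.prodMk hZd)
  have h2 := DFunLike.congr_fun h1 w
  rw [ContinuousLinearMap.comp_apply, mfderiv_prodMk hfd hZd, mfderiv_prod_eq_add_apply hG] at h2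
  have h3 : (fun z' => mvfderiv (𝓡 m) φ (f z') (ξ z')) =ᶠ[𝓝 z] fun z' => P (f z') (Z z') := by
    filter_upwards [he] with z' hz'
    exact congrArg (mvfderiv (𝓡 m) φ (f z')) hz'
  have h4 : mvfderiv 𝓘(ℝ, F) (fun z' => mvfderiv (𝓡 m) φ (f z') (ξ z')) z w =
      mfderiv 𝓘(ℝ, F) 𝓘(ℝ, V) (fun z' => P (f z') (Z z')) z w := by
    rw [mvfderiv, h3.mfderiv_eq]
    rfl
  have h5 : mfderiv 𝓘(ℝ, Fin q → 𝔼) 𝓘(ℝ, V) (fun c => P (f z) c) (Z z) = P (f z) := by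
    rw [mfderiv_eq_fderiv]
    exact (P (f z)).fderiv
  have h6 : mfderiv (𝓡 m) 𝓘(ℝ, V) (fun x => P x (Z z)) (f z) =
      (fderiv ℝ (fun y => mvfderiv (𝓡 m) φ (φ.symm y) (Φ.s (φ.symm y) (Z z))) (φ (f z))).comp
        (mvfderiv (𝓡 m) φ (f z)) := by
    have h7 : (fun x => P x (Z z)) =ᶠ[𝓝 (f z)]
        (fun y => mvfderiv (𝓡 m) φ (φ.symm y) (Φ.s (φ.symm y) (Z z))) ∘ φ := by
      filter_upwards [φ.open_source.mem_nhds hz] with x hx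
      have : ∀ x' : M, x' = x → P x (Z z) = mvfderiv (𝓡 m) φ x' (Φ.s x' (Z z)) := by
        rintro _ rfl
        rfl
      exact this _ (φ.left_inv hx)
    have h8 : MDifferentiableAt 𝓘(ℝ, V) 𝓘(ℝ, V)
        (fun y => mvfderiv (𝓡 m) φ (φ.symm y) (Φ.s (φ.symm y) (Z z))) (φ (f z)) := by
      have h9 : ContMDiffAt 𝓘(ℝ, V) 𝓘(ℝ, V) ∞ (fun y => P (φ.symm y) (Z z)) (φ (f z)) := by
        have h10 := (hP (φ.symm (φ (f z))) (φ.map_target (φ.map_source hz))).comp (φ (f z))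
          (hφ.contMDiffAt_symm (φ.map_source hz))
        exact h10.clm_apply contMDiffAt_const
      exact h9.mdifferentiableAt (by simp)
    rw [h7.mfderiv_eq, mfderiv_comp (f z) h8 ((hφ.contMDiffAt hz).mdifferentiableAt (by simp)),
      mfderiv_eq_fderiv]
    rfl
  have h7 := hφ.conn (fun x => Φ.s x (Z z)) (Φ.s_smooth (Z z)) (f z) hz
    (mfderiv 𝓘(ℝ, F) (𝓡 m) f z w)
  rw [h4]
  refine Eq.trans ?_ h2.symm
  rw [covAlong_congr he]
  have h8 : covAlong (F := F) nabla f (fun z' => Φ.s (f z') (Φ.θ (f z') (ξ z'))) z =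
    (Φ.s (f z)).comp (mvfderiv 𝓘(ℝ, F) Z z) +
        (nabla (fun y => Φ.s y (Z z)) (f z)).comp (mfderiv 𝓘(ℝ, F) (𝓡 m) f z) :=
    Φ.covAlong_eq hfd hZd
  rw [h8, add_apply, map_add, add_comm]
  refine congrArg₂ (· + ·) ?_ ?_
  · refine Eq.trans h7 ?_
    exact (DFunLike.congr_fun h6 _).symm
  · exact (DFunLike.congr_fun h5 _).symm

end IsFlatChart

end FlatChart

end DbarExpansion

namespace DbarExpansion

/-! ### Curves in flat charts -/

lemma eventually_segment_subset {V : Type*} [NormedAddCommGroup V] [NormedSpace ℝ V] {T : Set V}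
    (hT : IsOpen T) {y c : V} (h : segment ℝ y (y + c) ⊆ T) :
    ∀ᶠ p : V × V in 𝓝 (y, c), segment ℝ p.1 (p.1 + p.2) ⊆ T := by
  have h1 : ∀ᶠ p : V × V in 𝓝 (y, c), ∀ θ ∈ Icc (0 : ℝ) 1, p.1 + θ • p.2 ∈ T := by
    refine isCompact_Icc.eventually_forall_of_forall_eventually fun θ hθ => ?_
    have hc : ContinuousAt (fun q : (V × V) × ℝ => q.1.1 + q.2 • q.1.2) ((y, c), θ) := by fun_prop
    refine hc (hT.mem_nhds (h ?_))
    rw [segment_eq_image']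
    exact ⟨θ, hθ, by simp⟩
  filter_upwards [h1] with p hp
  rw [segment_eq_image']
  rintro _ ⟨θ, hθ, rfl⟩
  simpa using hp θ hθ

section FlatChart

variable {m : ℕ} {M : Type*} [TopologicalSpace M] [ChartedSpace (EuclideanSpace ℝ (Fin m)) M]
  [IsManifold (𝓡 m) ∞ M]

local notation "𝔼" => EuclideanSpace ℝ (Fin m)

local notation "TM" => (TangentSpace (𝓡 m) : M → Type _)

variable {nabla : CovariantDerivative (𝓡 m) (EuclideanSpace ℝ (Fin m))
  (TangentSpace (𝓡 m) : M → Type _)}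
  {exp : TangentBundle (𝓡 m) M → M}
  {V : Type*} [NormedAddCommGroup V] [NormedSpace ℝ V]

namespace IsFlatChart

variable {φ : OpenPartialHomeomorph M V} (hφ : IsFlatChart nabla exp φ)
include hφ

lemma exp_mem {x : M} (hx : x ∈ φ.source) {v : TangentSpace (𝓡 m) x}
    (h : segment ℝ (φ x) (φ x + mvfderiv (𝓡 m) φ x v) ⊆ φ.target) : exp ⟨x, v⟩ ∈ φ.source := by
  rw [hφ.exp_eq x hx v h]
  exact φ.map_target (h (right_mem_segment ℝ _ _))

lemma apply_exp {x : M} (hx : x ∈ φ.source) {v : TangentSpace (𝓡 m) x}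
    (h : segment ℝ (φ x) (φ x + mvfderiv (𝓡 m) φ x v) ⊆ φ.target) :
    φ (exp ⟨x, v⟩) = φ x + mvfderiv (𝓡 m) φ x v := by
  rw [hφ.exp_eq x hx v h]
  exact φ.right_inv (h (right_mem_segment ℝ _ _))

/-- The condition on the segment is open, so the formula for `exp` persists near `z` and can be
differentiated. -/
lemma eventually_apply_exp {E₁ : Type*} [NormedAddCommGroup E₁] [NormedSpace ℝ E₁]
    {G : Type*} [TopologicalSpace G] {IN : ModelWithCorners ℝ E₁ G}
    {N : Type*} [TopologicalSpace N] [ChartedSpace G N]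
    {f : N → M} {ξ : ∀ z : N, TangentSpace (𝓡 m) (f z)} {z : N}
    (hξ : IsSmoothAlongAt (𝓡 m) IN f ξ z) (hz : f z ∈ φ.source)
    (h : segment ℝ (φ (f z)) (φ (f z) + mvfderiv (𝓡 m) φ (f z) (ξ z)) ⊆ φ.target) :
    ∀ᶠ z' in 𝓝 z, φ (exp ⟨f z', ξ z'⟩) = φ (f z') + mvfderiv (𝓡 m) φ (f z') (ξ z') := by
  have hf := hξ.contMDiffAt.continuousAt
  have h1 := ((φ.continuousAt hz).comp hf).prodMk (hφ.contMDiffAt_repr hξ hz).continuousAt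
  filter_upwards [h1 (eventually_segment_subset φ.open_target h),
    hf (φ.open_source.mem_nhds hz)] with z' hz' hz''
  exact hφ.apply_exp hz'' hz'

lemma mvfderiv_vel {γ : ℝ → M} {t : ℝ} (hγ : MDifferentiableAt 𝓘(ℝ, ℝ) (𝓡 m) γ t)
    (ht : γ t ∈ φ.source) {A : V} (h : HasDerivAt (fun t => φ (γ t)) A t) :
    mvfderiv (𝓡 m) φ (γ t) (vel γ t) = A := by
  have h1 := mfderiv_comp t ((hφ.contMDiffAt ht).mdifferentiableAt (by simp)) hγ
  have h2 : fderiv ℝ (fun t => φ (γ t)) t 1 = A := by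
    rw [fderiv_apply_one_eq_deriv, h.deriv]
  rw [← h2, ← mfderiv_eq_fderiv]
  exact (DFunLike.congr_fun h1 (1 : ℝ)).symm

variable [T2Space M]

lemma hasDerivAt_repr {γ : ℝ → M} {ζ : ∀ t, TangentSpace (𝓡 m) (γ t)} {t : ℝ}
    (hζ : IsSmoothAlongAt (𝓡 m) 𝓘(ℝ, ℝ) γ ζ t) (ht : γ t ∈ φ.source) :
    HasDerivAt (fun t => mvfderiv (𝓡 m) φ (γ t) (ζ t))
      (mvfderiv (𝓡 m) φ (γ t) (covDeriv nabla γ ζ t)) t := by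
  have h1 := (hφ.contMDiffAt_repr hζ ht).mdifferentiableAt (by simp)
  have h2 := h1.differentiableAt.hasDerivAt
  have h3 := hφ.mvfderiv_covAlong hζ ht (1 : ℝ)
  have h4 : deriv (fun t => mvfderiv (𝓡 m) φ (γ t) (ζ t)) t =
      mvfderiv (𝓡 m) φ (γ t) (covDeriv nabla γ ζ t) := by
    rw [← fderiv_apply_one_eq_deriv, ← mfderiv_eq_fderiv]
    exact h3.symm
  rwa [h4] at h2

lemma covDeriv_eq_zero {γ : ℝ → M} {ζ : ∀ t, TangentSpace (𝓡 m) (γ t)} {t : ℝ}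
    (hζ : IsSmoothAlongAt (𝓡 m) 𝓘(ℝ, ℝ) γ ζ t) (ht : γ t ∈ φ.source) {A : V}
    (h : ∀ᶠ t' in 𝓝 t, mvfderiv (𝓡 m) φ (γ t') (ζ t') = A) : covDeriv nabla γ ζ t = 0 := by
  have h1 := (hφ.hasDerivAt_repr hζ ht).unique ((hasDerivAt_const t A).congr_of_eventuallyEq h)
  exact hφ.mvfderiv_injective ht (h1.trans (map_zero _).symm)

/-- Parallel transport along a curve in a flat chart is constant. -/
lemma mvfderiv_isParallelTransport {x : M} {v X : TangentSpace (𝓡 m) x}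
    {Y : TangentSpace (𝓡 m) (exp ⟨x, v⟩)}
    (hγ : ∀ t ∈ Icc (0 : ℝ) 1, expCurve exp x v t ∈ φ.source)
    (h : IsParallelTransport nabla exp x v X Y) :
    mvfderiv (𝓡 m) φ (exp ⟨x, v⟩) Y = mvfderiv (𝓡 m) φ x X := by
  obtain ⟨ζ, hζ, hp, h0, h1⟩ := h
  have key : ∀ (y x' : M) (a : TangentSpace (𝓡 m) y) (c : TangentSpace (𝓡 m) x'),
      (⟨y, a⟩ : TangentBundle (𝓡 m) M) = ⟨x', c⟩ →
      mvfderiv (𝓡 m) φ y a = mvfderiv (𝓡 m) φ x' c := by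
    intro y x' a c hac
    obtain rfl : y = x' := congrArg TotalSpace.proj hac
    rw [eq_of_heq (TotalSpace.mk.inj hac).2]
  rw [← key _ _ _ _ h0, ← key _ _ _ _ h1]
  have hd : ∀ t ∈ Icc (0 : ℝ) 1, HasDerivAt
      (fun t => mvfderiv (𝓡 m) φ (expCurve exp x v t) (ζ t)) 0 t := by
    intro t ht
    have h2 := hφ.hasDerivAt_repr (hζ.at t) (hγ t ht)
    have h3 : covDeriv nabla (expCurve exp x v) ζ t = 0 := by
      rw [covDeriv, hp t ht]
      rfl
    rwa [h3, map_zero] at h2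
  refine constant_of_derivWithin_zero
    (fun t ht => (hd t ht).differentiableAt.differentiableWithinAt)
    (fun t ht => ?_) 1 ⟨zero_le_one, le_rfl⟩
  exact (hd t (Ico_subset_Icc_self ht)).hasDerivWithinAt.derivWithin
    (uniqueDiffOn_Icc zero_lt_one t (Ico_subset_Icc_self ht))

/-- The connection is torsion free on a flat chart. -/
lemma torsion_eq_zero (hexp : IsExponentialLike (𝓡 m) exp) {x : M} (hx : x ∈ φ.source)
    (a b : TangentSpace (𝓡 m) x) : nabla.torsion x b a = 0 := by
  -- Near the origin `φ ∘ α` is affine in `(s, t)`. Hence `∂_s α` and `∂_t α` have constant image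
  -- under `dφ`, both mixed covariant derivatives vanish at the origin, and their difference is the
  -- torsion.
  set α : ℝ → ℝ → M := fun s t => exp ⟨x, s • a + t • b⟩ with hα_def
  have hs : ContMDiff (𝓘(ℝ, ℝ).prod 𝓘(ℝ, ℝ)) (𝓡 m).tangent ∞
      (fun p : ℝ × ℝ => (⟨x, p.1 • a + p.2 • b⟩ : TangentBundle (𝓡 m) M)) := by
    intro p
    refine contMDiffAt_totalSpace.2 ⟨contMDiffAt_const, ?_⟩
    have hc : ∀ c : 𝔼, ContMDiffAt (𝓘(ℝ, ℝ).prod 𝓘(ℝ, ℝ)) 𝓘(ℝ, 𝔼) ∞ (fun _ : ℝ × ℝ => c) p :=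
      fun c => contMDiffAt_const
    refine ((contMDiffAt_fst.smul (hc (trivializationAt 𝔼 TM x ⟨x, a⟩).2)).add
      (contMDiffAt_snd.smul (hc (trivializationAt 𝔼 TM x ⟨x, b⟩).2))).congr_of_eventuallyEq
      (Filter.Eventually.of_forall fun t' => ?_)
    have hl := (trivializationAt 𝔼 TM x).linear ℝ (mem_baseSet_trivializationAt 𝔼 TM x)
    exact (hl.map_add _ _).trans (congrArg₂ (· + ·) (hl.map_smul _ _) (hl.map_smul _ _))
  have hα : ContMDiff (𝓘(ℝ, ℝ).prod 𝓘(ℝ, ℝ)) (𝓡 m) ∞ (Function.uncurry α) :=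
    hexp.smooth.comp hs
  have h0 : α 0 0 = x := by simp [hα_def, hexp.zero]
  have hsrc : ∀ᶠ p : ℝ × ℝ in 𝓝 (0, 0), α p.1 p.2 ∈ φ.source := by
    refine hα.continuous.continuousAt (φ.open_source.mem_nhds ?_)
    rwa [Function.uncurry_apply_pair, h0]
  have hlin : ∀ᶠ p : ℝ × ℝ in 𝓝 (0, 0), φ (α p.1 p.2) =
      φ x + (p.1 • mvfderiv (𝓡 m) φ x a + p.2 • mvfderiv (𝓡 m) φ x b) := by
    have h1 := hφ.eventually_apply_exp (f := fun _ : ℝ × ℝ => x)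
      (ξ := fun p => p.1 • a + p.2 • b) (hs (0, 0)) hx (by simpa using φ.map_source hx)
    filter_upwards [h1] with p hp
    simpa using hp
  have hαs : ∀ s t, ContMDiffAt 𝓘(ℝ, ℝ) (𝓡 m) ∞ (fun s => α s t) s := fun s t =>
    hα.contMDiffAt.comp (f := fun s => (s, t)) s (contMDiffAt_id.prodMk contMDiffAt_const)
  have hαt : ∀ s t, ContMDiffAt 𝓘(ℝ, ℝ) (𝓡 m) ∞ (fun t => α s t) t := fun s t =>
    hα.contMDiffAt.comp (f := fun t => (s, t)) t (contMDiffAt_const.prodMk contMDiffAt_id)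
  have h1 : covDeriv nabla (fun t => α 0 t) (fun t => vel (fun s => α s t) 0) 0 = 0 := by
    refine hφ.covDeriv_eq_zero (A := mvfderiv (𝓡 m) φ x a) ?_ (by rwa [h0]) ?_
    · have h1 := isSmoothHomAt_partial_mfderiv (I := 𝓘(ℝ, ℝ)) (I' := 𝓡 m) (IN := 𝓘(ℝ, ℝ))
        (f := fun t s => α s t) (g := fun _ => (0 : ℝ)) (z₀ := (0 : ℝ))
        (hα.contMDiffAt.comp (f := fun p : ℝ × ℝ => (p.2, p.1)) ((0 : ℝ), (0 : ℝ))
          (contMDiffAt_snd.prodMk contMDiffAt_fst)) contMDiffAt_const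
      exact h1.apply (ξ := fun _ => (1 : ℝ)) ((isSmoothAlongAt_model_iff contMDiffAt_const).2
        contMDiffAt_const) (hαt 0 0)
    · have h2 : Filter.Tendsto (fun q : ℝ × ℝ => (q.2, q.1)) (𝓝 (0 : ℝ) ×ˢ 𝓝 (0 : ℝ)) (𝓝 (0, 0)) := by
        rw [← nhds_prod_eq]
        exact continuous_swap.tendsto _
      -- After currying, for each small fixed `t` the affine formula holds for all `s` near `0`,
      -- which is what differentiation in `s` needs.
      filter_upwards [(h2.eventually hlin).curry, (h2.eventually hsrc).curry] with t ht ht'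
      refine hφ.mvfderiv_vel ((hαs 0 t).mdifferentiableAt (by simp)) ht'.self_of_nhds ?_
      refine HasDerivAt.congr_of_eventuallyEq ?_ ht
      have := (((hasDerivAt_id (0 : ℝ)).smul_const (mvfderiv (𝓡 m) φ x a)).add_const
        (t • mvfderiv (𝓡 m) φ x b)).const_add (φ x)
      simpa using this
  have h2 : covDeriv nabla (fun s => α s 0) (fun s => vel (fun t => α s t) 0) 0 = 0 := by
    refine hφ.covDeriv_eq_zero (A := mvfderiv (𝓡 m) φ x b) ?_ (by rwa [h0]) ?_
    · have h1 := isSmoothHomAt_partial_mfderiv (I := 𝓘(ℝ, ℝ)) (I' := 𝓡 m) (IN := 𝓘(ℝ, ℝ))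
        (f := fun s t => α s t) (g := fun _ => (0 : ℝ)) (z₀ := (0 : ℝ))
        hα.contMDiffAt contMDiffAt_const
      exact h1.apply (ξ := fun _ => (1 : ℝ)) ((isSmoothAlongAt_model_iff contMDiffAt_const).2
        contMDiffAt_const) (hαs 0 0)
    · rw [nhds_prod_eq] at hlin hsrc
      filter_upwards [hlin.curry, hsrc.curry] with s ht ht'
      refine hφ.mvfderiv_vel ((hαt s 0).mdifferentiableAt (by simp)) ht'.self_of_nhds ?_
      refine HasDerivAt.congr_of_eventuallyEq ?_ ht
      have := (((hasDerivAt_id (0 : ℝ)).smul_const (mvfderiv (𝓡 m) φ x b)).const_add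
        (s • mvfderiv (𝓡 m) φ x a)).const_add (φ x)
      simpa using this
  have h3 := covDeriv_vel_sub (nabla := nabla) hα 0 0
  rw [h1, h2, sub_zero] at h3
  have h4 : (vel (fun t => α 0 t) 0 : 𝔼) = b := by
    have : (fun t => α 0 t) = expCurve exp x b := by
      funext t
      simp [hα_def, expCurve]
    rw [this]
    exact vel_expCurve_zero hexp x b
  have h5 : (vel (fun s => α s 0) 0 : 𝔼) = a := by
    have : (fun s => α s 0) = expCurve exp x a := by
      funext t
      simp [hα_def, expCurve]
    rw [this]
    exact vel_expCurve_zero hexp x a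
  have h6 : ∀ (y y' : M) (a a' : TangentSpace (𝓡 m) y) (e e' : TangentSpace (𝓡 m) y'), y = y' →
      (a : 𝔼) = e → (a' : 𝔼) = e' →
      (nabla.torsion y a a' : 𝔼) = nabla.torsion y' e e' := by
    rintro y _ a a' e e' rfl h h'
    obtain rfl : a = e := h
    obtain rfl : a' = e' := h'
    rfl
  exact (h6 _ _ _ _ _ _ h0 h4 h5).symm.trans h3.symm

end IsFlatChart

end FlatChart

end DbarExpansion

namespace DbarExpansion

/-! ### The remainder in a flat chart -/

section FlatRemainder

variable {m : ℕ} {M : Type*} [TopologicalSpace M] [ChartedSpace (EuclideanSpace ℝ (Fin m)) M]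
  [IsManifold (𝓡 m) ∞ M]

local notation "𝔼" => EuclideanSpace ℝ (Fin m)

local notation "TM" => (TangentSpace (𝓡 m) : M → Type _)

variable {nabla : CovariantDerivative (𝓡 m) (EuclideanSpace ℝ (Fin m))
  (TangentSpace (𝓡 m) : M → Type _)}
  {exp : TangentBundle (𝓡 m) M → M}
  {V : Type*} [NormedAddCommGroup V] [NormedSpace ℝ V]
  [T2Space M] [RiemannianBundle (fun x : M => TangentSpace (𝓡 m) x)]
  [IsContMDiffRiemannianBundle (𝓡 m) ∞ (EuclideanSpace ℝ (Fin m))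
    (fun x : M => TangentSpace (𝓡 m) x)]
  {φ : OpenPartialHomeomorph M V}

namespace IsFlatChart

/-- In a flat chart the curve `γ_v` is a straight line, and its speed is constant. -/
lemma norm_vel_expCurve (hφ : IsFlatChart nabla exp φ)
    (hexp : IsExponentialLike (𝓡 m) exp) (hmetric : nabla.IsMetricCompatible)
    {x : M} (hx : x ∈ φ.source) {v : TangentSpace (𝓡 m) x} {T : ℝ} (hT : 0 ≤ T)
    (h : ∀ t ∈ Icc 0 T, segment ℝ (φ x) (φ x + t • mvfderiv (𝓡 m) φ x v) ⊆ φ.target) :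
    ‖vel (m := m) (expCurve exp x v) T‖ = ‖v‖ := by
  set γ := expCurve exp x v with hγ_def
  have hγ : ContMDiff 𝓘(ℝ, ℝ) (𝓡 m) ∞ γ := contMDiff_expCurve hexp.smooth x v
  have hvel : ∀ t, IsSmoothAlongAt (𝓡 m) 𝓘(ℝ, ℝ) γ (vel γ) t := fun t =>
    (isSmoothHomAt_mfderiv (hγ t)).apply (ξ := fun _ => (1 : ℝ))
      ((isSmoothAlongAt_model_iff contMDiffAt_id).2 contMDiffAt_const) (hγ t)
  have hopen : ∀ t ∈ Icc 0 T, ∀ᶠ t' in 𝓝 t,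
      segment ℝ (φ x) (φ x + t' • mvfderiv (𝓡 m) φ x v) ⊆ φ.target := by
    intro t ht
    have hc : ContinuousAt (fun t' : ℝ => (φ x, t' • mvfderiv (𝓡 m) φ x v)) t :=
      (continuous_const.prodMk (continuous_id.smul continuous_const)).continuousAt
    exact hc.eventually (eventually_segment_subset φ.open_target (h t ht))
  have hlin : ∀ t ∈ Icc 0 T, ∀ᶠ t' in 𝓝 t, γ t' ∈ φ.source ∧
      φ (γ t') = φ x + t' • mvfderiv (𝓡 m) φ x v := by
    intro t ht
    filter_upwards [hopen t ht] with t' ht'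
    rw [← map_smul] at ht'
    refine ⟨hφ.exp_mem hx ht', ?_⟩
    rw [← map_smul]
    exact hφ.apply_exp hx ht'
  have hcov : ∀ t ∈ Icc 0 T, covDeriv nabla γ (vel γ) t = 0 := by
    intro t ht
    refine hφ.covDeriv_eq_zero (hvel t) (hlin t ht).self_of_nhds.1
      (A := mvfderiv (𝓡 m) φ x v) ?_
    filter_upwards [(hlin t ht).eventually_nhds] with t' ht'
    refine hφ.mvfderiv_vel ((hγ t').mdifferentiableAt (by simp)) ht'.self_of_nhds.1 ?_
    refine HasDerivAt.congr_of_eventuallyEq ?_ (ht'.mono fun _ h => h.2)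
    simpa using ((hasDerivAt_id t').smul_const (mvfderiv (𝓡 m) φ x v)).const_add (φ x)
  have hd : ∀ t ∈ Icc 0 T, HasDerivAt (fun t => inner ℝ (vel (m := m) γ t) (vel γ t)) 0 t := by
    intro t ht
    have h1 := hasDerivAt_inner_along hmetric ((hvel t).alongDiffAt (F := ℝ))
      ((hvel t).alongDiffAt (F := ℝ))
    have h2 : covAlong (F := ℝ) nabla γ (vel γ) t (1 : ℝ) = 0 := hcov t ht
    rw [h2, inner_zero_left, inner_zero_right, add_zero] at h1
    exact h1
  have hconst : inner ℝ (vel (m := m) γ T) (vel γ T) = inner ℝ (vel (m := m) γ 0) (vel γ 0) := by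
    rcases hT.eq_or_lt with rfl | hT'
    · rfl
    refine constant_of_derivWithin_zero (f := fun t => inner ℝ (vel (m := m) γ t) (vel γ t))
      (fun t ht => (hd t ht).differentiableAt.differentiableWithinAt)
      (fun t ht => ?_) T ⟨hT, le_rfl⟩
    exact (hd t (Ico_subset_Icc_self ht)).hasDerivWithinAt.derivWithin
      (uniqueDiffOn_Icc hT' t (Ico_subset_Icc_self ht))
  have key : ∀ (y y' : M) (a : TangentSpace (𝓡 m) y) (a' : TangentSpace (𝓡 m) y'), y = y' →
      (a : 𝔼) = a' → ‖a‖ = ‖a'‖ := by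
    rintro y _ a a' rfl h
    obtain rfl : a = a' := h
    rfl
  rw [real_inner_self_eq_norm_sq, real_inner_self_eq_norm_sq] at hconst
  have h1 := (sq_eq_sq₀ (norm_nonneg _) (norm_nonneg _)).1 hconst
  exact h1.trans (key _ _ _ _ (expCurve_zero hexp x v) (vel_expCurve_zero hexp x v))

/-- If the domain of a flat chart is the metric ball of radius `δ` around `x`, then `γ_v` stays in
it for `‖v‖ < δ`. -/
lemma segment_subset (hφ : IsFlatChart nabla exp φ)
    (hexp : IsExponentialLike (𝓡 m) exp) (hmetric : nabla.IsMetricCompatible)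
    {x : M} {δ : ℝ} (hB : φ.source = riemannianBall m x δ) (hx : x ∈ φ.source)
    {v : TangentSpace (𝓡 m) x} (hv : ‖v‖ < δ) {t : ℝ} (ht : t ∈ Icc (0 : ℝ) 1) :
    segment ℝ (φ x) (φ x + t • mvfderiv (𝓡 m) φ x v) ⊆ φ.target := by
  suffices H : ∀ t ∈ Icc (0 : ℝ) 1, φ x + t • mvfderiv (𝓡 m) φ x v ∈ φ.target by
    rw [segment_eq_image']
    rintro _ ⟨θ, hθ, rfl⟩
    have := H (θ * t) ⟨mul_nonneg hθ.1 ht.1, mul_le_one₀ hθ.2 ht.1 ht.2⟩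
    simpa [smul_smul] using this
  by_contra! hbad
  set γ := expCurve exp x v with hγ_def
  have hγ : ContMDiff 𝓘(ℝ, ℝ) (𝓡 m) ∞ γ := contMDiff_expCurve hexp.smooth x v
  have hline : Continuous fun t : ℝ => φ x + t • mvfderiv (𝓡 m) φ x v :=
    continuous_const.add (continuous_id.smul continuous_const)
  have hZ : IsCompact (Icc (0 : ℝ) 1 ∩
      (fun t : ℝ => φ x + t • mvfderiv (𝓡 m) φ x v) ⁻¹' φ.targetᶜ) :=
    isCompact_Icc.inter_right (φ.open_target.isClosed_compl.preimage hline)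
  obtain ⟨t₁, ht₁, ht₁'⟩ := hbad
  -- `T` is the first time at which the straight line leaves `φ.target`. Before `T` the curve `γ`
  -- follows the line with constant speed `‖v‖`, so its length up to `T` is at most `‖v‖ < δ`. Since
  -- `exp` is globally defined, `γ T` makes sense and lies in the ball. By continuity `φ (γ T)` is
  -- the point of the line at time `T`, a contradiction.
  obtain ⟨T, ⟨hT, hT'⟩, hmin⟩ := hZ.exists_isLeast ⟨t₁, ht₁, ht₁'⟩
  have hT0 : 0 < T := by
    refine hT.1.lt_of_ne fun h => hT' ?_
    rw [← h]
    simpa using φ.map_source hx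
  have hgood : ∀ t ∈ Ico 0 T, segment ℝ (φ x) (φ x + t • mvfderiv (𝓡 m) φ x v) ⊆ φ.target := by
    intro t ht
    rw [segment_eq_image']
    rintro _ ⟨θ, hθ, rfl⟩
    by_contra h
    have h1 : θ * t ∈ Ico 0 T :=
      ⟨mul_nonneg hθ.1 ht.1, (mul_le_of_le_one_left ht.1 hθ.2).trans_lt ht.2⟩
    refine (hmin ⟨⟨h1.1, h1.2.le.trans hT.2⟩, ?_⟩).not_gt h1.2
    simpa [smul_smul] using h
  have hspeed : ∀ t ∈ Ico 0 T, ‖vel (m := m) γ t‖ = ‖v‖ := fun t ht =>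
    hφ.norm_vel_expCurve hexp hmetric hx ht.1 fun t' ht' => hgood t' ⟨ht'.1, ht'.2.trans_lt ht.2⟩
  have hdist : γ T ∈ φ.source := by
    rw [hB]
    refine lt_of_le_of_lt (Manifold.riemannianEDist_le_pathELength (γ := γ) (a := 0) (b := T)
      ((hγ.of_le (by simp)).contMDiffOn) (expCurve_zero hexp x v) rfl hT0.le) ?_
    rw [Manifold.pathELength_eq_lintegral_mfderiv_Ioo]
    calc _ = ∫⁻ _ in Ioo 0 T, ENNReal.ofReal ‖v‖ := by
          refine MeasureTheory.setLIntegral_congr_fun measurableSet_Ioo fun t ht => ?_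
          have h1 := hspeed t (Ioo_subset_Ico_self ht)
          rw [← h1, ofReal_norm]
          rfl
      _ = ENNReal.ofReal ‖v‖ * ENNReal.ofReal T := by
          rw [MeasureTheory.setLIntegral_const, Real.volume_Ioo, sub_zero]
      _ ≤ ENNReal.ofReal ‖v‖ * 1 := by
          gcongr
          exact ENNReal.ofReal_le_one.2 hT.2
      _ < ENNReal.ofReal δ := by
          rw [mul_one]
          exact (ENNReal.ofReal_lt_ofReal_iff_of_nonneg (norm_nonneg _)).2 hv
  have hlim : φ (γ T) = φ x + T • mvfderiv (𝓡 m) φ x v := by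
    have h1 : Filter.Tendsto (fun t => φ (γ t)) (𝓝[<] T) (𝓝 (φ (γ T))) :=
      ((φ.continuousAt hdist).comp hγ.continuous.continuousAt).tendsto.mono_left nhdsWithin_le_nhds
    have h2 := (hline.tendsto T).mono_left (nhdsWithin_le_nhds (s := Iio T))
    refine tendsto_nhds_unique h1 (h2.congr' ?_)
    filter_upwards [Ico_mem_nhdsLT hT0] with t ht
    have h3 := hgood t ht
    rw [← map_smul] at h3 ⊢
    exact (hφ.apply_exp hx h3).symm
  have h1 := φ.map_source hdist
  rw [hlim] at h1
  exact hT' h1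

variable {d : ℕ} {S : Type*} [TopologicalSpace S] [ChartedSpace (EuclideanSpace ℝ (Fin d)) S]
  {J : ∀ x : M, TangentSpace (𝓡 m) x →L[ℝ] TangentSpace (𝓡 m) x}
  {j : ∀ z : S, TangentSpace (𝓡 d) z →L[ℝ] TangentSpace (𝓡 d) z} {f : S → M}

/-- In the chart `exp_u ξ` is `u + ξ`, its differential is `du + ∇ξ`, and transport is the identity.
As the torsion vanishes, the pullback formula holds with `η = 0`. -/
lemma remainder_eq_zero (hφ : IsFlatChart nabla exp φ)
    (hsmooth : nabla.ContMDiffCovariantDerivative ∞)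
    (hexp : IsExponentialLike (𝓡 m) exp) (hmetric : nabla.IsMetricCompatible)
    (hJ : IsSmoothHom (𝓡 m) (𝓡 m) (𝓡 m) (id : M → M) (id : M → M) J) (hnablaJ : IsJLinear nabla J)
    {ξ : ∀ z : S, TangentSpace (𝓡 m) (f z)} (hξ : IsSmoothAlong (𝓡 m) (𝓡 d) f ξ) {z : S} {δ : ℝ}
    (hB : φ.source = riemannianBall m (f z) δ) (hδ : ‖ξ z‖ < δ) :
    remainder nabla exp J j f ξ z = 0 := by
  have hx : f z ∈ φ.source := by
    rw [hB]
    change Manifold.riemannianEDist (𝓡 m) (f z) (f z) < ENNReal.ofReal δ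
    rw [Manifold.riemannianEDist_self, ENNReal.ofReal_pos]
    exact (norm_nonneg _).trans_lt hδ
  have hseg := fun t ht => hφ.segment_subset hexp hmetric hB hx hδ (t := t) ht
  have hcurve : ∀ t ∈ Icc (0 : ℝ) 1, expCurve exp (f z) (ξ z) t ∈ φ.source := by
    intro t ht
    have := hseg t ht
    rw [← map_smul] at this
    exact hφ.exp_mem hx this
  have hseg1 := hseg 1 ⟨zero_le_one, le_rfl⟩
  rw [one_smul] at hseg1
  have hmem := hφ.exp_mem hx hseg1
  have hf := (hξ.at z).contMDiffAt.mdifferentiableAt (show (∞ : WithTop ℕ∞) ≠ 0 by simp)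
  have hexpξ : MDifferentiableAt (𝓡 d) (𝓡 m) (fun z' => exp ⟨f z', ξ z'⟩) z :=
    (hexp.smooth.contMDiffAt.comp z (hξ z)).mdifferentiableAt (by simp)
  have hrepr := (hφ.contMDiffAt_repr (hξ.at z) hx).mdifferentiableAt (by simp)
  have key : ∀ w : TangentSpace (𝓡 d) z,
      mvfderiv (𝓡 m) φ (exp ⟨f z, ξ z⟩) (mfderiv (𝓡 d) (𝓡 m) (fun z' => exp ⟨f z', ξ z'⟩) z w) =
        mvfderiv (𝓡 m) φ (f z) (mfderiv (𝓡 d) (𝓡 m) f z w + covAlong nabla f ξ z w) := by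
    intro w
    have h1 := mfderiv_comp z ((hφ.contMDiffAt hmem).mdifferentiableAt (by simp)) hexpξ
    have h2 := mfderiv_comp z ((hφ.contMDiffAt hx).mdifferentiableAt (by simp)) hf
    have h3 : (φ ∘ fun z' => exp ⟨f z', ξ z'⟩) =ᶠ[𝓝 z]
        (fun z' => (φ ∘ f) z' + mvfderiv (𝓡 m) φ (f z') (ξ z')) :=
      hφ.eventually_apply_exp (hξ.at z) hx hseg1
    have h4 : MDifferentiableAt (𝓡 d) 𝓘(ℝ, V) (φ ∘ f) z :=
      ((hφ.contMDiffAt hx).mdifferentiableAt (by simp)).comp z hf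
    have h5 := mfderiv_add h4 hrepr
    rw [h3.mfderiv_eq] at h1
    have h6 := DFunLike.congr_fun (h1.symm.trans h5) w
    rw [map_add, hφ.mvfderiv_covAlong (hξ.at z) hx]
    refine Eq.trans h6 ?_
    exact congrArg (fun A : V => A + mvfderiv (𝓡 d)
      (fun z' => mvfderiv (𝓡 m) φ (f z') (ξ z')) z w) (DFunLike.congr_fun h2 w)
  have hrem := remainder_eq_zeroOnePart_of_pullback hsmooth hexp hmetric hJ hnablaJ j (f := f)
    (ξ := ξ) (z := z) (η := fun _ => 0) fun w => ?_
  · rw [hrem]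
    simp [zeroOnePart]
  · rw [hφ.torsion_eq_zero hexp hx, sub_zero, zero_apply, zero_add]
    refine hφ.mvfderiv_injective hx ?_
    rw [← key w]
    refine (hφ.mvfderiv_isParallelTransport hcurve ?_).symm
    have := parallelTransport_spec hsmooth hexp hmetric (f z) (ξ z)
      ((parallelTransport nabla exp (f z) (ξ z)).symm
        (mfderiv (𝓡 d) (𝓡 m) (fun z' => exp ⟨f z', ξ z'⟩) z w))
    rwa [ContinuousLinearEquiv.apply_symm_apply] at this

end IsFlatChart

omit [T2Space M] [RiemannianBundle (fun x : M => TangentSpace (𝓡 m) x)]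
  [IsContMDiffRiemannianBundle (𝓡 m) ∞ (EuclideanSpace ℝ (Fin m))
    (fun x : M => TangentSpace (𝓡 m) x)] in
lemma IsStandardOn.exists_isFlatChart {J : ∀ x : M, TangentSpace (𝓡 m) x →L[ℝ] TangentSpace (𝓡 m) x}
    {B : Set M} (h : IsStandardOn nabla exp J B) :
    ∃ (n : ℕ) (φ : OpenPartialHomeomorph M (EuclideanSpace ℂ (Fin n))),
      φ.source = B ∧ IsFlatChart nabla exp φ := by
  obtain ⟨n, φ, rfl, h1, h2, -, h3, h4⟩ := h
  exact ⟨n, φ, rfl, h1, h2, h3, h4⟩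

end FlatRemainder

end DbarExpansion

open DbarExpansion in
theorem mainTheorem3 {m : ℕ} {M : Type u} [TopologicalSpace M]
    [ChartedSpace (EuclideanSpace ℝ (Fin m)) M] [IsManifold (𝓡 m) ∞ M]
    [T2Space M] [SecondCountableTopology M]
    [RiemannianBundle (fun x : M => TangentSpace (𝓡 m) x)]
    [IsContMDiffRiemannianBundle (𝓡 m) ∞ (EuclideanSpace ℝ (Fin m))
      (fun x : M => TangentSpace (𝓡 m) x)]
    (J : ∀ x : M, TangentSpace (𝓡 m) x →L[ℝ] TangentSpace (𝓡 m) x) (hJ : IsAlmostComplex (𝓡 m) J)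
    (exp : TangentBundle (𝓡 m) M → M) (hexp : IsExponentialLike (𝓡 m) exp)
    (nabla : CovariantDerivative (𝓡 m) (EuclideanSpace ℝ (Fin m))
      (TangentSpace (𝓡 m) : M → Type _))
    (hsmooth : nabla.ContMDiffCovariantDerivative ∞)
    (hmetric : nabla.IsMetricCompatible) (hnablaJ : IsJLinear nabla J) :
    (∀ K : Set M, IsCompact K → ∃ C : ℝ → ℝ, ContDiff ℝ ∞ C ∧
      ∀ (d : ℕ) (S : Type w) [TopologicalSpace S] [ChartedSpace (EuclideanSpace ℝ (Fin d)) S]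
        [IsManifold (𝓡 d) ∞ S] [T2Space S] [SecondCountableTopology S]
        (j : ∀ z : S, TangentSpace (𝓡 d) z →L[ℝ] TangentSpace (𝓡 d) z), IsAlmostComplex (𝓡 d) j →
      ∀ f : S → M, ContMDiff (𝓡 d) (𝓡 m) ∞ f → range f ⊆ K →
      ∀ C₀ : ℝ, 0 < C₀ →
      ∀ (normOne : (∀ z : S, TangentSpace (𝓡 m) (f z)) → ℝ)
        (normZero : (∀ z : S, TangentSpace (𝓡 d) z →L[ℝ] TangentSpace (𝓡 m) (f z)) → ℝ),
      IsAdmissible nabla j f C₀ normOne normZero →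
      ∀ ξ ξ' : (∀ z : S, TangentSpace (𝓡 m) (f z)),
      IsSmoothAlong (𝓡 m) (𝓡 d) f ξ →
      IsSmoothAlong (𝓡 m) (𝓡 d) f ξ' →
        normZero (remainder nabla exp J j f ξ - remainder nabla exp J j f ξ') ≤
          C (C₀ + normZero (mfderiv (𝓡 d) (𝓡 m) f) + normOne ξ + normOne ξ') *
            (normOne ξ + normOne ξ') * normOne (ξ - ξ')) ∧
    (∀ (d : ℕ) (S : Type w) [TopologicalSpace S] [ChartedSpace (EuclideanSpace ℝ (Fin d)) S]
        [IsManifold (𝓡 d) ∞ S] [T2Space S] [SecondCountableTopology S]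
        (j : ∀ z : S, TangentSpace (𝓡 d) z →L[ℝ] TangentSpace (𝓡 d) z), IsAlmostComplex (𝓡 d) j →
      ∀ f : S → M, ContMDiff (𝓡 d) (𝓡 m) ∞ f →
        remainder nabla exp J j f 0 = 0 ∧
        ∀ ξ : (∀ z : S, TangentSpace (𝓡 m) (f z)),
          IsSmoothAlong (𝓡 m) (𝓡 d) f ξ →
          IsZeroOneForm J j f (remainder nabla exp J j f ξ) ∧
          ∀ (z : S) (δ : ℝ), IsStandardOn nabla exp J (riemannianBall m (f z) δ) → ‖ξ z‖ < δ →
            remainder nabla exp J j f ξ z = 0) := by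
  refine ⟨fun K hK => ?_, fun d S _ _ _ _ _ j hj f hf =>
    ⟨remainder_zero hsmooth hexp hmetric hJ.smooth hnablaJ hf, fun ξ hξ =>
      ⟨isZeroOneForm_remainder hsmooth hexp hmetric hJ hnablaJ hj hξ, fun z δ hstd hδ => ?_⟩⟩⟩
  · obtain ⟨C, hC, h⟩ := exists_remainder_estimate hsmooth hexp hmetric hJ hnablaJ hK
    exact ⟨C, hC, fun d S _ _ _ _ _ => h d S⟩
  · obtain ⟨n, φ, hB, hφ⟩ := hstd.exists_isFlatChart
    exact hφ.remainder_eq_zero hsmooth hexp hmetric hJ.smooth hnablaJ hξ hB hδ
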